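/- **CONGEST model.** A network is a finite connected undirected graph on $n$ vertices whose vertices carry distinct $O(\log n)$-bit identifiers. Initially each vertex knows its own identifier, the identifiers of its neighbours, its local input and a private infinite string of independent fair random bits; it knows neither $n$ nor the diameter. All vertices run the same algorithm in synchronous rounds. In each round each vertex may send a (possibly distinct) message of $O(\log n)$ bits to each of its neighbours, and then performs unrestricted local computation. At any time a vertex may halt with an irrevocable output, after which it sends nothing more. **Replacement Paths.** Let $G=(V,E)$ be an unweighted directed graph with $n$ vertices whose underlying undirected graph is connected, with (undirected) diameter $D$, and let $P=(s=v_0,v_1,\dots,v_h=t)$ be a given shortest directed path from $s$ to $t$ in $G$. The communication network is the underlying undirected graph of $G$. The local input of a vertex $v$ tells it which directed edges of $G$ enter and leave it, which of these edges belong to $P$, and whether $v=s$ and whether $v=t$. The task is that, for each $0\le i<h$, the vertex $v_i$ outputs $|st\diamond(v_i,v_{i+1})|$, the length (number of edges) of a shortest directed path from $s$ to $t$ in $G$ avoiding the edge $(v_i,v_{i+1})$, or $\infty$ if there is no such path. **Theorem 1.1.** There is a randomized CONGEST algorithm that solves Replacement Paths in unweighted directed graphs in $\widetilde O(n^{2/3}+D)$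 rounds with high probability. That is, for every constant $\kappa$ and every constant $c$ there are an algorithm $\mathcal A$ and constants $B,C,k$ such that, for every instance as above on $n\ge 1$ vertices with identifiers in $\{0,\dots,2^{\kappa\ell}-1\}$, where $\ell=\lfloor\log_2 n\rfloor+1$: in every execution all messages have at most $B\ell$ bits; there is an integer $T\le C\,\ell^{k}\,(n^{2/3}+D)$ such that in every execution all vertices have halted after at most $T$ rounds; and, with probability at least $1-n^{-c}$ over the random bits, every $v_i$ with $0\le i<h$ outputs $|st\diamond(v_i,v_{i+1})|$. -/

import Mathlib

open MeasureTheory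

/-! ## The CONGEST model -/

/-- `bitLength n = ⌊log₂ n⌋ + 1`, the number of bits of `n`; it stands for `log n` in all bounds. -/
def bitLength (n : ℕ) : ℕ := Nat.log 2 n + 1

/-- A communication network on the vertex set `V`: an undirected graph of communication links
together with pairwise distinct identifiers. -/
structure Network (V : Type) where
  link : SimpleGraph V
  id : V → ℕ
  id_injective : Function.Injective id

/-- What a vertex knows before the first round: its own identifier, the identifiers of its
neighbours, and its local input of type `X`. In particular it knows neither the number of vertices
nor the diameter. -/
structure LocalView (X : Type) where
  ownId : ℕ
  nbrIds : Set ℕ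
  input : X

/-- A randomized distributed algorithm with local inputs in `X` and local outputs in `Y`. All
vertices run the same algorithm; local computation is unrestricted.
* `start` gives the initial state, from the local view and a private infinite string of random bits;
* `send σ i` is the message that a vertex in state `σ` sends to its neighbour with identifier `i`
  in the current round (the empty bit string being silence);
* `step σ m` is the next state of a vertex in state `σ` when `m i` is the message received from
  the neighbour with identifier `i`;
* `output σ` is `none` while the vertex is running, and `some y` if it has halted with output `y`. -/
structure DistAlgorithm (X Y : Type) where
  State : Type
  start : LocalView X → (ℕ → Bool) → State
  send : State → ℕ → List Bool
  step : State → (ℕ → List Bool) → State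
  output : State → Option Y

/-- Outcomes of the private random strings of all vertices. -/
abbrev RandomStrings (V : Type) : Type := V → ℕ → Bool

/-- All random bits of all vertices are independent fair coin flips. -/
noncomputable def coinMeasure (V : Type) [Fintype V] : Measure (RandomStrings V) :=
  Measure.pi fun _ : V =>
    Measure.infinitePi fun _ : ℕ => (PMF.uniformOfFintype Bool).toMeasure

namespace DistAlgorithm

variable {X Y V : Type}

/-- The message that `u`, in state `σ`, sends to its neighbour `v`. A vertex that has halted
sends nothing. -/
def message (A : DistAlgorithm X Y) (N : Network V) (σ : A.State) (v : V) : List Bool :=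
  match A.output σ with
  | some _ => []
  | none => A.send σ (N.id v)

open Classical in
/-- The messages delivered to `v` in one round, indexed by the identifier of the sender, when the
states of the vertices are given by `σ`. -/
noncomputable def inbox (A : DistAlgorithm X Y) (N : Network V) (σ : V → A.State) (v : V) :
    ℕ → List Bool :=
  Function.extend N.id (fun u => if N.link.Adj u v then A.message N (σ u) v else [])
    (fun _ => [])

/-- The local view of the vertex `v`. -/
def view (N : Network V) (x : V → X) (v : V) : LocalView X where
  ownId := N.id v
  nbrIds := N.id '' {u | N.link.Adj u v}
  input := x v

/-- The states of all vertices after `r` synchronous rounds, on the network `N` with local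
inputs `x` and random strings `ω`. A vertex that has halted never changes its state again. -/
noncomputable def run (A : DistAlgorithm X Y) (N : Network V) (x : V → X)
    (ω : RandomStrings V) : ℕ → V → A.State
  | 0 => fun v => A.start (view N x v) (ω v)
  | r + 1 => fun v =>
    match A.output (A.run N x ω r v) with
    | some _ => A.run N x ω r v
    | none => A.step (A.run N x ω r v) (A.inbox N (A.run N x ω r) v)

/-- The output of the vertex `v` after `r` rounds (`none` if it has not halted yet). -/
noncomputable def outputAt (A : DistAlgorithm X Y) (N : Network V) (x : V → X)
    (ω : RandomStrings V) (r : ℕ) (v : V) : Option Y :=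
  A.output (A.run N x ω r v)

/-- In every round of every execution, every message has at most `b` bits. -/
def MessagesBoundedBy (A : DistAlgorithm X Y) (N : Network V) (x : V → X) (b : ℕ) : Prop :=
  ∀ (ω : RandomStrings V) (r : ℕ) (u v : V), N.link.Adj u v →
    (A.message N (A.run N x ω r u) v).length ≤ b

/-- In every execution, every vertex has halted after at most `T` rounds. -/
def HaltsWithin (A : DistAlgorithm X Y) (N : Network V) (x : V → X) (T : ℕ) : Prop :=
  ∀ (ω : RandomStrings V) (v : V), (A.outputAt N x ω T v).isSome

end DistAlgorithm

/-! ## Replacement paths in unweighted directed graphs -/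

/-- The vertex sequence `p₀, …, p_k` is a directed walk with `k` edges from `u` to `v` in `G`. -/
def IsDiwalk {V : Type} (G : Digraph V) (u v : V) {k : ℕ} (p : Fin (k + 1) → V) : Prop :=
  p 0 = u ∧ p (Fin.last k) = v ∧ ∀ i : Fin k, G.Adj (p i.castSucc) (p i.succ)

/-- The length of a shortest directed path from `u` to `v` in `G`, and `∞` if there is none.
(A walk of minimum length has no repeated vertex.) -/
noncomputable def didist {V : Type} (G : Digraph V) (u v : V) : ℕ∞ :=
  ⨅ (k : ℕ) (_ : ∃ p : Fin (k + 1) → V, IsDiwalk G u v p), (k : ℕ∞)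

/-- `G` without the directed edge `(a, b)`. -/
def removeEdge {V : Type} (G : Digraph V) (a b : V) : Digraph V where
  Adj x y := G.Adj x y ∧ ¬ (x = a ∧ y = b)

/-- An instance of the replacement paths problem: an unweighted directed graph, whose underlying
undirected graph is connected, with distinct identifiers, and a shortest path `v₀, …, v_h`
from the source `s = v₀` to the target `t = v_h`. -/
structure RPathsInstance (V : Type) where
  graph : Digraph V
  connected : graph.toSimpleGraphInclusive.Connected
  id : V → ℕ
  id_injective : Function.Injective id
  source : V
  target : V
  /-- the number of edges of the given path -/
  hops : ℕ
  path : Fin (hops + 1) → V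
  isDiwalk_path : IsDiwalk graph source target path
  isShortest_path : didist graph source target = hops

/-- The local input of a vertex: the identifiers of its out-neighbours and in-neighbours, which of
the edges to and from them belong to the given path, and whether it is the source, the target. -/
structure RPathsInput where
  outIds : Set ℕ
  inIds : Set ℕ
  pathOutIds : Set ℕ
  pathInIds : Set ℕ
  isSource : Prop
  isTarget : Prop

namespace RPathsInstance

variable {V : Type}

/-- Communication takes place, in both directions, along all edges of the graph. -/
def network (I : RPathsInstance V) : Network V where
  link := I.graph.toSimpleGraphInclusive
  id := I.id
  id_injective := I.id_injective

/-- The unweighted undirected diameter `D`. -/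
noncomputable def diam (I : RPathsInstance V) : ℕ := I.graph.toSimpleGraphInclusive.diam

/-- The directed edge `(a, b)` belongs to the given path. -/
def OnPath (I : RPathsInstance V) (a b : V) : Prop :=
  ∃ i : Fin I.hops, I.path i.castSucc = a ∧ I.path i.succ = b

/-- The initial knowledge of the vertex `v`. -/
def localInput (I : RPathsInstance V) (v : V) : RPathsInput where
  outIds := I.id '' {w | I.graph.Adj v w}
  inIds := I.id '' {w | I.graph.Adj w v}
  pathOutIds := I.id '' {w | I.OnPath v w}
  pathInIds := I.id '' {w | I.OnPath w v}
  isSource := v = I.source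
  isTarget := v = I.target

/-- `|st ⋄ (vᵢ, vᵢ₊₁)|`: the length of a shortest path from `s` to `t` avoiding the `i`-th edge of
the given path, and `∞` if there is none. -/
noncomputable def replacementLength (I : RPathsInstance V) (i : Fin I.hops) : ℕ∞ :=
  didist (removeEdge I.graph (I.path i.castSucc) (I.path i.succ)) I.source I.target

/-- After `T` rounds, every vertex `vᵢ` with `0 ≤ i < h` has output `|st ⋄ (vᵢ, vᵢ₊₁)|`. -/
def SolvedBy (I : RPathsInstance V) (A : DistAlgorithm RPathsInput ℕ∞) (T : ℕ)
    (ω : RandomStrings V) : Prop :=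
  ∀ i : Fin I.hops,
    A.outputAt I.network I.localInput ω T (I.path i.castSucc) = some (I.replacementLength i)

end RPathsInstance

/-! A shortest replacement path for the `i`-th edge may be assumed to follow `P` up to some `v_a`
with `a ≤ i`, then make a detour without edges of `P` to some `v_j` with `j > i`, and then follow
`P` to `t`. Indeed, whatever a walk does before it uses an edge of `P` in front of the `i`-th one
can be exchanged for an initial segment of `P`, which is a shortest path (`exists_detour`; converse
`replacementLength_le`). So the answer is the minimum of `a + d + (h - j)` over off-path walks of
length `d`. Fix `z` of order `n^(2/3)`.

Detours of length at most `z`: relaxing backwards off `P` for `z` rounds tells each `v_a`, for every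
`δ ≤ z`, the farthest `v_j` reached by an off-path walk with `δ` edges. Another `z` rounds carry the
resulting candidates forward along `P` (`runs_shortDetour`).

Longer detours: declare each vertex a landmark with probability of order `log n / n^(2/3)`. With
high probability there are at most `K = Õ(n^(1/3))` landmarks, and every shortest walk with `z`
edges, on or off `P`, can be rerouted through one at no cost (`coinMeasure_sampling`). A long detour
then passes a landmark `x`, and the two sides of `x` separate: add the minimum over `a ≤ i` of `a +
d(v_a, x)` to the minimum over `j > i` of `d(x, v_j) + h - j`, and minimise over `x`.

Landmark distances are computed by source detection up to range `z + 1`, in `z + 1 + K` rounds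
(`estimate_eq`), by broadcasting the `K²` short distances between landmarks (`gossip_progress`), and
by local composition of chains (`chainDist_eq`). The prefix and suffix minima are pipelined over
windows of `P`, the landmarks on `P` publishing their values to bridge longer gaps
(`runs_prefixMin`, `runs_suffixMin`). All this takes `O(z + K² + D)` rounds, and `K² = Õ(n^(2/3))`.

Since `n` and `D` are unknown, the depth of the network seen from `s` is guessed as `1, 2, 4, …`.
For each guess a census either fails at all vertices simultaneously or tells all of them `n`; the
costs form a geometric sum of order `D`. Bounds on rounds and messages hold in every execution,
because the phases have fixed lengths and messages that could grow too long are suppressed. Chance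
affects only correctness, through the event `GoodParams`. -/

namespace Congest

/-! ### Local programs, their synchronous executions, and compilation to the model. -/

section Programs

variable {V X Y α β : Type}

/-- A local program of one vertex: it either returns a value, or broadcasts a number to all
neighbours (`0` being silence) and continues with the numbers heard, indexed by sender. -/
inductive Prog (α : Type) : Type
  | ret : α → Prog α
  | round : ℕ → ((ℕ → ℕ) → Prog α) → Prog α

namespace Prog

/-- Sequential composition of local programs. -/
def bind : Prog α → (α → Prog β) → Prog β
  | ret a, f => f a
  | round m k, f => round m fun i => (k i).bind f

/-- Run a state machine for `T` rounds, starting at time `t`. -/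
def loop (out : ℕ → α → ℕ) (step : ℕ → α → (ℕ → ℕ) → α) : ℕ → ℕ → α → Prog α
  | _, 0, s => ret s
  | t, T + 1, s => round (out t s) fun i => loop out step (t + 1) T (step t s i)

end Prog

open Classical in
/-- The numbers heard by `v` when every vertex `u` broadcasts `m u`. -/
noncomputable def hear (N : Network V) (m : V → ℕ) (v : V) : ℕ → ℕ :=
  Function.extend N.id (fun u => if N.link.Adj u v then m u else 0) fun _ => 0

open Classical in
theorem hear_id (N : Network V) (m : V → ℕ) (u v : V) :
    hear N m v (N.id u) = if N.link.Adj u v then m u else 0 :=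
  N.id_injective.extend_apply _ _ _

theorem hear_ne_zero {N : Network V} {m : V → ℕ} {v : V} {i : ℕ} (h : hear N m v i ≠ 0) :
    ∃ u, N.id u = i ∧ N.link.Adj u v ∧ hear N m v i = m u := by
  classical
  by_cases hi : ∃ u, N.id u = i
  · obtain ⟨u, rfl⟩ := hi
    rw [hear_id] at h ⊢
    by_cases hu : N.link.Adj u v
    · exact ⟨u, rfl, hu, if_pos hu⟩
    · simp [hu] at h
  · exact absurd (Function.extend_apply' _ _ _ hi) h

/-- The vertices run the programs `p` synchronously for `T` rounds, all messages have at most `b`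
bits, and the values returned are `a`. -/
inductive Runs (N : Network V) (b : ℕ) : (V → Prog α) → ℕ → (V → α) → Prop
  | ret (a : V → α) : Runs N b (fun v => .ret (a v)) 0 a
  | round {m : V → ℕ} {k : V → (ℕ → ℕ) → Prog α} {T : ℕ} {a : V → α} (hm : ∀ v, m v < 2 ^ b)
      (h : Runs N b (fun v => k v (hear N m v)) T a) :
      Runs N b (fun v => .round (m v) (k v)) (T + 1) a

theorem Runs.bind {N : Network V} {b : ℕ} {p : V → Prog α} {T T' : ℕ} {a : V → α} {c : V → β}
    {f : V → α → Prog β} (hp : Runs N b p T a) (hf : Runs N b (fun v => f v (a v)) T' c) :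
    Runs N b (fun v => (p v).bind (f v)) (T + T') c := by
  induction hp with
  | ret a => simpa [Prog.bind] using hf
  | @round m k T a hm h ih =>
    have := Runs.round (k := fun v i => (k v i).bind (f v)) hm (ih hf)
    rw [show T + 1 + T' = T + T' + 1 by omega]
    exact this

theorem Runs.exchange {N : Network V} {b : ℕ} {m : V → ℕ} (hm : ∀ v, m v < 2 ^ b) :
    Runs N b (fun v => .round (m v) .ret) 1 (hear N m) :=
  .round hm (.ret _)

/-- The states of the vertices after `t` rounds of state machines. -/
noncomputable def iter (N : Network V) (out : V → ℕ → α → ℕ)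
    (step : V → ℕ → α → (ℕ → ℕ) → α) (s : V → α) : ℕ → V → α
  | 0 => s
  | t + 1 => fun v => step v t (iter N out step s t v)
      (hear N (fun u => out u t (iter N out step s t u)) v)

theorem runs_loop_from {N : Network V} {b : ℕ} {out : V → ℕ → α → ℕ}
    {step : V → ℕ → α → (ℕ → ℕ) → α} {s : V → α} (T t : ℕ)
    (hb : ∀ v r, r < t + T → out v r (iter N out step s r v) < 2 ^ b) :
    Runs N b (fun v => .loop (out v) (step v) t T (iter N out step s t v)) T
      (iter N out step s (t + T)) := by
  induction T generalizing t with
  | zero => exact .ret _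
  | succ T ih =>
    refine .round (fun v => hb v t (by omega)) ?_
    rw [show t + (T + 1) = t + 1 + T by omega] at hb ⊢
    exact ih (t + 1) hb

theorem runs_loop {N : Network V} {b : ℕ} {out : V → ℕ → α → ℕ}
    {step : V → ℕ → α → (ℕ → ℕ) → α} {s : V → α} (T : ℕ)
    (hb : ∀ v r, r < T → out v r (iter N out step s r v) < 2 ^ b) :
    Runs N b (fun v => .loop (out v) (step v) 0 T (s v)) T (iter N out step s T) := by
  have := runs_loop_from (s := s) T 0 (by simpa using hb)
  rwa [Nat.zero_add] at this

/-! ### Compilation to distributed algorithms -/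

/-- The number with a given binary expansion. -/
noncomputable def ofBits : List Bool → ℕ := Function.invFun Nat.bits

theorem bits_injective : Function.Injective Nat.bits := by
  intro a b h
  apply Nat.eq_of_testBit_eq
  intro i
  rw [Nat.testBit_eq_inth, Nat.testBit_eq_inth, h]

@[simp] theorem ofBits_bits (m : ℕ) : ofBits (Nat.bits m) = m :=
  Function.leftInverse_invFun bits_injective m

@[simp] theorem ofBits_nil : ofBits [] = 0 := by
  simpa using ofBits_bits 0

/-- The state of a vertex that makes attempts `0, 1, 2, …`, where `B k` is the program of the
`k`-th attempt; an attempt that returns `none` is followed by the next one. -/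
abbrev AttemptState (Y : Type) : Type := (ℕ → Prog (Option Y)) × ℕ × Prog (Option Y)

/-- Pass on to the next attempt if the current one has failed. -/
def advance (B : ℕ → Prog (Option Y)) (k : ℕ) : Prog (Option Y) → AttemptState Y
  | .ret none => (B, k + 1, B (k + 1))
  | p => (B, k, p)

/-- The distributed algorithm that makes attempts until one succeeds. -/
noncomputable def compile (body : LocalView X → (ℕ → Bool) → ℕ → Prog (Option Y)) :
    DistAlgorithm X Y where
  State := AttemptState Y
  start w ω := (body w ω, 0, body w ω 0)
  send σ _ := match σ.2.2 with
    | .round m _ => Nat.bits m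
    | .ret _ => []
  step σ m := match σ.2.2 with
    | .round _ k => advance σ.1 σ.2.1 (k fun i => ofBits (m i))
    | .ret _ => σ
  output σ := match σ.2.2 with
    | .round _ _ => none
    | .ret o => o

theorem run_succ (A : DistAlgorithm X Y) (N : Network V) (x : V → X) (ω : RandomStrings V)
    (r : ℕ) (v : V) : A.run N x ω (r + 1) v =
      match A.output (A.run N x ω r v) with
      | some _ => A.run N x ω r v
      | none => A.step (A.run N x ω r v) (A.inbox N (A.run N x ω r) v) := rfl

section compile

variable {body : LocalView X → (ℕ → Bool) → ℕ → Prog (Option Y)} {N : Network V} {x : V → X}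
  {ω : RandomStrings V} {b : ℕ}

theorem inbox_compile {σ : V → AttemptState Y} {m : V → ℕ}
    (hσ : ∀ u v, (compile body).message N (σ u) v = Nat.bits (m u)) (v : V) :
    (fun i => ofBits ((compile body).inbox N σ v i)) = hear N m v := by
  classical
  unfold DistAlgorithm.inbox
  funext i
  by_cases hi : ∃ u, N.id u = i
  · obtain ⟨u, rfl⟩ := hi
    rw [hear_id, N.id_injective.extend_apply]
    by_cases hu : N.link.Adj u v <;> simp [hu, hσ]
  · rw [Function.extend_apply' _ _ _ hi, hear,
      Function.extend_apply' _ _ _ hi, ofBits_nil]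

/-- The invariant is stated with `advance` because the round that ends a failing phase already sets
up the next one; no round is lost in between. -/
theorem run_of_runs {p : V → Prog (Option Y)} {T : ℕ} {a : V → Option Y} (h : Runs N b p T a)
    {B : V → ℕ → Prog (Option Y)} {k r : ℕ}
    (hr : ∀ v, (compile body).run N x ω r v = advance (B v) k (p v)) :
    (∀ v, (compile body).run N x ω (r + T) v = advance (B v) k (.ret (a v))) ∧
      ∀ r', r ≤ r' → r' < r + T → ∀ u v,
        ((compile body).message N ((compile body).run N x ω r' u) v).length ≤ b := by
  induction h generalizing r with
  | ret a => exact ⟨hr, fun r' h1 h2 => by omega⟩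
  | @round m k' T a hm h ih =>
    have hmsg : ∀ u v, (compile body).message N ((compile body).run N x ω r u) v
        = Nat.bits (m u) := by
      intro u v
      rw [hr]; rfl
    have hs : ∀ v, (compile body).run N x ω (r + 1) v
        = advance (B v) k (k' v (hear N m v)) := by
      intro v
      rw [← inbox_compile hmsg v, run_succ, hr v]
      rfl
    obtain ⟨h1, h2⟩ := ih hs
    refine ⟨fun v => by rw [← h1 v]; congr 1; omega, fun r' hr1 hr2 u v => ?_⟩
    rcases hr1.eq_or_lt with rfl | hlt
    · rw [hmsg, Nat.size_eq_bits_len]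
      exact Nat.size_le.2 (hm u)
    · exact h2 r' hlt (by omega) u v

theorem advance_of_runs {p : V → Prog (Option Y)} {T : ℕ} {a : V → Option Y}
    (h : Runs N b p (T + 1) a) (B : ℕ → Prog (Option Y)) (k : ℕ) (v : V) :
    advance B k (p v) = (B, k, p v) := by
  cases h; rfl

theorem run_add_of_output {A : DistAlgorithm X Y} {r : ℕ} {v : V} {y : Y}
    (h : A.outputAt N x ω r v = some y) (j : ℕ) : A.run N x ω (r + j) v = A.run N x ω r v := by
  induction j with
  | zero => rfl
  | succ j ih =>
    rw [DistAlgorithm.outputAt] at h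
    rw [← Nat.add_assoc, run_succ, ih, h]

/-- Each phase lasts at least one round (`T k + 1`), so `advance` leaves a freshly started program
alone. Failure is common to all vertices and occurs in the same round, which keeps the phases
synchronous. -/
theorem compile_spec {T : ℕ → ℕ} {k₀ : ℕ} {y : RandomStrings V → V → Y}
    (hfail : ∀ ω : RandomStrings V, ∀ k < k₀,
      Runs N b (fun v => body (DistAlgorithm.view N x v) (ω v) k) (T k + 1) fun _ => none)
    (hok : ∀ ω : RandomStrings V,
      Runs N b (fun v => body (DistAlgorithm.view N x v) (ω v) k₀) (T k₀ + 1)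
        fun v => some (y ω v)) :
    (compile body).MessagesBoundedBy N x b ∧
      ∀ ω v, (compile body).outputAt N x ω (∑ k ∈ Finset.range (k₀ + 1), (T k + 1)) v
        = some (y ω v) := by
  have key : ∀ ω : RandomStrings V, ∀ k ≤ k₀,
      (∀ v, (compile body).run N x ω (∑ j ∈ Finset.range k, (T j + 1)) v
        = (body (DistAlgorithm.view N x v) (ω v), k,
            body (DistAlgorithm.view N x v) (ω v) k)) ∧
      ∀ r' < ∑ j ∈ Finset.range k, (T j + 1), ∀ u v,
        ((compile body).message N ((compile body).run N x ω r' u) v).length ≤ b := by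
    intro ω k
    induction k with
    | zero => exact fun _ => ⟨fun v => rfl, fun r' h => by simp at h⟩
    | succ k ih =>
      intro hk
      obtain ⟨h1, h2⟩ := ih (by omega)
      have hr := hfail ω k (by omega)
      obtain ⟨h3, h4⟩ := run_of_runs (x := x) (ω := ω) hr
        (B := fun v => body (DistAlgorithm.view N x v) (ω v)) (k := k)
        (fun v => by rw [h1 v, advance_of_runs hr])
      rw [Finset.sum_range_succ]
      refine ⟨h3, fun r' hr' u v => ?_⟩
      rcases lt_or_ge r' (∑ j ∈ Finset.range k, (T j + 1)) with h | h
      · exact h2 r' h u v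
      · exact h4 r' h hr' u v
  have fin : ∀ ω : RandomStrings V,
      (∀ v, (compile body).outputAt N x ω (∑ j ∈ Finset.range (k₀ + 1), (T j + 1)) v
        = some (y ω v)) ∧
      ∀ r' < ∑ j ∈ Finset.range (k₀ + 1), (T j + 1), ∀ u v,
        ((compile body).message N ((compile body).run N x ω r' u) v).length ≤ b := by
    intro ω
    obtain ⟨h1, h2⟩ := key ω k₀ le_rfl
    obtain ⟨h3, h4⟩ := run_of_runs (x := x) (ω := ω) (hok ω)
      (B := fun v => body (DistAlgorithm.view N x v) (ω v)) (k := k₀)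
      (fun v => by rw [h1 v, advance_of_runs (hok ω)])
    rw [Finset.sum_range_succ]
    refine ⟨fun v => by rw [DistAlgorithm.outputAt, h3 v]; rfl, fun r' hr' u v => ?_⟩
    rcases lt_or_ge r' (∑ j ∈ Finset.range k₀, (T j + 1)) with h | h
    · exact h2 r' h u v
    · exact h4 r' h hr' u v
  refine ⟨fun ω r u v _ => ?_, fun ω => (fin ω).1⟩
  rcases lt_or_ge r (∑ j ∈ Finset.range (k₀ + 1), (T j + 1)) with h | h
  · exact (fin ω).2 r h u v
  -- After the successful phase all vertices have halted, and they send nothing.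
  · obtain ⟨j, rfl⟩ := Nat.exists_eq_add_of_le h
    have ho := (fin ω).1 u
    rw [run_add_of_output ho, DistAlgorithm.message]
    rw [DistAlgorithm.outputAt] at ho
    simp [ho]

end compile

end Programs

/-! ### Walks, distances, and propagation of minima along walks. -/

section Walks

variable {V : Type}

/-! ### Walks and distances in relations -/

/-- There is a walk with `n` steps from `u` to `v`. -/
def Reach (H : V → V → Prop) : ℕ → V → V → Prop
  | 0, u, v => u = v
  | n + 1, u, v => ∃ w, Reach H n u w ∧ H w v

theorem reach_add {H : V → V → Prop} {m n : ℕ} {u v : V} :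
    Reach H (m + n) u v ↔ ∃ w, Reach H m u w ∧ Reach H n w v := by
  induction n generalizing v with
  | zero => simp [Reach]
  | succ n ih =>
    rw [← Nat.add_assoc]
    simp only [Reach, ih]
    constructor
    · rintro ⟨w, ⟨x, h1, h2⟩, h3⟩
      exact ⟨x, h1, w, h2, h3⟩
    · rintro ⟨x, h1, w, h2, h3⟩
      exact ⟨w, ⟨x, h1, h2⟩, h3⟩

theorem reach_one {H : V → V → Prop} {u v : V} : Reach H 1 u v ↔ H u v := by
  simp [Reach]

theorem reach_flip {H : V → V → Prop} {n : ℕ} {u v : V} :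
    Reach (flip H) n u v ↔ Reach H n v u := by
  induction n generalizing v with
  | zero => simp [Reach, eq_comm]
  | succ n ih =>
    rw [Nat.add_comm n 1, reach_add (H := H)]
    rw [Nat.add_comm 1 n]
    simp only [Reach, ih, flip]
    constructor
    · rintro ⟨w, h1, h2⟩
      exact ⟨w, ⟨v, rfl, h2⟩, h1⟩
    · rintro ⟨w, ⟨v', rfl, h2⟩, h1⟩
      exact ⟨w, h1, h2⟩

theorem Reach.mono {H H' : V → V → Prop} (hH : ∀ u v, H u v → H' u v) {n : ℕ} {u v : V}
    (h : Reach H n u v) : Reach H' n u v := by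
  induction n generalizing v with
  | zero => exact h
  | succ n ih => exact ⟨h.choose, ih h.choose_spec.1, hH _ _ h.choose_spec.2⟩

theorem Reach.trans {H : V → V → Prop} {m n : ℕ} {u v w : V} (h : Reach H m u v)
    (h' : Reach H n v w) : Reach H (m + n) u w :=
  reach_add.2 ⟨v, h, h'⟩

/-- The length of a shortest walk from `u` to `v`. -/
noncomputable def ddist (H : V → V → Prop) (u v : V) : ℕ∞ :=
  ⨅ (n : ℕ) (_ : Reach H n u v), (n : ℕ∞)

theorem Reach.ddist_le {H : V → V → Prop} {n : ℕ} {u v : V} (h : Reach H n u v) :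
    ddist H u v ≤ n :=
  iInf₂_le n h

theorem exists_reach {H : V → V → Prop} {u v : V} (h : ddist H u v ≠ ⊤) :
    ∃ n : ℕ, ddist H u v = n ∧ Reach H n u v := by
  have hne : ∃ n, Reach H n u v := by
    by_contra! hc
    exact h (by simp [ddist, hc])
  classical
  refine ⟨Nat.find hne, le_antisymm (Nat.find_spec hne).ddist_le ?_, Nat.find_spec hne⟩
  exact le_iInf₂ fun n hn => by exact_mod_cast Nat.find_min' hne hn

theorem exists_reach_of_eq {H : V → V → Prop} {u v : V} {n : ℕ} (h : ddist H u v = n) :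
    Reach H n u v := by
  obtain ⟨m, hm, hr⟩ := exists_reach (H := H) (u := u) (v := v) (by simp [h])
  rw [h] at hm
  rwa [Nat.cast_inj.1 hm]

@[simp] theorem ddist_self (H : V → V → Prop) (u : V) : ddist H u u = 0 :=
  le_antisymm (by simpa using Reach.ddist_le (H := H) (n := 0) (u := u) (v := u) rfl) zero_le

theorem ddist_triangle (H : V → V → Prop) (u v w : V) :
    ddist H u w ≤ ddist H u v + ddist H v w := by
  by_cases h1 : ddist H u v = ⊤
  · simp [h1]
  by_cases h2 : ddist H v w = ⊤
  · simp [h2]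
  obtain ⟨m, hm, hr⟩ := exists_reach h1
  obtain ⟨n, hn, hs⟩ := exists_reach h2
  rw [hm, hn]
  exact_mod_cast (hr.trans hs).ddist_le

theorem ddist_flip (H : V → V → Prop) (u v : V) : ddist (flip H) u v = ddist H v u := by
  simp only [ddist, reach_flip]

/-- Cut a shortest walk after `a` steps; by the triangle inequality neither part can be shortened.
-/
theorem exists_ddist_split {H : V → V → Prop} {u v : V} {a b : ℕ} (h : ddist H u v = (a + b : ℕ)) :
    ∃ w, ddist H u w = a ∧ ddist H w v = b := by
  obtain ⟨w, h1, h2⟩ := reach_add.1 (exists_reach_of_eq h)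
  have h3 := ddist_triangle H u w v
  have h4 := h1.ddist_le
  have h5 := h2.ddist_le
  obtain ⟨a', ha⟩ := ENat.ne_top_iff_exists.1 (ne_top_of_le_ne_top (ENat.natCast_ne_top _) h4)
  obtain ⟨b', hb⟩ := ENat.ne_top_iff_exists.1 (ne_top_of_le_ne_top (ENat.natCast_ne_top _) h5)
  refine ⟨w, ?_⟩
  rw [h, ← ha, ← hb] at h3
  rw [← ha] at h4 ⊢
  rw [← hb] at h5 ⊢
  norm_cast at *
  omega

/-! ### Extended numbers as messages -/

/-- Extended natural numbers as messages, silence standing for `∞`. -/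
noncomputable def enc (x : ℕ∞) : ℕ := if x = ⊤ then 0 else x.toNat + 1

/-- The extended natural number that a message stands for. -/
def dec : ℕ → ℕ∞
  | 0 => ⊤
  | m + 1 => m

@[simp] theorem enc_top : enc ⊤ = 0 := if_pos rfl
@[simp] theorem enc_coe (m : ℕ) : enc m = m + 1 := by simp [enc]
@[simp] theorem dec_zero : dec 0 = ⊤ := rfl
@[simp] theorem dec_succ (m : ℕ) : dec (m + 1) = m := rfl

@[simp] theorem dec_enc (x : ℕ∞) : dec (enc x) = x := by
  cases x <;> simp

/-- Suppress messages of more than `W` bits. -/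
def clamp (W m : ℕ) : ℕ := if m < 2 ^ W then m else 0

theorem clamp_lt (W m : ℕ) : clamp W m < 2 ^ W := by
  unfold clamp; split_ifs with h
  · exact h
  · positivity

theorem clamp_of_lt {W m : ℕ} (h : m < 2 ^ W) : clamp W m = m := if_pos h

@[simp] theorem clamp_zero (W : ℕ) : clamp W 0 = 0 := by simp [clamp]

/-- Listening only to senders with identifiers in `Src v`. -/
def Heard (N : Network V) (Src : V → Set ℕ) (w v : V) : Prop :=
  N.link.Adj w v ∧ N.id w ∈ Src v

/-! ### Propagation of minima along walks -/

/-- Each round, broadcast the minimum of the own value and the minimum heard in the previous round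
from the senders in `Src`. The result is the function sending `t` to the minimum heard in round
`t`. -/
noncomputable def relax (cl : ℕ → ℕ) (Src : Set ℕ) (own : ℕ → ℕ∞) (T : ℕ) : Prog (ℕ → ℕ∞) :=
  .loop (fun t s => cl (enc (min (own t) (s t))))
    (fun t s m => Function.update s (t + 1) (⨅ i ∈ Src, dec (m i))) 0 T fun _ => ⊤

/-- The value of `a` at time `t` is the minimum of the own values over walks with between `1` and
`t` steps, the own value of `u` being taken at the start of the walk. -/
structure WalkMin (H : V → V → Prop) (own : V → ℕ → ℕ∞) (T : ℕ) (a : V → ℕ → ℕ∞) : Prop where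
  le : ∀ {q t : ℕ} {u v : V}, 1 ≤ q → q ≤ t → t ≤ T → Reach H q u v → a v t ≤ own u (t - q)
  attained : ∀ {t : ℕ} {v : V}, t ≤ T → a v t ≠ ⊤ →
    ∃ q u, 1 ≤ q ∧ q ≤ t ∧ Reach H q u v ∧ a v t = own u (t - q)

/-- The mathematical recursion performed by `relax`. -/
noncomputable def relaxVal (cl : ℕ → ℕ) (H : V → V → Prop) (own : V → ℕ → ℕ∞) : ℕ → V → ℕ∞
  | 0, _ => ⊤
  | t + 1, v => ⨅ w, ⨅ (_ : H w v), dec (cl (enc (min (own w t) (relaxVal cl H own t w))))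

/-- Every value that is relayed is the own value of some vertex. As `cl` fixes the encodings of own
values, it never alters anything under way. -/
theorem relaxVal_attained {cl : ℕ → ℕ} {H : V → V → Prop} {own : V → ℕ → ℕ∞}
    (h0 : cl 0 = 0) (hcl : ∀ u t, cl (enc (own u t)) = enc (own u t)) (t : ℕ) (v : V) :
    relaxVal cl H own t v = ⊤ ∨
      ∃ q u, 1 ≤ q ∧ q ≤ t ∧ Reach H q u v ∧ relaxVal cl H own t v = own u (t - q) := by
  induction t generalizing v with
  | zero => exact .inl rfl
  | succ t ih =>
    by_cases htop : relaxVal cl H own (t + 1) v = ⊤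
    · exact .inl htop
    refine .inr ?_
    have hne : Nonempty {w // H w v} := by
      by_contra hc
      rw [not_nonempty_iff, isEmpty_subtype] at hc
      exact htop (by simp [relaxVal, hc])
    obtain ⟨⟨w, hw⟩, hmin⟩ := ENat.exists_eq_iInf
      (fun w : {w // H w v} => dec (cl (enc (min (own w t) (relaxVal cl H own t w)))))
    have heq : relaxVal cl H own (t + 1) v
        = dec (cl (enc (min (own w t) (relaxVal cl H own t w)))) := by
      rw [hmin, iInf_subtype]; rfl
    rw [heq] at htop ⊢
    rcases min_choice (own w t) (relaxVal cl H own t w) with h | h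
    · rw [h, hcl, dec_enc]
      exact ⟨1, w, le_rfl, by omega, reach_one.2 hw, by simp⟩
    · rw [h] at htop ⊢
      rcases ih w with h' | ⟨q, u, hq1, hq2, hr, he⟩
      · simp [h', h0] at htop
      · rw [he, hcl, dec_enc]
        exact ⟨q + 1, u, by omega, by omega, ⟨w, hr, hw⟩, by congr 1; omega⟩

theorem relaxVal_clamp {cl : ℕ → ℕ} {H : V → V → Prop} {own : V → ℕ → ℕ∞}
    (h0 : cl 0 = 0) (hcl : ∀ u t, cl (enc (own u t)) = enc (own u t)) (t : ℕ) (v : V) :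
    cl (enc (min (own v t) (relaxVal cl H own t v)))
      = enc (min (own v t) (relaxVal cl H own t v)) := by
  rcases min_choice (own v t) (relaxVal cl H own t v) with h | h <;> rw [h]
  · exact hcl v t
  · rcases relaxVal_attained h0 hcl t v with h' | ⟨q, u, -, -, -, he⟩
    · rw [h', enc_top, h0]
    · rw [he, hcl]

theorem relaxVal_le {cl : ℕ → ℕ} {H : V → V → Prop} {own : V → ℕ → ℕ∞}
    (h0 : cl 0 = 0) (hcl : ∀ u t, cl (enc (own u t)) = enc (own u t)) {q t : ℕ} {u v : V}
    (hq : 1 ≤ q) (hqt : q ≤ t) (hr : Reach H q u v) : relaxVal cl H own t v ≤ own u (t - q) := by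
  induction t generalizing q v with
  | zero => omega
  | succ t ih =>
    obtain ⟨q, rfl⟩ := Nat.exists_eq_add_of_le' hq
    obtain ⟨w, hw, hwv⟩ := hr
    refine (iInf₂_le w hwv).trans ?_
    rw [relaxVal_clamp h0 hcl, dec_enc]
    rcases Nat.eq_zero_or_pos q with rfl | hq0
    · cases hw
      simp
    · refine (min_le_right _ _).trans ?_
      simpa using ih hq0 (by omega) hw

theorem iInf_dec_hear (N : Network V) (Src : V → Set ℕ) (m : V → ℕ) (v : V) :
    ⨅ i ∈ Src v, dec (hear N m v i) = ⨅ w, ⨅ (_ : Heard N Src w v), dec (m w) := by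
  classical
  apply le_antisymm
  · refine le_iInf₂ fun w hw => (iInf₂_le (N.id w) hw.2).trans ?_
    rw [hear_id, if_pos hw.1]
  · refine le_iInf₂ fun i hi => ?_
    by_cases h : hear N m v i = 0
    · simp [h]
    · obtain ⟨u, rfl, ha, he⟩ := hear_ne_zero h
      rw [he]
      exact iInf₂_le u ⟨ha, hi⟩

/-- The two alternatives in `hb` serve different callers. A genuine clamp bounds the messages in
every execution, even when the sample of landmarks is bad. While the vertices are being counted no
suitable width is known locally, so `cl = id` and the own values themselves must be small. -/
theorem runs_relax {N : Network V} {b : ℕ} {cl : ℕ → ℕ} {Src : V → Set ℕ} {own : V → ℕ → ℕ∞}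
    {T : ℕ} (h0 : cl 0 = 0)
    (hb : (∀ m, cl m < 2 ^ b) ∨
      ∀ u t, cl (enc (own u t)) = enc (own u t) ∧ enc (own u t) < 2 ^ b) :
    ∃ a, Runs N b (fun v => relax cl (Src v) (own v) T) T a ∧
      ((∀ u t, cl (enc (own u t)) = enc (own u t)) → WalkMin (Heard N Src) own T a) := by
  let out : V → ℕ → (ℕ → ℕ∞) → ℕ := fun v t s => cl (enc (min (own v t) (s t)))
  let step : V → ℕ → (ℕ → ℕ∞) → (ℕ → ℕ) → ℕ → ℕ∞ :=
    fun v t s m => Function.update s (t + 1) (⨅ i ∈ Src v, dec (m i))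
  have hiter : ∀ T v, iter N out step (fun _ _ => ⊤) (T + 1) v
      = Function.update (iter N out step (fun _ _ => ⊤) T v) (T + 1)
        (⨅ i ∈ Src v, dec (hear N (fun u => out u T (iter N out step (fun _ _ => ⊤) T u)) v i)) :=
    fun _ _ => rfl
  have hval : ∀ T t v, t ≤ T →
      iter N out step (fun _ _ => ⊤) T v t = relaxVal cl (Heard N Src) own t v := by
    intro T
    induction T with
    | zero => intro t v ht; cases Nat.le_zero.1 ht; rfl
    | succ T ih =>
      intro t v ht
      rcases ht.eq_or_lt with rfl | hlt
      · rw [hiter, Function.update_self, iInf_dec_hear]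
        simp only [out, ih T _ le_rfl]
        rfl
      · rw [hiter, Function.update_of_ne (by omega)]
        exact ih t v (by omega)
  refine ⟨iter N out step (fun _ _ => ⊤) T, runs_loop T fun v t ht => ?_, fun hcl => ⟨?_, ?_⟩⟩
  · change cl (enc (min (own v t) (iter N out step (fun _ _ => ⊤) t v t))) < 2 ^ b
    rw [hval t t v le_rfl]
    rcases hb with hb | hb
    · exact hb _
    · have hcl : ∀ u t, cl (enc (own u t)) = enc (own u t) := fun u t => (hb u t).1
      rw [relaxVal_clamp h0 hcl]
      rcases min_choice (own v t) (relaxVal cl (Heard N Src) own t v) with h | h <;> rw [h]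
      · exact (hb v t).2
      · rcases relaxVal_attained (H := Heard N Src) h0 hcl t v with h' | ⟨q, u, -, -, -, he⟩
        · rw [h', enc_top]; positivity
        · rw [he]; exact (hb _ _).2
  · intro q t u v hq hqt htT hr
    rw [hval T t v htT]
    exact relaxVal_le h0 hcl hq hqt hr
  · intro t v htT hne
    rw [hval T t v htT] at hne ⊢
    exact (relaxVal_attained h0 hcl t v).resolve_left hne

end Walks

/-! ### Pipelined broadcast of a set of items to all vertices. -/

section Gossip

variable {V : Type}

/-! ### Gossip -/

/-- One round of gossip: learn the items heard; mark the smallest unsent item as sent. -/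
noncomputable def gossipStep (s : Set ℕ × Set ℕ) (m : ℕ → ℕ) : Set ℕ × Set ℕ :=
  (s.1 ∪ {x | x ≠ 0 ∧ ∃ i, m i = x}, s.2 ∪ {x | x ∈ s.1 \ s.2 ∧ x = sInf (s.1 \ s.2)})

/-- For `T` rounds, broadcast the smallest known item that has not been sent yet. -/
noncomputable def gossip (W T : ℕ) (X : Set ℕ) : Prog (Set ℕ) :=
  (Prog.loop (fun _ s => clamp W (sInf (s.1 \ s.2))) (fun _ => gossipStep) 0 T (X, ∅)).bind
    fun s => .ret s.1

section gossip

variable (N : Network V) (W : ℕ) (X : V → Set ℕ)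

/-- The items known and sent by the vertices after `t` rounds of gossip. -/
noncomputable def gossipState : ℕ → V → Set ℕ × Set ℕ :=
  iter N (fun _ _ s => clamp W (sInf (s.1 \ s.2))) (fun _ _ => gossipStep) fun v => (X v, ∅)

variable {N W X}

theorem gossipState_succ (t : ℕ) (v : V) : gossipState N W X (t + 1) v
    = gossipStep (gossipState N W X t v) (hear N (fun u => clamp W
        (sInf ((gossipState N W X t u).1 \ (gossipState N W X t u).2))) v) := rfl

theorem gossip_mem_known (t : ℕ) (v : V) : X v ⊆ (gossipState N W X t v).1 := by
  induction t with
  | zero => exact subset_rfl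
  | succ t ih => exact ih.trans (by rw [gossipState_succ]; exact Set.subset_union_left)

theorem gossip_known_subset (t : ℕ) (v : V) : (gossipState N W X t v).1 ⊆ ⋃ u, X u := by
  induction t generalizing v with
  | zero => exact Set.subset_iUnion X v
  | succ t ih =>
    rw [gossipState_succ]
    refine Set.union_subset (ih v) ?_
    rintro x ⟨hx, i, rfl⟩
    obtain ⟨u, -, -, he⟩ := hear_ne_zero hx
    rw [he] at hx ⊢
    by_cases hlt : sInf ((gossipState N W X t u).1 \ (gossipState N W X t u).2) < 2 ^ W
    -- As `sInf ∅ = 0` is silence, a nonzero message is a genuine item.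
    · rw [clamp_of_lt hlt] at hx ⊢
      exact ih u (Nat.sInf_mem (Nat.nonempty_of_pos_sInf (Nat.pos_of_ne_zero hx))).1
    · exact absurd (if_neg hlt) hx

theorem gossip_sent_subset (t : ℕ) (v : V) :
    (gossipState N W X t v).2 ⊆ (gossipState N W X t v).1 := by
  induction t with
  | zero => exact Set.empty_subset _
  | succ t ih =>
    rw [gossipState_succ]
    exact Set.union_subset (ih.trans Set.subset_union_left)
      fun x hx => Or.inl hx.1.1

theorem gossip_sent_subset_of_adj (hX : ∀ v, ∀ x ∈ X v, 0 < x ∧ x < 2 ^ W)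
    (t : ℕ) {w v : V} (h : N.link.Adj w v) :
    (gossipState N W X t w).2 ⊆ (gossipState N W X t v).1 := by
  classical
  induction t with
  | zero => exact Set.empty_subset _
  | succ t ih =>
    rw [gossipState_succ, gossipState_succ]
    refine Set.union_subset (ih.trans Set.subset_union_left) ?_
    rintro x ⟨hx, he⟩
    obtain ⟨u, hu⟩ := Set.mem_iUnion.1 (gossip_known_subset t w hx.1)
    have hv := hX u x hu
    refine Or.inr ⟨hv.1.ne', N.id w, ?_⟩
    rw [hear_id, if_pos h, ← he, clamp_of_lt hv.2]

/-- Pipelining: a vertex that may still lack an item from within distance `d` has learnt at least `t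
- d` items, whatever the order of sending. Indeed a neighbour sends a new item in each round unless
it has sent all it knows, in which case the induction hypothesis for `d` applies to what it has
sent. So a neighbour that has not passed on everything from within distance `d` has sent at least `t
- (d + 1)` items, all of which have been heard. -/
theorem gossip_progress (hX : ∀ v, ∀ x ∈ X v, 0 < x ∧ x < 2 ^ W)
    (d t : ℕ) (u : V) :
    (∀ q w, q ≤ d → Reach N.link.Adj q w u → X w ⊆ (gossipState N W X t u).1) ∨
      (t : ℕ∞) ≤ d + (gossipState N W X t u).1.encard := by
  induction d generalizing t u with
  | zero =>
    left
    intro q w hq hr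
    cases Nat.le_zero.1 hq
    rw [show w = u from hr]
    exact gossip_mem_known t u
  | succ d ih =>
    have hsent : ∀ t w, (∀ q x, q ≤ d → Reach N.link.Adj q x w →
        X x ⊆ (gossipState N W X t w).2) ∨
        (t : ℕ∞) ≤ d + 1 + (gossipState N W X t w).2.encard := by
      intro t w
      induction t with
      | zero => right; simp
      | succ t iht =>
        rw [gossipState_succ]
        by_cases hne : ((gossipState N W X t w).1 \ (gossipState N W X t w).2).Nonempty
        · rcases iht with h | h
          · exact .inl fun q x hq hr => (h q x hq hr).trans Set.subset_union_left
          · right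
            have hm := Nat.sInf_mem hne
            have : (gossipState N W X t w).2 ∪
                {x | x ∈ (gossipState N W X t w).1 \ (gossipState N W X t w).2 ∧
                  x = sInf ((gossipState N W X t w).1 \ (gossipState N W X t w).2)}
                = insert (sInf ((gossipState N W X t w).1 \ (gossipState N W X t w).2))
                  (gossipState N W X t w).2 := by
              ext x
              simp only [Set.mem_union, Set.mem_ofPred_eq, Set.mem_insert_iff]
              constructor
              · rintro (h | h)
                · exact .inr h
                · exact .inl h.2
              · rintro (h | h)
                · exact .inr ⟨h ▸ hm, h⟩
                · exact .inl h
            rw [gossipStep, this, Set.encard_insert_of_notMem hm.2, ← add_assoc]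
            push_cast
            gcongr
        -- Nothing is left to send: what is known has been sent, so the bound on known items carries
        -- over.
        · have hsub := Set.sdiff_eq_empty.1 (Set.not_nonempty_iff_eq_empty.1 hne)
          rcases ih t w with h | h
          · exact .inl fun q x hq hr => (h q x hq hr).trans (hsub.trans Set.subset_union_left)
          · right
            push_cast
            rw [add_right_comm]
            refine add_le_add_left (h.trans ?_) 1
            gcongr
            exact hsub.trans Set.subset_union_left
    by_cases hc : ∃ w, (w = u ∨ N.link.Adj w u) ∧ ¬ (∀ q x, q ≤ d → Reach N.link.Adj q x w →
        X x ⊆ (gossipState N W X t w).2)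
    · obtain ⟨w, hw, hc⟩ := hc
      right
      push_cast
      refine ((hsent t w).resolve_left hc).trans ?_
      gcongr
      rcases hw with rfl | hw
      · exact gossip_sent_subset t w
      · exact gossip_sent_subset_of_adj hX t hw
    · left
      push Not at hc
      intro q w hq hr
      rcases Nat.eq_zero_or_pos q with rfl | hq0
      · rw [show w = u from hr]
        exact gossip_mem_known t u
      · obtain ⟨q, rfl⟩ := Nat.exists_eq_add_of_le' hq0
        obtain ⟨w', hw', ha⟩ := hr
        exact (hc w' (.inr ha) q w (by omega) hw').trans (gossip_sent_subset_of_adj hX t ha)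

/-- Otherwise `v` would know at least `t - d > K` items, more than there are. -/
theorem gossip_known_eq (hX : ∀ v, ∀ x ∈ X v, 0 < x ∧ x < 2 ^ W)
    {K d t : ℕ} (hK : (⋃ u, X u).encard ≤ K)
    (hd : ∀ u v, ∃ q ≤ d, Reach N.link.Adj q u v) (ht : d + K < t) (v : V) :
    (gossipState N W X t v).1 = ⋃ u, X u := by
  refine (gossip_known_subset t v).antisymm (Set.iUnion_subset fun u => ?_)
  obtain ⟨q, hq, hr⟩ := hd u v
  rcases gossip_progress hX d t v with h | h
  · exact h q u hq hr
  · have h1 : (t : ℕ∞) ≤ d + K :=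
      h.trans (by gcongr; exact (Set.encard_le_encard (gossip_known_subset t v)).trans hK)
    norm_cast at h1
    omega

theorem runs_gossip {W T b : ℕ} (hW : W ≤ b) (X : V → Set ℕ) :
    ∃ a, Runs N b (fun v => gossip W T (X v)) T a ∧
      ∀ K d : ℕ, (∀ v, ∀ x ∈ X v, 0 < x ∧ x < 2 ^ W) → (⋃ u, X u).encard ≤ K →
        (∀ u v, ∃ q ≤ d, Reach N.link.Adj q u v) → d + K < T → ∀ v, a v = ⋃ u, X u := by
  refine ⟨fun v => (gossipState N W X T v).1, ?_, fun K d hX hK hd hT v =>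
    gossip_known_eq hX hK hd hT v⟩
  exact Runs.bind (T' := 0) (runs_loop T fun v r _ =>
    (clamp_lt W _).trans_le (Nat.pow_le_pow_right (by norm_num) hW)) (.ret _)

end gossip

end Gossip

/-! ### Source detection: many distances at once, one message per round. -/

section Detection

variable {V : Type}

/-! ### Detection of sources -/

/-- The indices preceding `x` in the lexicographic order of the pairs `(e y, y)`. -/
def lexBelow (e : ℕ → ℕ∞) (x : ℕ) : Set ℕ := {y | e y < e x ∨ (e y = e x ∧ y < x)}

theorem lexBelow_subset {e : ℕ → ℕ∞} {x y : ℕ} (h : y ∈ lexBelow e x) :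
    lexBelow e y ⊆ lexBelow e x := by
  rintro w (hw | ⟨hw, hwy⟩) <;> rcases h with h | ⟨h, hyx⟩
  · exact .inl (hw.trans h)
  · exact .inl (h ▸ hw)
  · exact .inl (hw ▸ h)
  · exact .inr ⟨hw.trans h, hwy.trans hyx⟩

theorem notMem_lexBelow (e : ℕ → ℕ∞) (x : ℕ) : x ∉ lexBelow e x := by
  rintro (h | ⟨-, h⟩) <;> exact lt_irrefl _ h

theorem lexBelow_total (e : ℕ → ℕ∞) {x y : ℕ} (h : x ≠ y) :
    x ∈ lexBelow e y ∨ y ∈ lexBelow e x := by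
  rcases lt_trichotomy (e x) (e y) with h1 | h1 | h1
  · exact .inl (.inl h1)
  · rcases h.lt_or_gt with h2 | h2
    · exact .inl (.inr ⟨h1, h2⟩)
    · exact .inr (.inr ⟨h1.symm, h2⟩)
  · exact .inr (.inl h1)

/-- In lexicographic order the distance does not decrease and the rank strictly increases. Hence
their sums are distinct, and at most one source is due for announcement in each round. -/
theorem add_rank_lt {e : ℕ → ℕ∞} {x y t : ℕ} (h : x ∈ lexBelow e y)
    (hx : e x + (lexBelow e x).encard = t) : (t : ℕ∞) + 1 ≤ e y + (lexBelow e y).encard := by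
  rw [← hx, add_assoc, ← Set.encard_insert_of_notMem (notMem_lexBelow e x)]
  have hle : e x ≤ e y := by
    rcases h with h | h
    · exact h.le
    · exact h.1.le
  exact add_le_add hle (Set.encard_le_encard (Set.insert_subset h (lexBelow_subset h)))

theorem eq_of_add_rank_eq {e : ℕ → ℕ∞} {x y t : ℕ}
    (hx : e x + (lexBelow e x).encard = t) (hy : e y + (lexBelow e y).encard = t) : x = y := by
  by_contra hne
  rcases lexBelow_total e hne with h | h
  · have := add_rank_lt h hx
    rw [hy] at this
    norm_cast at this
    omega
  · have := add_rank_lt h hy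
    rw [hx] at this
    norm_cast at this
    omega

open Classical in
/-- In round `t`, announce the source for which distance plus rank is `t`. -/
noncomputable def detectOut (W t : ℕ) (e : ℕ → ℕ∞) : ℕ :=
  if h : ∃ x, e x + (lexBelow e x).encard = t then
    clamp W (Nat.pair (e h.choose).toNat h.choose + 1) else 0

/-- Update the distance estimates with the announcements heard from the senders in `Src`. -/
noncomputable def detectStep (Src : Set ℕ) (e : ℕ → ℕ∞) (m : ℕ → ℕ) (x : ℕ) : ℕ∞ :=
  min (e x) (⨅ i ∈ Src, ⨅ (d : ℕ) (_ : m i = Nat.pair d x + 1), ((d + 1 : ℕ) : ℕ∞))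

/-- Compute, for `T` rounds, estimates of the distances from all sources. -/
noncomputable def detect (W : ℕ) (Src : Set ℕ) (T : ℕ) (e : ℕ → ℕ∞) : Prog (ℕ → ℕ∞) :=
  .loop (detectOut W) (fun _ => detectStep Src) 0 T e

theorem detectOut_eq {W t x d : ℕ} {e : ℕ → ℕ∞} (hd : e x = d)
    (hx : e x + (lexBelow e x).encard = t) : detectOut W t e = clamp W (Nat.pair d x + 1) := by
  have h : ∃ x, e x + (lexBelow e x).encard = t := ⟨x, hx⟩
  rw [detectOut, dif_pos h, eq_of_add_rank_eq h.choose_spec hx, hd, ENat.toNat_natCast]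

theorem of_detectOut_eq {W t x d : ℕ} {e : ℕ → ℕ∞}
    (h : detectOut W t e = Nat.pair d x + 1) : e x = d := by
  unfold detectOut at h
  split_ifs at h with hx
  · unfold clamp at h
    split_ifs at h
    have hx := hx.choose_spec
    generalize Exists.choose _ = y at h hx
    obtain ⟨h1, rfl⟩ := Nat.pair_eq_pair.1 (Nat.succ_injective h)
    rw [← h1, ENat.natCast_toNat]
    intro htop
    simp [htop] at hx

section detect

variable (N : Network V) (W : ℕ) (Src : V → Set ℕ) (e : V → ℕ → ℕ∞)

/-- The estimates after `t` rounds of source detection. -/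
noncomputable def estimate : ℕ → V → ℕ → ℕ∞ :=
  iter N (fun _ => detectOut W) (fun v _ => detectStep (Src v)) e

variable {N W Src e}

theorem estimate_antitone {s t : ℕ} (h : s ≤ t) (v : V) (x : ℕ) :
    estimate N W Src e t v x ≤ estimate N W Src e s v x := by
  induction t, h using Nat.le_induction with
  | base => exact le_rfl
  | succ t _ ih => exact (min_le_left _ _).trans ih

/-- `D x v` behaves like the distance from the source `x` to `v`, when `e` gives the initial
estimates. -/
structure IsSourceDist (H : V → V → Prop) (e : V → ℕ → ℕ∞) (D : ℕ → V → ℕ∞) : Prop where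
  le_init : ∀ x v, D x v ≤ e v x
  le_step : ∀ x w v, H w v → D x v ≤ D x w + 1
  zero : ∀ x v, D x v = 0 → e v x = 0
  pred : ∀ x v (d : ℕ), D x v = (d + 1 : ℕ) → ∃ w, H w v ∧ D x w = d

variable {D : ℕ → V → ℕ∞}

theorem le_estimate (hD : IsSourceDist (Heard N Src) e D) (t : ℕ) (v : V) (x : ℕ) :
    D x v ≤ estimate N W Src e t v x := by
  induction t generalizing v x with
  | zero => exact hD.le_init x v
  | succ t ih =>
    refine le_min (ih v x) (le_iInf₂ fun i hi => le_iInf₂ fun d hd => ?_)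
    obtain ⟨w, rfl, hw, he⟩ := hear_ne_zero (hd.trans_ne (Nat.succ_ne_zero _))
    rw [he] at hd
    have := of_detectOut_eq hd
    refine (hD.le_step x w v ⟨hw, hi⟩).trans ?_
    push_cast
    rw [← this]
    gcongr
    exact ih w x

/-- Let `w` be the predecessor of `v` on a shortest walk from `x`. Whatever precedes `x` at `w`
precedes it at `v`, since the distance of `x` grows by exactly one and the others by at most one; so
the rank at `w` is no larger. Therefore `τ = D x w + rank` is smaller than `t`. By induction `w`
knows the true distances of `x` and of everything before `x` at time `τ`, so it sees the true rank
and announces `x` in that very round. -/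
theorem estimate_eq (hD : IsSourceDist (Heard N Src) e D) {T : ℕ}
    (hW : ∀ x v d, D x v ≠ ⊤ → d ≤ T → Nat.pair d x + 1 < 2 ^ W) {t : ℕ} (ht : t ≤ T) {v : V}
    {x : ℕ} (h : D x v + (lexBelow (fun y => D y v) x).encard ≤ t) :
    estimate N W Src e t v x = D x v := by
  classical
  induction t using Nat.strong_induction_on generalizing v x with
  | _ t ih =>
  refine le_antisymm ?_ (le_estimate hD t v x)
  obtain ⟨d', hd'⟩ := ENat.ne_top_iff_exists.1
    (ne_top_of_le_ne_top (ENat.natCast_ne_top t) (le_self_add.trans h))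
  rcases d' with _ | d
  · rw [← hd']
    refine (estimate_antitone (Nat.zero_le t) v x).trans ?_
    exact (hD.zero x v (by simp [← hd'])).le
  obtain ⟨w, hw, hwd⟩ := hD.pred x v d hd'.symm
  have hsub : lexBelow (fun y => D y w) x ⊆ lexBelow (fun y => D y v) x := by
    intro y hy
    have hstep := hD.le_step y w v hw
    rcases hy with hy | ⟨hy, hyx⟩
    · left
      simp only [hwd] at hy
      simp only [← hd']
      refine hstep.trans_lt ?_
      push_cast
      exact (ENat.add_lt_add_iff_right ENat.one_ne_top).2 hy
    · simp only [hwd] at hy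
      rw [hy] at hstep
      have hstep' : D y v ≤ D x v := by rw [← hd']; exact_mod_cast hstep
      rcases hstep'.lt_or_eq with h | h
      · exact .inl h
      · exact .inr ⟨h, hyx⟩
  have hle : D x w + (lexBelow (fun y => D y w) x).encard + 1 ≤ t := by
    refine le_trans ?_ h
    rw [hwd, ← hd', add_right_comm]
    push_cast
    gcongr
  obtain ⟨τ, hτ⟩ := ENat.ne_top_iff_exists.1
    (ne_top_of_le_ne_top (ENat.natCast_ne_top t) (le_self_add.trans hle))
  rw [← hτ] at hle
  have hτt : τ + 1 ≤ t := by exact_mod_cast hle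
  have hdτ : d ≤ τ := by
    have : D x w ≤ τ := by rw [hτ]; exact le_self_add
    rw [hwd] at this
    exact_mod_cast this
  have hx := ih τ (by omega) (by omega) hτ.ge
  have hrank : lexBelow (estimate N W Src e τ w) x = lexBelow (fun y => D y w) x := by
    ext y
    constructor
    · have hy := le_estimate (W := W) hD τ w y
      rintro (h1 | ⟨h1, h2⟩)
      · exact .inl ((hy.trans_lt h1).trans_eq hx)
      · rw [h1, hx] at hy
        rcases hy.lt_or_eq with h3 | h3
        · exact .inl h3
        · exact .inr ⟨h3, h2⟩
    · intro hy
      have hle' : D y w ≤ D x w := by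
        rcases hy with hy | hy
        · exact hy.le
        · exact hy.1.le
      have he := ih τ (v := w) (x := y) (by omega) (by omega)
        ((add_le_add hle' (Set.encard_le_encard (lexBelow_subset hy))).trans hτ.ge)
      simpa only [lexBelow, Set.mem_ofPred_eq, he, hx] using hy
  have hout : detectOut W τ (estimate N W Src e τ w) = Nat.pair d x + 1 := by
    rw [detectOut_eq (hx.trans hwd) (by rw [hrank, hx, hτ]),
      clamp_of_lt (hW x w d (by simp [hwd]) (by omega))]
  refine (estimate_antitone hτt v x).trans ((min_le_right _ _).trans ?_)
  refine (iInf₂_le (N.id w) hw.2).trans ((iInf₂_le d ?_).trans hd'.le)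
  rw [hear_id, if_pos hw.1]
  exact hout

theorem runs_detect {b : ℕ} (T : ℕ) (hW : W ≤ b) :
    ∃ a, Runs N b (fun v => detect W (Src v) T (e v)) T a ∧
      ∀ D : ℕ → V → ℕ∞, IsSourceDist (Heard N Src) e D →
        (∀ x v d, D x v ≠ ⊤ → d ≤ T → Nat.pair d x + 1 < 2 ^ W) →
        (∀ v x, D x v ≤ a v x) ∧
        ∀ v x, D x v + (lexBelow (fun y => D y v) x).encard ≤ T → a v x = D x v := by
  refine ⟨estimate N W Src e T, runs_loop T fun v r _ => ?_, fun D hD hDW =>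
    ⟨fun v x => le_estimate hD T v x, fun v x h => estimate_eq hD hDW le_rfl h⟩⟩
  refine lt_of_lt_of_le ?_ (Nat.pow_le_pow_right (by norm_num) hW)
  unfold detectOut
  split_ifs
  · exact clamp_lt W _
  · positivity

end detect

end Detection

/-! ### Exact distances from landmarks, composed of short hops. -/

section Landmarks

variable {V : Type}

/-! ### Distances through landmarks -/

/-- The length of a chain of landmarks from `x`, the last hop being measured by `f`. -/
def chainLength (E : ℕ → ℕ → ℕ∞) (f : ℕ → ℕ∞) : ℕ → List ℕ → ℕ∞
  | x, [] => f x
  | x, a :: l => E x a + chainLength E f a l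

/-- The length of a shortest chain of landmarks from `x`, the last hop being measured by `f`. -/
noncomputable def chainDist (E : ℕ → ℕ → ℕ∞) (f : ℕ → ℕ∞) (x : ℕ) : ℕ∞ :=
  ⨅ l, chainLength E f x l

open Classical in
/-- Forget distances that are larger than `r`. -/
noncomputable def trunc (r : ℕ) (δ : ℕ∞) : ℕ∞ := if δ ≤ r then δ else ⊤

theorem le_trunc (r : ℕ) (δ : ℕ∞) : δ ≤ trunc r δ := by
  unfold trunc; split_ifs <;> simp

theorem trunc_of_le {r : ℕ} {δ : ℕ∞} (h : δ ≤ r) : trunc r δ = δ := if_pos h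

theorem trunc_eq_coe {r d : ℕ} {δ : ℕ∞} : trunc r δ = d ↔ δ = d ∧ d ≤ r := by
  unfold trunc
  split_ifs with h
  · exact ⟨fun h' => ⟨h', by rw [h'] at h; exact_mod_cast h⟩, fun h' => h'.1⟩
  · refine ⟨fun h' => by simp at h', ?_⟩
    rintro ⟨rfl, h'⟩
    exact absurd (by exact_mod_cast h') h

/-- The distance from the landmark with key `x` to `v`, and `∞` if there is no such landmark. -/
noncomputable def keyDist (H : V → V → Prop) (L : Set V) (key : V → ℕ) (x : ℕ) (v : V) : ℕ∞ :=
  ⨅ u, ⨅ (_ : u ∈ L ∧ key u = x), ddist H u v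

section keyDist

variable {H : V → V → Prop} {L : Set V} {key : V → ℕ}

theorem keyDist_key (hkey : Function.Injective key) {u : V} (hu : u ∈ L) (v : V) :
    keyDist H L key (key u) v = ddist H u v := by
  apply le_antisymm
  · exact iInf₂_le u ⟨hu, rfl⟩
  · refine le_iInf₂ fun w hw => ?_
    rw [hkey hw.2]

theorem exists_of_keyDist_ne_top {x : ℕ} {v : V} (h : keyDist H L key x v ≠ ⊤) :
    ∃ u ∈ L, key u = x := by
  by_contra! hc
  refine h (iInf₂_eq_top.2 fun u hu => absurd hu.2 (hc u hu.1))

theorem keyDist_triangle (x : ℕ) (w v : V) :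
    keyDist H L key x v ≤ keyDist H L key x w + ddist H w v := by
  by_cases h : keyDist H L key x w = ⊤
  · simp [h]
  · have : Nonempty {u // u ∈ L ∧ key u = x} := by
      obtain ⟨u, hu⟩ := exists_of_keyDist_ne_top h
      exact ⟨⟨u, hu⟩⟩
    obtain ⟨⟨u, hu⟩, he⟩ := ENat.exists_eq_iInf
      (fun u : {u // u ∈ L ∧ key u = x} => ddist H u.1 w)
    have : keyDist H L key x w = ddist H u w := by
      rw [he, iInf_subtype]; rfl
    rw [this]
    exact (iInf₂_le u hu).trans (ddist_triangle H u w v)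

/-- Strong induction on the distance `n`. If `n > z + 1`, go one edge to `w₁` and `z` further edges
to `w₂`, and reroute the latter piece through a landmark `y`. Then `y` is within `z + 1` of `u`, and
the first edge guarantees that `y` is closer than `n` to `v`, even if `y = w₁`. This is why hops are
truncated at `z + 1` and not at `z`. -/
theorem chainDist_eq (hkey : Function.Injective key) {z : ℕ}
    (hhit : ∀ u v, ddist H u v = z → ∃ x ∈ L, ddist H u x + ddist H x v = z)
    {E : ℕ → ℕ → ℕ∞} (hE : ∀ x, ∀ w ∈ L, E x (key w) = trunc (z + 1) (keyDist H L key x w))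
    (hE' : ∀ x y, y ∉ key '' L → E x y = ⊤) (v : V) (x : ℕ) :
    chainDist E (fun a => trunc (z + 1) (keyDist H L key a v)) x = keyDist H L key x v := by
  apply le_antisymm
  · by_cases htop : keyDist H L key x v = ⊤
    · simp [htop]
    obtain ⟨u, hu, rfl⟩ := exists_of_keyDist_ne_top htop
    rw [keyDist_key hkey hu] at htop ⊢
    obtain ⟨n, hn, -⟩ := exists_reach htop
    suffices h : ∃ l, chainLength E (fun a => trunc (z + 1) (keyDist H L key a v)) (key u) l
        ≤ n by
      obtain ⟨l, hl⟩ := h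
      rw [hn]
      exact (iInf_le _ l).trans hl
    clear htop
    induction n using Nat.strong_induction_on generalizing u with
    | _ n ih =>
    by_cases hnz : n ≤ z + 1
    · refine ⟨[], ?_⟩
      simp only [chainLength]
      rw [keyDist_key hkey hu, hn, trunc_of_le (by exact_mod_cast hnz)]
    · obtain ⟨w₁, h1, h1'⟩ := exists_ddist_split (a := 1) (b := n - 1)
        (hn.trans (by congr 1; omega))
      obtain ⟨w₂, h2, h2'⟩ := exists_ddist_split (a := z) (b := n - 1 - z)
        (h1'.trans (by congr 1; omega))
      obtain ⟨y, hy, hyz⟩ := hhit w₁ w₂ h2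
      obtain ⟨p, hp⟩ := ENat.ne_top_iff_exists.1
        (ne_top_of_le_ne_top (ENat.natCast_ne_top z) (le_self_add.trans hyz.le))
      obtain ⟨q, hq⟩ := ENat.ne_top_iff_exists.1
        (ne_top_of_le_ne_top (ENat.natCast_ne_top z) (le_add_self.trans hyz.le))
      have huy := ddist_triangle H u w₁ y
      have hyv := ddist_triangle H y w₂ v
      rw [h1, ← hp] at huy
      rw [h2', ← hq] at hyv
      rw [← hp, ← hq] at hyz
      obtain ⟨a, ha⟩ := ENat.ne_top_iff_exists.1
        (ne_top_of_le_ne_top (by simp) huy)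
      obtain ⟨b, hb⟩ := ENat.ne_top_iff_exists.1
        (ne_top_of_le_ne_top (by simp) hyv)
      rw [← ha] at huy
      rw [← hb] at hyv
      norm_cast at hyz huy hyv
      obtain ⟨l, hl⟩ := ih b (by omega) y hy hb.symm
      refine ⟨key y :: l, ?_⟩
      simp only [chainLength]
      rw [hE _ y hy, keyDist_key hkey hu, ← ha, trunc_of_le (by norm_cast; omega)]
      refine (add_le_add le_rfl hl).trans ?_
      norm_cast
      omega
  · refine le_iInf fun l => ?_
    induction l generalizing x with
    | nil => exact le_trunc _ _
    | cons a l ih =>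
      simp only [chainLength]
      by_cases ha : a ∈ key '' L
      · obtain ⟨w, hw, rfl⟩ := ha
        refine (keyDist_triangle x w v).trans (add_le_add ?_ ?_)
        · rw [hE x w hw]; exact le_trunc _ _
        · rw [← keyDist_key hkey hw]; exact ih _
      · rw [hE' x a ha]; simp

end keyDist

/-- What a vertex learns about the distances from the landmarks: the distance `dist x` from the
landmark with key `x` to the vertex itself, the distance `between x y` from the landmark with key
`x` to the landmark with key `y`, and the set `keys` of all keys of landmarks. -/
structure LandmarkInfo where
  dist : ℕ → ℕ∞
  between : ℕ → ℕ → ℕ∞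
  keys : Set ℕ

/-- The distance between landmarks that is recorded in a set of items. -/
noncomputable def itemDist (S : Set ℕ) (x y : ℕ) : ℕ∞ :=
  ⨅ (δ : ℕ) (_ : Nat.pair x (Nat.pair y δ) + 1 ∈ S), (δ : ℕ∞)

open Classical in
/-- Learn all distances from landmarks in the relation of hearing from `Src`, provided that there
are at most `K` landmarks, each walk with `z` steps can be replaced by one through a landmark, and
`d` bounds the diameter of the network. -/
noncomputable def landmarkDist (W z K d : ℕ) (Src : Set ℕ) (isL : Prop) (key : ℕ) :
    Prog LandmarkInfo :=
  (detect W Src (z + 1 + K) fun x => if isL ∧ x = key then 0 else ⊤).bind fun e =>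
    (gossip W (d + K * K + 1)
      {i | isL ∧ ∃ x δ : ℕ, trunc (z + 1) (e x) = δ ∧ i = Nat.pair x (Nat.pair key δ) + 1}).bind
    fun S => .ret
      { dist := chainDist (itemDist S) fun x => trunc (z + 1) (e x)
        between := fun x y => chainDist (itemDist S) (fun a => itemDist S a y) x
        keys := {x | itemDist S x x ≠ ⊤} }

theorem isSourceDist_keyDist {H : V → V → Prop} {L : Set V} {key : V → ℕ} {e : V → ℕ → ℕ∞}
    (he : ∀ v x, (v ∈ L ∧ x = key v → e v x = 0) ∧ (¬ (v ∈ L ∧ x = key v) → e v x = ⊤)) :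
    IsSourceDist H e (keyDist H L key) where
  le_init x v := by
    by_cases h : v ∈ L ∧ x = key v
    · rw [(he v x).1 h]
      exact (iInf₂_le v ⟨h.1, h.2.symm⟩).trans (ddist_self H v).le
    · rw [(he v x).2 h]; exact le_top
  le_step x w v h := by
    refine (keyDist_triangle x w v).trans ?_
    gcongr
    exact_mod_cast (reach_one.2 h).ddist_le
  zero x v h := by
    by_cases hv : v ∈ L ∧ x = key v
    · exact (he v x).1 hv
    · exfalso
      have : (1 : ℕ∞) ≤ keyDist H L key x v := by
        refine le_iInf₂ fun u hu => Order.one_le_iff_ne_zero.2 fun h0 => hv ?_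
        have : u = v := exists_reach_of_eq (n := 0) h0
        exact this ▸ ⟨hu.1, hu.2.symm⟩
      rw [h] at this
      simp at this
  pred x v d h := by
    have hne : Nonempty {u // u ∈ L ∧ key u = x} := by
      obtain ⟨u, hu⟩ := exists_of_keyDist_ne_top (H := H) (L := L) (key := key) (x := x) (v := v)
        (by simp [h])
      exact ⟨⟨u, hu⟩⟩
    obtain ⟨⟨u, hu⟩, hmin⟩ := ENat.exists_eq_iInf
      (fun u : {u // u ∈ L ∧ key u = x} => ddist H u.1 v)
    have hd : ddist H u v = (d + 1 : ℕ) := by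
      rw [← h]; simp only [keyDist]; rw [← iInf_subtype (f := fun u : {u // u ∈ L ∧ key u = x} => ddist H u.1 v)]
      exact hmin
    obtain ⟨w, h1, h2⟩ := exists_ddist_split hd
    have hwv : H w v := reach_one.1 (exists_reach_of_eq h2)
    refine ⟨w, hwv, le_antisymm ?_ ?_⟩
    · rw [← h1]; exact iInf₂_le u hu
    · have h3 := keyDist_triangle (L := L) (key := key) x w v (H := H)
      rw [h, h2] at h3
      push_cast at h3
      exact (ENat.add_le_add_iff_right ENat.one_ne_top).1 h3

/-- The execution is asserted for arbitrary `L` and `key`, and the hypotheses on them enter only the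
statement on correctness: rounds and messages must be bounded even when the sample is bad. The later
lemmas on executions with landmarks follow the same pattern. -/
theorem runs_landmarkDist {N : Network V} {W b z K d : ℕ} (hW : W ≤ b) (Src : V → Set ℕ)
    (L : Set V) (key : V → ℕ) :
    ∃ a, Runs N b (fun v => landmarkDist W z K d (Src v) (v ∈ L) (key v))
        (z + 1 + K + (d + K * K + 1)) a ∧
      (Function.Injective key → L.encard ≤ K →
        (∀ u v, ddist (Heard N Src) u v = z →
          ∃ x ∈ L, ddist (Heard N Src) u x + ddist (Heard N Src) x v = z) →
        (∀ u v, ∃ q ≤ d, Reach N.link.Adj q u v) →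
        (∀ u v δ, δ ≤ z + 1 + K → Nat.pair (key u) (Nat.pair (key v) δ) + 1 < 2 ^ W ∧
          Nat.pair δ (key u) + 1 < 2 ^ W) →
        ∀ v, (a v).dist = (fun x => keyDist (Heard N Src) L key x v) ∧
          (∀ x, ∀ w ∈ L, (a v).between x (key w) = keyDist (Heard N Src) L key x w) ∧
          (a v).keys = key '' L) := by
  classical
  set H := Heard N Src with hH
  obtain ⟨e, he, hspec⟩ := runs_detect (N := N) (W := W) (Src := Src)
    (e := fun v x => if v ∈ L ∧ x = key v then 0 else ⊤) (z + 1 + K) hW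
  obtain ⟨S, hS, hSspec⟩ := runs_gossip (N := N) (T := d + K * K + 1) hW fun v =>
    {i | v ∈ L ∧ ∃ x δ : ℕ, trunc (z + 1) (e v x) = δ ∧ i = Nat.pair x (Nat.pair (key v) δ) + 1}
  refine ⟨_, he.bind (hS.bind (T' := 0) (.ret _)), fun hkey hLK hhit hd hsize v => ?_⟩
  have hrank : ∀ v x, keyDist H L key x v ≠ ⊤ →
      (lexBelow (fun y => keyDist H L key y v) x).encard ≤ K := by
    intro v x hx
    refine (Set.encard_le_encard (t := key '' L) ?_).trans ((Set.encard_image_le key L).trans hLK)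
    intro y hy
    have : keyDist H L key y v ≠ ⊤ := by
      rcases hy with hy | hy
      · exact hy.ne_top
      · exact hy.1.trans_ne hx
    obtain ⟨u, hu, rfl⟩ := exists_of_keyDist_ne_top this
    exact ⟨u, hu, rfl⟩
  obtain ⟨hle, heq⟩ := hspec (keyDist H L key)
    (isSourceDist_keyDist fun v x => ⟨fun h => if_pos h, fun h => if_neg h⟩)
    (fun x v δ hx hδ => by
      obtain ⟨u, -, rfl⟩ := exists_of_keyDist_ne_top hx
      exact (hsize u v δ hδ).2)
  -- Outside the range `z + 1` the estimates may be wrong, but only too large, so truncation removes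
  -- the difference.
  have htr : ∀ v x, trunc (z + 1) (e v x) = trunc (z + 1) (keyDist H L key x v) := by
    intro v x
    by_cases h : keyDist H L key x v ≤ (z + 1 : ℕ)
    · rw [heq v x]
      push_cast at h ⊢
      exact add_le_add h (hrank v x (ne_top_of_le_ne_top (by simp) h))
    · rw [trunc, trunc, if_neg h, if_neg fun h' => h ((hle v x).trans h')]
  simp only [htr] at hSspec ⊢
  have hX : ∀ v, S v = _ := hSspec (K * K) d ?_ ?_ hd (Nat.lt_succ_self _)
  rotate_left
  · rintro v i ⟨hv, x, δ, hδ, rfl⟩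
    obtain ⟨hδ1, hδ2⟩ := trunc_eq_coe.1 hδ
    obtain ⟨u, -, rfl⟩ := exists_of_keyDist_ne_top (hδ1.trans_ne (ENat.natCast_ne_top δ))
    exact ⟨Nat.succ_pos _, (hsize u v δ (by omega)).1⟩
  -- An item is determined by an ordered pair of landmarks, hence the `K * K`.
  · refine (Set.encard_le_encard (t := (fun p : V × V => Nat.pair (key p.1) (Nat.pair (key p.2)
      (keyDist H L key (key p.1) p.2).toNat) + 1) '' (L ×ˢ L)) ?_).trans
        ((Set.encard_image_le _ _).trans ?_)
    · refine Set.iUnion_subset fun v => ?_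
      rintro i ⟨hv, x, δ, hδ, rfl⟩
      obtain ⟨hδ1, hδ2⟩ := trunc_eq_coe.1 hδ
      obtain ⟨u, hu, rfl⟩ := exists_of_keyDist_ne_top (hδ1.trans_ne (ENat.natCast_ne_top δ))
      exact ⟨(u, v), ⟨hu, hv⟩, by simp [hδ1]⟩
    · rw [Set.encard_prod]
      push_cast
      gcongr
  have hE : ∀ v x, ∀ w ∈ L, itemDist (S v) x (key w) = trunc (z + 1) (keyDist H L key x w) := by
    intro v x w hw
    have hmem : ∀ δ : ℕ, Nat.pair x (Nat.pair (key w) δ) + 1 ∈ S v ↔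
        trunc (z + 1) (keyDist H L key x w) = δ := by
      intro δ
      rw [hX v]
      constructor
      · rintro ⟨-, ⟨u, rfl⟩, hu, x', δ', hδ, he⟩
        obtain ⟨rfl, he'⟩ := Nat.pair_eq_pair.1 (Nat.succ_injective he)
        obtain ⟨hk, rfl⟩ := Nat.pair_eq_pair.1 he'
        rwa [hkey hk]
      · intro h
        exact Set.mem_iUnion.2 ⟨w, hw, x, δ, h, rfl⟩
    simp only [itemDist, hmem]
    generalize trunc (z + 1) (keyDist H L key x w) = y
    cases y with
    | top => simp
    | coe y => exact le_antisymm (iInf₂_le (f := fun (δ : ℕ) (_ : (y : ℕ∞) = δ) => (δ : ℕ∞)) y rfl) (le_iInf₂ fun δ hδ => hδ.le)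
  have hE' : ∀ v x y, y ∉ key '' L → itemDist (S v) x y = ⊤ := by
    intro v x y hy
    refine iInf₂_eq_top.2 fun δ hδ => absurd ?_ hy
    rw [hX v] at hδ
    obtain ⟨-, ⟨u, rfl⟩, hu, x', δ', -, he⟩ := hδ
    exact ⟨u, hu, (Nat.pair_eq_pair.1 (Nat.pair_eq_pair.1 (Nat.succ_injective he)).2).1.symm⟩
  refine ⟨funext fun x => chainDist_eq hkey hhit (hE v) (hE' v) v x, fun x w hw => ?_, ?_⟩
  · simp only [hE v _ w hw]
    exact chainDist_eq hkey hhit (hE v) (hE' v) w x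
  · ext x
    constructor
    · intro hx
      by_contra hc
      exact hx (hE' v x x hc)
    -- Every landmark publishes its distance `0` to itself; this is how `keys` recognises it.
    · rintro ⟨w, hw, rfl⟩
      change itemDist (S v) (key w) (key w) ≠ ⊤
      rw [hE v _ w hw, keyDist_key hkey hw, ddist_self, trunc_of_le (zero_le)]
      simp

end Landmarks

/-! ### Counting the vertices, or detecting that the guessed depth is too small. -/

section Census

variable {V : Type}

/-- The vertices of a shortest walk are distinct because their distances from `u` are. Such sets are
what the random sample has to hit. -/
theorem card_between [Fintype V] {H : V → V → Prop} {u v : V} {n : ℕ} (h : ddist H u v = n) :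
    ∃ S : Finset V, S.card = n + 1 ∧ ∀ w ∈ S, ddist H u w + ddist H w v = n := by
  classical
  have hw : ∀ i : Fin (n + 1), ∃ w, ddist H u w = (i : ℕ) ∧ ddist H w v = (n - i : ℕ) :=
    fun i => exists_ddist_split (h.trans (by congr 1; omega))
  choose w hw using hw
  refine ⟨Finset.univ.image w, ?_, ?_⟩
  · rw [Finset.card_image_of_injective, Finset.card_fin]
    intro i j hij
    have := (hw i).1
    rw [hij, (hw j).1] at this
    exact Fin.ext (by exact_mod_cast this.symm)
  · intro x hx
    obtain ⟨i, -, rfl⟩ := Finset.mem_image.1 hx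
    rw [(hw i).1, (hw i).2]
    norm_cast
    omega

theorem ddist_lt_card [Fintype V] {H : V → V → Prop} {u v : V} {n : ℕ} (h : ddist H u v = n) :
    n < Fintype.card V := by
  obtain ⟨S, hS, -⟩ := card_between h
  have := Finset.card_le_univ S
  omega

theorem reach_symm {H : V → V → Prop} (hH : ∀ u v, H u v → H v u) {n : ℕ} {u v : V}
    (h : Reach H n u v) : Reach H n v u :=
  (reach_flip.2 h).mono fun _ _ h => hH _ _ h

theorem finsum_hear [Fintype V] (N : Network V) (m : V → ℕ) (v : V) {F : ℕ → ℕ} (hF : F 0 = 0)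
    [DecidableRel N.link.Adj] :
    ∑ᶠ i, F (hear N m v i) = ∑ u, if N.link.Adj u v then F (m u) else 0 := by
  classical
  rw [finsum_eq_sum_of_support_subset (s := Finset.univ.image N.id),
    Finset.sum_image fun _ _ _ _ h => N.id_injective h]
  · refine Finset.sum_congr rfl fun u _ => ?_
    rw [hear_id]
    split_ifs <;> simp [hF]
  · intro i hi
    have : hear N m v i ≠ 0 := fun h => hi (by simp [h, hF])
    obtain ⟨u, rfl, -⟩ := hear_ne_zero this
    simp

/-! ### Counting the vertices -/

open Classical in
/-- The share of a message `m` that is addressed to the vertex with identifier `i`. -/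
noncomputable def addressed (i m : ℕ) : ℕ :=
  if m ≠ 0 ∧ (Nat.unpair (m - 1)).1 = i then (Nat.unpair (m - 1)).2 else 0

/-- Convergecast: in round `t`, the vertices of depth `R - t` send the number of vertices below
them to their parents. -/
noncomputable def convergecast (ownId parent depth R : ℕ) : Prog ℕ :=
  .loop (fun t c => if depth + t = R then Nat.pair parent c + 1 else 0)
    (fun _ c m => c + ∑ᶠ i, addressed ownId (m i)) 0 R 1

/-- The counts held at depth at most `R - t` always add up to the number of vertices, since round
`t` moves the counts at depth `R - t` to their parents. The same invariant bounds the messages. -/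
theorem runs_convergecast [Fintype V] {N : Network V} {b R : ℕ} {dep : V → ℕ} {par : V → ℕ}
    (hpar : ∀ v, dep v ≠ 0 → ∃ w, N.link.Adj v w ∧ N.id w = par v ∧ dep w + 1 = dep v)
    (hR : ∀ v, dep v ≤ R)
    (hb : ∀ u c, c ≤ Fintype.card V → Nat.pair (N.id u) c + 1 < 2 ^ b) :
    ∃ a, Runs N b (fun v => convergecast (N.id v) (par v) (dep v) R) R a ∧
      ∀ s, (∀ v, dep v = 0 ↔ v = s) → a s = Fintype.card V := by
  classical
  let out : V → ℕ → ℕ → ℕ := fun v t c => if dep v + t = R then Nat.pair (par v) c + 1 else 0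
  let step : V → ℕ → ℕ → (ℕ → ℕ) → ℕ := fun v _ c m => c + ∑ᶠ i, addressed (N.id v) (m i)
  have hsucc : ∀ t v, iter N out step (fun _ => 1) (t + 1) v
      = iter N out step (fun _ => 1) t v + ∑ u, if N.link.Adj u v ∧ dep u + t = R ∧
          par u = N.id v then iter N out step (fun _ => 1) t u else 0 := by
    intro t v
    have := finsum_hear N (fun u => out u t (iter N out step (fun _ => 1) t u)) v
      (F := addressed (N.id v)) (by simp [addressed])
    refine (congrArg (iter N out step (fun _ => 1) t v + ·) this).trans ?_
    refine congrArg _ (Finset.sum_congr rfl fun u _ => ?_)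
    by_cases h1 : N.link.Adj u v <;> by_cases h2 : dep u + t = R <;>
      simp [h1, h2, out, addressed]
  have hsum : ∀ t ≤ R, ∑ v with dep v + t ≤ R, iter N out step (fun _ => 1) t v
      = Fintype.card V := by
    intro t
    induction t with
    | zero =>
      intro _
      rw [Finset.filter_true_of_mem fun v _ => by simpa using hR v]
      simp [iter]
    | succ t ih =>
      intro ht
      rw [← ih (by omega)]
      simp only [hsucc, Finset.sum_add_distrib]
      have hsplit : (Finset.univ.filter fun v => dep v + t ≤ R)
          = (Finset.univ.filter fun v => dep v + (t + 1) ≤ R) ∪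
            (Finset.univ.filter fun v => dep v + t = R) := by
        ext v; simp; omega
      rw [hsplit, Finset.sum_union (Finset.disjoint_filter.2 fun v _ h1 h2 => by omega)]
      congr 1
      rw [Finset.sum_comm, Finset.sum_filter]
      refine Finset.sum_congr rfl fun u _ => ?_
      by_cases hu : dep u + t = R
      · obtain ⟨w, hw1, hw2, hw3⟩ := hpar u (by omega)
        rw [if_pos hu, Finset.sum_eq_single w]
        · rw [if_pos ⟨hw1, hu, hw2.symm⟩]
        · intro v _ hv
          rw [if_neg]
          rintro ⟨-, -, h⟩
          exact hv (N.id_injective (h.symm.trans hw2.symm))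
        · intro h
          exact absurd (Finset.mem_filter.2 ⟨Finset.mem_univ w, by omega⟩) h
      · rw [if_neg hu]
        exact Finset.sum_eq_zero fun v _ => if_neg fun h => hu h.2.1
  refine ⟨_, runs_loop R fun v t ht => ?_, fun s hs => ?_⟩
  · change out v t (iter N out step (fun _ => 1) t v) < 2 ^ b
    by_cases h : dep v + t = R
    · obtain ⟨w, -, hw, -⟩ := hpar v (by omega)
      simp only [out, if_pos h, ← hw]
      refine hb w _ ((hsum t ht.le).symm ▸ ?_)
      exact Finset.single_le_sum (f := fun v => iter N out step (fun _ => 1) t v)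
        (fun _ _ => Nat.zero_le _) (Finset.mem_filter.2 ⟨Finset.mem_univ v, h.le⟩)
    · simp only [out, if_neg h]
      positivity
  · rw [← hsum R le_rfl, Finset.sum_eq_single s]
    · intro v hv hvs
      rw [Finset.mem_filter] at hv
      exact absurd ((hs v).1 (by omega)) hvs
    · intro h
      exact absurd (Finset.mem_filter.2 ⟨Finset.mem_univ s, by rw [(hs s).2 rfl]; omega⟩) h

open Classical in
/-- The number `0` if `p` holds, and `∞` otherwise. -/
noncomputable def flag (p : Prop) : ℕ∞ := if p then 0 else ⊤

theorem flag_of {p : Prop} (h : p) : flag p = 0 := if_pos h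

theorem flag_of_not {p : Prop} (h : ¬ p) : flag p = ⊤ := if_neg h

open Classical in
/-- Count the vertices, when `depth` is the distance from the source, which is at most `R`. -/
noncomputable def count (isSource : Prop) (ownId : ℕ) (nbrs : Set ℕ) (R depth : ℕ) :
    Prog (Option ℕ) :=
  (Prog.round (depth + 1) .ret).bind fun m =>
    (convergecast ownId (sInf {i | m i = depth}) depth R).bind fun c =>
    (relax id nbrs (fun _ => if isSource then (c : ℕ∞) else ⊤) R).bind fun r =>
    .ret (some (min (if isSource then (c : ℕ∞) else ⊤) (r R)).toNat)

open Classical in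
/-- If all vertices have distance at most `R` from the source, return the number of vertices;
otherwise return `none`. -/
noncomputable def census (isSource : Prop) (ownId : ℕ) (nbrs : Set ℕ) (R : ℕ) :
    Prog (Option ℕ) :=
  (relax (clamp 1) nbrs (fun _ => flag isSource) R).bind fun d =>
    (relax (clamp 1) nbrs (fun _ => flag (¬ (isSource ∨ d R = 0))) (2 * R + 1)).bind
    fun alarm =>
    if (isSource ∨ d R = 0) ∧ alarm (2 * R + 1) = ⊤ then
      count isSource ownId nbrs R (sInf {t | isSource ∨ d t = 0})
    else .ret none

section census

variable {N : Network V}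

theorem heard_nbrs : Heard N (fun v => N.id '' {u | N.link.Adj u v}) = N.link.Adj := by
  funext w v
  simp only [Heard, eq_iff_iff, and_iff_left_iff_imp]
  exact fun h => ⟨w, h, rfl⟩

/-- One-bit messages suffice here, so flooding is possible before anything is known about `n`. -/
theorem runs_flood {b : ℕ} (hb : 1 ≤ b) (P : V → Prop) (T : ℕ) :
    ∃ a, Runs N b (fun v => relax (clamp 1) (N.id '' {u | N.link.Adj u v})
        (fun _ => flag (P v)) T) T a ∧
      ∀ v t, t ≤ T → (a v t = 0 ∨ a v t = ⊤) ∧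
        (a v t = 0 ↔ ∃ q u, 1 ≤ q ∧ q ≤ t ∧ Reach N.link.Adj q u v ∧ P u) := by
  obtain ⟨a, ha, hspec⟩ := runs_relax (N := N) (b := b) (cl := clamp 1) (T := T)
    (Src := fun v => N.id '' {u | N.link.Adj u v}) (own := fun v _ => flag (P v))
    (clamp_zero 1) (.inl fun m => (clamp_lt 1 m).trans_le (Nat.pow_le_pow_right (by norm_num) hb))
  have hw := hspec fun u t => clamp_of_lt (by unfold flag; split_ifs <;> simp [enc])
  rw [heard_nbrs] at hw
  refine ⟨a, ha, fun v t ht => ?_⟩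
  by_cases htop : a v t = ⊤
  · refine ⟨.inr htop, fun h => by simp [h] at htop, ?_⟩
    rintro ⟨q, u, hq1, hq2, hr, hu⟩
    simpa [flag_of hu] using hw.le hq1 hq2 ht hr
  · obtain ⟨q, u, hq1, hq2, hr, he⟩ := hw.attained ht htop
    rw [he] at htop ⊢
    have hu : P u := by
      by_contra hu
      simp [flag_of_not hu] at htop
    rw [flag_of hu]
    exact ⟨.inl rfl, fun _ => ⟨q, u, hq1, hq2, hr, hu⟩, fun _ => rfl⟩

variable {s : V} {b R : ℕ} {dep : V → ℕ}

theorem runs_count [Fintype V] (hdep : ∀ v, ddist N.link.Adj s v = dep v) (hR : ∀ v, dep v ≤ R)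
    (hb : ∀ u c, c ≤ Fintype.card V → Nat.pair (N.id u) c + 1 < 2 ^ b) :
    Runs N b (fun v => count (v = s) (N.id v) (N.id '' {u | N.link.Adj u v}) R (dep v))
      (1 + (R + (R + 0))) fun _ => some (Fintype.card V) := by
  classical
  have hcard : ∀ c ≤ Fintype.card V, c + 1 < 2 ^ b := fun c hc =>
    (Nat.add_le_add_right (Nat.right_le_pair _ _) 1).trans_lt (hb s c hc)
  have hdep0 : ∀ v, dep v = 0 ↔ v = s := by
    intro v
    constructor
    · intro h
      have := hdep v
      rw [h] at this
      exact (exists_reach_of_eq (n := 0) this).symm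
    · rintro rfl
      have := hdep v
      rw [ddist_self] at this
      exact_mod_cast this.symm
  -- Depths are broadcast increased by one, so that depth `0` is not silence; a message equal to the
  -- own depth thus comes from one level up. The source gets a junk parent, but it does not send
  -- within the `R` rounds.
  obtain ⟨c, hc, hcs⟩ := runs_convergecast (N := N) (b := b) (R := R) (dep := dep)
    (par := fun v => sInf {i | hear N (fun u => dep u + 1) v i = dep v}) (by
      intro v hv
      have hne : {i | hear N (fun u => dep u + 1) v i = dep v}.Nonempty := by
        obtain ⟨d, hd⟩ := Nat.exists_eq_succ_of_ne_zero hv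
        obtain ⟨w, h1, h2⟩ := exists_ddist_split (a := d) (b := 1) ((hdep v).trans (by rw [hd]))
        refine ⟨N.id w, ?_⟩
        have hadj := reach_one.1 (exists_reach_of_eq h2)
        rw [hdep w] at h1
        change hear N _ v (N.id w) = _
        rw [hear_id, if_pos hadj, hd]
        exact congrArg (· + 1) (by exact_mod_cast h1)
      have hm := Nat.sInf_mem hne
      obtain ⟨w, hw1, hw2, hw3⟩ := hear_ne_zero (hm.trans_ne hv)
      exact ⟨w, hw2.symm, hw1, hw3.symm.trans hm⟩) hR hb
  have hcs' := hcs s hdep0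
  obtain ⟨r, hr, hspec⟩ := runs_relax (N := N) (b := b) (cl := id) (T := R)
    (Src := fun v => N.id '' {u | N.link.Adj u v})
    (own := fun v _ => if v = s then (c v : ℕ∞) else ⊤) rfl (.inr fun u t => ⟨rfl, by
      split_ifs with h
      · subst h
        rw [enc_coe, hcs']
        exact hcard _ le_rfl
      · rw [enc_top]; positivity⟩)
  have hw := hspec fun _ _ => rfl
  rw [heard_nbrs] at hw
  have hfin : ∀ v, some (min (if v = s then (c v : ℕ∞) else ⊤) (r v R)).toNat
      = some (Fintype.card V) := by
    intro v
    have hval : ∀ t ≤ R, r v t ≠ ⊤ → r v t = Fintype.card V := by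
      intro t ht hne
      obtain ⟨q, u, -, -, -, he⟩ := hw.attained ht hne
      rw [he] at hne ⊢
      split_ifs at hne ⊢ with hu
      · rw [hu, hcs']
      · exact absurd rfl hne
    by_cases hv : v = s
    · rw [if_pos hv, hv, hcs']
      subst hv
      by_cases htop : r v R = ⊤
      · simp [htop]
      · simp [hval R le_rfl htop]
    · rw [if_neg hv, min_eq_right le_top]
      have hle := hw.le (t := R) (Nat.pos_of_ne_zero fun h => hv ((hdep0 v).1 h)) (hR v) le_rfl
        (exists_reach_of_eq (hdep v))
      rw [if_pos rfl] at hle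
      rw [hval R le_rfl (ne_top_of_le_ne_top (ENat.natCast_ne_top _) hle), ENat.toNat_natCast]
  rw [← funext hfin]
  refine Runs.bind (Runs.exchange fun v => hcard _ (ddist_lt_card (hdep v)).le) ?_
  exact hc.bind (hr.bind (.ret _))

theorem runs_census_flood (hb : 1 ≤ b) (hdep : ∀ v, ddist N.link.Adj s v = dep v) (R : ℕ) :
    ∃ d alarm : V → ℕ → ℕ∞,
      (∀ v t, t ≤ R → (v = s ∨ d v t = 0 ↔ dep v ≤ t)) ∧
      (∀ v, alarm v (2 * R + 1) = ⊤ ↔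
        ¬ ∃ q u, 1 ≤ q ∧ q ≤ 2 * R + 1 ∧ Reach N.link.Adj q u v ∧ R < dep u) ∧
      ∀ (T : ℕ) (a : V → Option ℕ), Runs N b (fun v =>
        open Classical in
        if (v = s ∨ d v R = 0) ∧ alarm v (2 * R + 1) = ⊤ then
          count (v = s) (N.id v) (N.id '' {u | N.link.Adj u v}) R (sInf {t | v = s ∨ d v t = 0})
        else .ret none) T a →
        Runs N b (fun v => census (v = s) (N.id v) (N.id '' {u | N.link.Adj u v}) R)
          (R + (2 * R + 1 + T)) a := by
  classical
  obtain ⟨d, hd, hds⟩ := runs_flood (N := N) hb (fun v => v = s) R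
  obtain ⟨al, hal, hals⟩ := runs_flood (N := N) hb (fun v => ¬ (v = s ∨ d v R = 0)) (2 * R + 1)
  have hreach : ∀ v t, t ≤ R → (v = s ∨ d v t = 0 ↔ dep v ≤ t) := by
    intro v t ht
    rw [(hds v t ht).2]
    constructor
    · rintro (rfl | ⟨q, u, -, hq, hr, rfl⟩)
      · have := hdep v
        rw [ddist_self] at this
        have : dep v = 0 := by exact_mod_cast this.symm
        omega
      · have := hr.ddist_le
        rw [hdep v] at this
        have : dep v ≤ q := by exact_mod_cast this
        omega
    · intro h
      have hr := exists_reach_of_eq (hdep v)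
      rcases Nat.eq_zero_or_pos (dep v) with h0 | h0
      · rw [h0] at hr
        exact .inl (Eq.symm hr)
      · exact .inr ⟨dep v, s, h0, h, hr, rfl⟩
  refine ⟨d, al, hreach, fun v => ?_, fun T a h => ?_⟩
  · have h1 := hals v (2 * R + 1) le_rfl
    have h2 : al v (2 * R + 1) = ⊤ ↔ ¬ al v (2 * R + 1) = 0 := by
      rcases h1.1 with h | h <;> simp [h]
    rw [h2, h1.2]
    simp only [hreach _ R le_rfl, not_le]
  · unfold census
    exact hd.bind (hal.bind h)

theorem runs_census [Fintype V] (hdep : ∀ v, ddist N.link.Adj s v = dep v) (hR : ∀ v, dep v ≤ R)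
    (hb : ∀ u c, c ≤ Fintype.card V → Nat.pair (N.id u) c + 1 < 2 ^ b) :
    Runs N b (fun v => census (v = s) (N.id v) (N.id '' {u | N.link.Adj u v}) R)
      (R + ((2 * R + 1) + (1 + (R + (R + 0))))) fun _ => some (Fintype.card V) := by
  classical
  have hb1 : 1 ≤ b := by
    by_contra h
    have := hb s 0 (Nat.zero_le _)
    rw [show b = 0 by omega] at this
    omega
  obtain ⟨d, al, hd, hal, h⟩ := runs_census_flood (N := N) hb1 hdep R
  refine h _ _ ?_
  convert runs_count (N := N) hdep hR hb using 2 with v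
  rw [if_pos]
  · congr 1
    have hmem : dep v ∈ {t | v = s ∨ d v t = 0} := (hd v _ (hR v)).2 le_rfl
    refine le_antisymm (Nat.sInf_le hmem) ?_
    have hle := (Nat.sInf_le hmem).trans (hR v)
    exact (hd v _ hle).1 (Nat.sInf_mem ⟨_, hmem⟩)
  · refine ⟨(hd v R le_rfl).2 (hR v), (hal v).2 ?_⟩
    rintro ⟨q, u, -, -, -, hu⟩
    exact absurd (hR u) (by omega)

/-- If some vertex is deeper than `R`, one has depth exactly `R + 1` and raises the alarm. A vertex
of depth at most `R` is within `R + 1 + R` of it, hence the `2 * R + 1` rounds of alarm; so all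
vertices fail together. -/
theorem runs_census_none (hdep : ∀ v, ddist N.link.Adj s v = dep v) (hR : ∃ v, R < dep v)
    (hb : 1 ≤ b) :
    Runs N b (fun v => census (v = s) (N.id v) (N.id '' {u | N.link.Adj u v}) R)
      (R + ((2 * R + 1) + 0)) fun _ => none := by
  classical
  obtain ⟨d, al, hd, hal, h⟩ := runs_census_flood (N := N) hb hdep R
  refine h _ _ ?_
  convert Runs.ret (N := N) (b := b) (fun _ : V => (none : Option ℕ)) using 2 with v
  rw [if_neg]
  rintro ⟨h1, h2⟩
  rw [hd v R le_rfl] at h1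
  refine (hal v).1 h2 ?_
  obtain ⟨x, hx⟩ := hR
  obtain ⟨w, hw, -⟩ := exists_ddist_split (a := R + 1) (b := dep x - (R + 1))
    ((hdep x).trans (by congr 1; omega))
  have hw' := hdep w
  rw [hw] at hw'
  have hw'' : R + 1 = dep w := by exact_mod_cast hw'
  refine ⟨R + 1 + dep v, w, by omega, by omega, ?_, by omega⟩
  exact (reach_symm (fun _ _ h => h.symm) (exists_reach_of_eq hw)).trans
    (exists_reach_of_eq (hdep v))

end census

end Census

/-! ### Independent coins: few landmarks, and every large set is hit. -/

section Sampling

variable {V : Type}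

/-! ### Random sampling -/

/-- The first `m` coins of `v` show heads. -/
def Lucky (m : ℕ) (ω : RandomStrings V) (v : V) : Prop := ∀ j < m, ω v j = true

section sampling

variable [Fintype V]

/-- The distribution of an infinite sequence of fair coins. -/
noncomputable abbrev coinSequence : Measure (ℕ → Bool) :=
  Measure.infinitePi fun _ : ℕ => (PMF.uniformOfFintype Bool).toMeasure

instance : IsProbabilityMeasure (coinMeasure V) := by
  unfold coinMeasure; infer_instance

theorem measurableSet_heads (m : ℕ) : MeasurableSet {f : ℕ → Bool | ∀ j < m, f j = true} := by
  have : {f : ℕ → Bool | ∀ j < m, f j = true} = Set.pi (Finset.range m) fun _ => {true} := by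
    ext f; simp [Set.pi]
  rw [this]
  exact MeasurableSet.pi (Finset.countable_toSet _) fun _ _ => .of_discrete

theorem coinSequence_heads (m : ℕ) :
    coinSequence.real {f : ℕ → Bool | ∀ j < m, f j = true} = (1 / 2) ^ m := by
  have : {f : ℕ → Bool | ∀ j < m, f j = true} = Set.pi (Finset.range m) fun _ => {true} := by
    ext f; simp [Set.pi]
  rw [this, measureReal_def, Measure.infinitePi_pi _ fun _ _ => .of_discrete]
  simp

theorem coinMeasure_forall (S : Finset V) {A : Set (ℕ → Bool)} :
    (coinMeasure V).real {ω | ∀ v ∈ S, ω v ∈ A} = coinSequence.real A ^ S.card := by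
  classical
  have : {ω : RandomStrings V | ∀ v ∈ S, ω v ∈ A}
      = Set.univ.pi fun v => if v ∈ S then A else Set.univ := by
    ext ω
    simp only [Set.mem_ofPred_eq, Set.mem_pi, Set.mem_univ, true_imp_iff]
    refine forall_congr' fun v => ?_
    split_ifs with h <;> simp [h]
  rw [this, measureReal_def, coinMeasure, Measure.pi_pi, ENNReal.toReal_prod]
  simp only [apply_ite coinSequence, apply_ite ENNReal.toReal, measure_univ, ENNReal.toReal_one]
  rw [Finset.prod_ite_mem, Finset.univ_inter, Finset.prod_const, measureReal_def]

theorem coinMeasure_all_lucky (m : ℕ) (S : Finset V) :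
    (coinMeasure V).real {ω | ∀ v ∈ S, Lucky m ω v} = ((1 / 2) ^ m) ^ S.card := by
  rw [← coinSequence_heads]
  exact coinMeasure_forall S (A := {f | ∀ j < m, f j = true})

theorem coinMeasure_none_lucky (m : ℕ) (S : Finset V) :
    (coinMeasure V).real {ω | ∀ v ∈ S, ¬ Lucky m ω v} = (1 - (1 / 2) ^ m) ^ S.card := by
  rw [← coinSequence_heads, ← probReal_compl_eq_one_sub (measurableSet_heads m)]
  exact coinMeasure_forall S (A := {f | ∀ j < m, f j = true}ᶜ)

/-- Union bound over the sets of size `J`. After multiplication by `2 ^ J` the bound is one term of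
the binomial expansion of `(1 + p) ^ n` with `p = 2 * 2⁻ᵐ`, which is at most `exp (2 * A)`; finally
`e < 4`. -/
theorem coinMeasure_many_lucky (m J A : ℕ) (hA : (Fintype.card V : ℝ) * (1 / 2) ^ m ≤ A) :
    (coinMeasure V).real {ω | ∃ S : Finset V, S.card = J ∧ ∀ v ∈ S, Lucky m ω v}
      ≤ 2 ^ (4 * A) / 2 ^ J := by
  have h1 : {ω : RandomStrings V | ∃ S : Finset V, S.card = J ∧ ∀ v ∈ S, Lucky m ω v}
      = ⋃ S ∈ Finset.powersetCard J (Finset.univ : Finset V), {ω | ∀ v ∈ S, Lucky m ω v} := by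
    ext ω; simp [Finset.mem_powersetCard]
  rw [h1]
  refine (measureReal_biUnion_finset_le _ _).trans ?_
  rw [Finset.sum_congr rfl fun S hS => by
    rw [coinMeasure_all_lucky, (Finset.mem_powersetCard.1 hS).2]]
  rw [Finset.sum_const, Finset.card_powersetCard, Finset.card_univ, nsmul_eq_mul,
    le_div_iff₀ (by positivity), mul_assoc, ← mul_pow]
  set p : ℝ := (1 / 2) ^ m * 2 with hp
  have h2 : ((Fintype.card V).choose J : ℝ) * p ^ J ≤ (p + 1) ^ Fintype.card V := by
    rw [add_pow]
    by_cases hJ : J ≤ Fintype.card V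
    · refine le_trans (le_of_eq ?_) (Finset.single_le_sum (f := fun i => p ^ i * 1 ^
        (Fintype.card V - i) * ((Fintype.card V).choose i : ℝ)) (fun i _ => by positivity)
        (Finset.mem_range.2 (Nat.lt_succ_of_le hJ)))
      simp only [one_pow, mul_one]
      ring
    · rw [Nat.choose_eq_zero_of_lt (by omega)]
      simp only [Nat.cast_zero, zero_mul]
      positivity
  refine h2.trans ?_
  have h3 : (p + 1) ^ Fintype.card V ≤ Real.exp (2 * A) := by
    refine (pow_le_pow_left₀ (by positivity) (Real.add_one_le_exp p) _).trans ?_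
    rw [← Real.exp_nat_mul]
    refine Real.exp_le_exp.2 ?_
    rw [hp]
    linarith
  refine h3.trans ?_
  have h4 : Real.exp (2 * A) = Real.exp 1 ^ (2 * A) := by
    rw [← Real.exp_nat_mul]; push_cast; ring_nf
  rw [h4, show (2 : ℝ) ^ (4 * A) = (2 ^ 2) ^ (2 * A) by rw [← pow_mul]; ring_nf]
  exact pow_le_pow_left₀ (Real.exp_pos 1).le (by have := Real.exp_one_lt_d9; linarith) _

/-- For `m = 0` every vertex is lucky. Otherwise `1 - x ≤ exp (-x)` bounds the left side by `exp
(-a)`, and `e > 2`. -/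
theorem one_sub_pow_le {m z a : ℕ} (hz : 1 ≤ z) (h : m = 0 ∨ a * 2 ^ m ≤ z) :
    (1 - (1 / 2 : ℝ) ^ m) ^ z ≤ 1 / 2 ^ a := by
  rcases h with rfl | h
  · rw [pow_zero, sub_self, zero_pow (by omega)]
    positivity
  have h0 : (0 : ℝ) ≤ 1 - (1 / 2) ^ m := sub_nonneg.2 (pow_le_one₀ (by norm_num) (by norm_num))
  refine (pow_le_pow_left₀ h0 (Real.one_sub_le_exp_neg _) z).trans ?_
  rw [← Real.exp_nat_mul]
  have h1 : (z : ℝ) * -((1 / 2) ^ m) ≤ -a := by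
    have : (a : ℝ) * 2 ^ m ≤ z := by exact_mod_cast h
    have h2 : (a : ℝ) = a * 2 ^ m * (1 / 2) ^ m := by
      rw [mul_assoc, ← mul_pow]; norm_num
    rw [mul_neg, neg_le_neg_iff, h2]
    gcongr
  refine (Real.exp_le_exp.2 h1).trans ?_
  rw [Real.exp_neg, one_div]
  refine inv_anti₀ (by positivity) ?_
  rw [← Real.exp_one_pow]
  exact pow_le_pow_left₀ (by norm_num) (by have := Real.exp_one_gt_d9; linarith) _

/-- With high probability, the lucky vertices are few, and meet all large sets of a family. -/
theorem coinMeasure_sampling {ι : Type} [Fintype ι] (F : ι → Finset V) {n c l m z A : ℕ}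
    (hn : Fintype.card V = n) (hι : Fintype.card ι ≤ 2 * n ^ 2) (hl : n < 2 ^ l) (hn0 : 1 ≤ n)
    (hz : 1 ≤ z) (hm : m = 0 ∨ (c + 4) * l * 2 ^ m ≤ z) (hA : n ≤ A * 2 ^ m) :
    coinMeasure V {ω | ¬ ((∀ S : Finset V, S.card = 4 * A + (c + 4) * l →
        ¬ ∀ v ∈ S, Lucky m ω v) ∧ ∀ i, z ≤ (F i).card → ∃ v ∈ F i, Lucky m ω v)}
      ≤ ((n : ENNReal) ^ c)⁻¹ := by
  -- Here `2 ^ a = (2 ^ l) ^ (c + 4)`: the exponent `c` yields `n⁻ᶜ`, and the remaining `4` absorbs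
  -- the `1 + 2 * n ^ 2` terms of the union bound.
  set a := (c + 4) * l
  have hsub : {ω : RandomStrings V | ¬ ((∀ S : Finset V, S.card = 4 * A + a →
        ¬ ∀ v ∈ S, Lucky m ω v) ∧ ∀ i, z ≤ (F i).card → ∃ v ∈ F i, Lucky m ω v)}
      ⊆ {ω | ∃ S : Finset V, S.card = 4 * A + a ∧ ∀ v ∈ S, Lucky m ω v} ∪
        ⋃ i ∈ Finset.univ.filter (fun i => z ≤ (F i).card), {ω | ∀ v ∈ F i, ¬ Lucky m ω v} := by
    intro ω hω
    simp only [Set.mem_ofPred_eq, not_and_or] at hω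
    rcases hω with h | h
    · left
      push Not at h
      exact h
    · right
      push Not at h
      obtain ⟨i, hi, h⟩ := h
      exact Set.mem_biUnion (by simpa using hi) h
  have hreal : (coinMeasure V).real {ω : RandomStrings V |
      ¬ ((∀ S : Finset V, S.card = 4 * A + a → ¬ ∀ v ∈ S, Lucky m ω v) ∧
        ∀ i, z ≤ (F i).card → ∃ v ∈ F i, Lucky m ω v)} ≤ ((n : ℝ) ^ c)⁻¹ := by
    refine (measureReal_mono hsub).trans ((measureReal_union_le _ _).trans ?_)
    have h1 := coinMeasure_many_lucky (V := V) m (4 * A + a) A (by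
      rw [hn, one_div, inv_pow, ← div_eq_mul_inv, div_le_iff₀ (by positivity)]
      exact_mod_cast hA)
    have h2 : (coinMeasure V).real (⋃ i ∈ Finset.univ.filter (fun i => z ≤ (F i).card),
        {ω | ∀ v ∈ F i, ¬ Lucky m ω v}) ≤ (2 * n ^ 2 : ℕ) * (1 / 2 ^ a) := by
      refine (measureReal_biUnion_finset_le _ _).trans ?_
      refine (Finset.sum_le_card_nsmul _ _ (1 / 2 ^ a) fun i hi => ?_).trans ?_
      · rw [coinMeasure_none_lucky]
        exact one_sub_pow_le (hz.trans (by simpa using hi))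
          (hm.imp_right fun h => h.trans (by simpa using hi))
      · rw [nsmul_eq_mul]
        gcongr
        exact (Finset.card_filter_le _ _).trans hι
    refine (add_le_add h1 h2).trans ?_
    rw [pow_add, div_mul_cancel_left₀ (by positivity)]
    have h3 : ((1 + 2 * n ^ 2 : ℕ) : ℝ) ≤ (2 ^ l) ^ 4 := by
      have : 1 + 2 * n ^ 2 ≤ (2 ^ l) ^ 4 := by
        refine le_trans ?_ (Nat.pow_le_pow_left hl 4)
        nlinarith [sq_nonneg (n : ℤ)]
      exact_mod_cast this
    have h4 : (n : ℝ) ^ c ≤ (2 ^ l) ^ c := by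
      gcongr
      exact_mod_cast hl.le
    have h5 : (2 : ℝ) ^ a = (2 ^ l) ^ c * (2 ^ l) ^ 4 := by
      rw [← pow_add, ← pow_mul, mul_comm l]
    have hn' : (0 : ℝ) < n ^ c := by positivity
    calc ((2 : ℝ) ^ a)⁻¹ + (2 * n ^ 2 : ℕ) * (1 / 2 ^ a)
        = ((1 + 2 * n ^ 2 : ℕ) : ℝ) / 2 ^ a := by push_cast; ring
      _ ≤ (2 ^ l) ^ 4 / 2 ^ a := by gcongr
      _ = ((2 ^ l) ^ c)⁻¹ := by rw [h5]; field_simp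
      _ ≤ ((n : ℝ) ^ c)⁻¹ := inv_anti₀ hn' h4
  rw [← ofReal_measureReal]
  refine (ENNReal.ofReal_le_ofReal hreal).trans (le_of_eq ?_)
  rw [ENNReal.ofReal_inv_of_pos (by positivity), ENNReal.ofReal_pow (by positivity),
    ENNReal.ofReal_natCast]

end sampling

end Sampling

/-! ### Structure of replacement paths, and the links seen by each relation. -/

section Detours

variable {V : Type}

/-! ### Detours -/

theorem exists_isDiwalk_iff {G : Digraph V} {u v : V} {k : ℕ} :
    (∃ p : Fin (k + 1) → V, IsDiwalk G u v p) ↔ Reach G.Adj k u v := by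
  induction k generalizing v with
  | zero =>
    constructor
    · rintro ⟨p, h1, h2, -⟩
      exact h1.symm.trans h2
    · rintro rfl
      exact ⟨fun _ => u, rfl, rfl, fun i => i.elim0⟩
  | succ k ih =>
    constructor
    · rintro ⟨p, h1, h2, h3⟩
      refine ⟨p (Fin.last k).castSucc, ih.1 ⟨fun i => p i.castSucc, h1, rfl, fun i => ?_⟩, ?_⟩
      · simpa using h3 i.castSucc
      · simpa [← h2] using h3 (Fin.last k)
    · rintro ⟨w, hw, hwv⟩
      obtain ⟨p, h1, h2, h3⟩ := ih.2 hw
      refine ⟨Fin.snoc p v, ?_, by simp, fun i => ?_⟩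
      · rw [← Fin.castSucc_zero, Fin.snoc_castSucc, h1]
      · induction i using Fin.lastCases with
        | last => simpa [h2] using hwv
        | cast i => rw [← Fin.castSucc_succ, Fin.snoc_castSucc, Fin.snoc_castSucc]; exact h3 i

theorem didist_eq_ddist (G : Digraph V) (u v : V) : didist G u v = ddist G.Adj u v := by
  simp only [didist, ddist, exists_isDiwalk_iff]

variable (I : RPathsInstance V)

/-- The `k`-th vertex of the given path. -/
def vert (k : ℕ) : V := I.path ⟨min k I.hops, by omega⟩

/-- The edges of the graph, without loops, that do not belong to the given path. -/
def OffPath (w v : V) : Prop := I.graph.Adj w v ∧ w ≠ v ∧ ¬ I.OnPath w v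

variable {I}

theorem vert_castSucc (i : Fin I.hops) : I.path i.castSucc = vert I i := by
  unfold vert; congr 1; ext; simp

theorem vert_succ (i : Fin I.hops) : I.path i.succ = vert I (i + 1) := by
  unfold vert; congr 1; ext; simp

theorem vert_zero : vert I 0 = I.source := by
  rw [← I.isDiwalk_path.1]; unfold vert; congr 1

theorem vert_hops : vert I I.hops = I.target := by
  rw [← I.isDiwalk_path.2.1]; unfold vert; congr 1; ext; simp

theorem onPath_iff {w v : V} :
    I.OnPath w v ↔ ∃ k < I.hops, w = vert I k ∧ v = vert I (k + 1) := by
  constructor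
  · rintro ⟨i, h1, h2⟩
    exact ⟨i, i.2, by rw [← h1, vert_castSucc], by rw [← h2, vert_succ]⟩
  · rintro ⟨k, hk, rfl, rfl⟩
    exact ⟨⟨k, hk⟩, vert_castSucc _, vert_succ _⟩

theorem adj_of_onPath {w v : V} (h : I.OnPath w v) : I.graph.Adj w v := by
  obtain ⟨i, rfl, rfl⟩ := h
  exact I.isDiwalk_path.2.2 i

theorem reach_onPath_vert {a d : ℕ} (h : a + d ≤ I.hops) :
    Reach I.OnPath d (vert I a) (vert I (a + d)) := by
  induction d with
  | zero => rfl
  | succ d ih =>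
    exact ⟨_, ih (by omega), onPath_iff.2 ⟨a + d, by omega, rfl, rfl⟩⟩

theorem reach_vert {a b : ℕ} (hab : a ≤ b) (h : b ≤ I.hops) :
    Reach I.graph.Adj (b - a) (vert I a) (vert I b) := by
  have := (reach_onPath_vert (I := I) (a := a) (d := b - a) (by omega)).mono
    fun _ _ => adj_of_onPath
  rwa [show a + (b - a) = b by omega] at this

theorem hops_le_of_reach {n : ℕ} (h : Reach I.graph.Adj n I.source I.target) : I.hops ≤ n := by
  have := h.ddist_le
  rw [← didist_eq_ddist, I.isShortest_path] at this
  exact_mod_cast this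

/-- A walk advancing by more positions than it has edges would shorten the given path. In particular
a detour with `d` edges returns at most `d` positions ahead. -/
theorem le_of_reach_vert {a j d : ℕ} (ha : a ≤ I.hops) (hj : j ≤ I.hops)
    (h : Reach I.graph.Adj d (vert I a) (vert I j)) : j ≤ a + d := by
  have := ((reach_vert (Nat.zero_le a) ha).trans h).trans (reach_vert hj le_rfl)
  rw [vert_zero, vert_hops] at this
  have := hops_le_of_reach this
  omega

theorem vert_injOn {a b : ℕ} (ha : a ≤ I.hops) (hb : b ≤ I.hops) (h : vert I a = vert I b) :
    a = b := by
  have h1 := le_of_reach_vert (d := 0) ha hb h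
  have h2 := le_of_reach_vert (d := 0) hb ha h.symm
  omega

theorem reach_onPath_iff {a d : ℕ} (ha : a ≤ I.hops) {v : V} :
    Reach I.OnPath d (vert I a) v ↔ a + d ≤ I.hops ∧ v = vert I (a + d) := by
  refine ⟨fun h => ?_, fun h => h.2 ▸ reach_onPath_vert h.1⟩
  induction d generalizing v with
  | zero => exact ⟨ha, Eq.symm h⟩
  | succ d ih =>
    obtain ⟨w, hw, hwv⟩ := h
    obtain ⟨h1, rfl⟩ := ih hw
    obtain ⟨k, hk, h2, rfl⟩ := onPath_iff.1 hwv
    have := vert_injOn h1 hk.le h2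
    subst this
    exact ⟨hk, rfl⟩

theorem reach_onPath_to_iff {b d : ℕ} (hb : b ≤ I.hops) {u : V} :
    Reach I.OnPath d u (vert I b) ↔ d ≤ b ∧ u = vert I (b - d) := by
  constructor
  · intro h
    induction d generalizing b with
    | zero => exact ⟨Nat.zero_le _, h⟩
    | succ d ih =>
      obtain ⟨w, hw, hwv⟩ := h
      obtain ⟨k, hk, rfl, h2⟩ := onPath_iff.1 hwv
      have := vert_injOn hb hk h2
      subst this
      obtain ⟨h3, h4⟩ := ih hk.le hw
      exact ⟨by omega, by rw [h4]; congr 1; omega⟩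
  · rintro ⟨h, rfl⟩
    have := reach_onPath_vert (I := I) (a := b - d) (d := d) (by omega)
    rwa [show b - d + d = b by omega] at this

theorem ddist_onPath {a b : ℕ} (hab : a ≤ b) (hb : b ≤ I.hops) :
    ddist I.OnPath (vert I a) (vert I b) = (b - a : ℕ) := by
  refine le_antisymm ((reach_onPath_to_iff hb).2 ⟨by omega, by congr 1; omega⟩).ddist_le ?_
  refine le_iInf₂ fun n hn => ?_
  obtain ⟨h1, h2⟩ := (reach_onPath_iff (hab.trans hb)).1 hn
  have := vert_injOn hb h1 h2
  exact_mod_cast (by omega : b - a ≤ n)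

theorem ddist_source_ne_top {v : V} (h : ddist I.OnPath I.source v ≠ ⊤) :
    ∃ a ≤ I.hops, v = vert I a := by
  obtain ⟨n, -, hn⟩ := exists_reach h
  rw [← vert_zero, reach_onPath_iff (Nat.zero_le _)] at hn
  exact ⟨0 + n, hn⟩

theorem OffPath.adj {w v : V} (h : OffPath I w v) : I.graph.Adj w v := h.1

theorem replacementLength_le (i : Fin I.hops) {a j d : ℕ} (hai : a ≤ i) (hij : i < j)
    (hj : j ≤ I.hops) (h : Reach (OffPath I) d (vert I a) (vert I j)) :
    I.replacementLength i ≤ (a + d + (I.hops - j) : ℕ) := by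
  rw [RPathsInstance.replacementLength, didist_eq_ddist]
  have hedge : ∀ k < I.hops, k ≠ i → (removeEdge I.graph (I.path i.castSucc) (I.path i.succ)).Adj
      (vert I k) (vert I (k + 1)) := by
    intro k hk hki
    refine ⟨adj_of_onPath (onPath_iff.2 ⟨k, hk, rfl, rfl⟩), fun h => hki ?_⟩
    rw [vert_castSucc] at h
    exact vert_injOn hk.le i.2.le h.1
  have hseg : ∀ b e, b + e ≤ I.hops → (b + e ≤ i ∨ i < b) →
      Reach (removeEdge I.graph (I.path i.castSucc) (I.path i.succ)).Adj e
        (vert I b) (vert I (b + e)) := by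
    intro b e
    induction e with
    | zero => exact fun _ _ => rfl
    | succ e ih => exact fun h1 h2 => ⟨_, ih (by omega) (by omega), hedge _ (by omega) (by omega)⟩
  have h1 := hseg 0 a (by omega) (by omega)
  have h2 := hseg j (I.hops - j) (by omega) (by omega)
  rw [vert_zero, Nat.zero_add] at h1
  rw [show j + (I.hops - j) = I.hops by omega, vert_hops] at h2
  have h3 := h.mono (H' := (removeEdge I.graph (I.path i.castSucc) (I.path i.succ)).Adj) (by
    rintro u v ⟨huv, -, hP⟩
    refine ⟨huv, fun h => hP ⟨i, h.1.symm, h.2.symm⟩⟩)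
  exact ((h1.trans h3).trans h2).ddist_le

/-- Follow the walk step by step, keeping one of two normal forms. Either the part so far can be
replaced by an initial segment up to `v_a`, `a ≤ i`, and an off-path walk, or the path has been
re-entered at some `v_j` behind the `i`-th edge. If the walk uses a path edge in front of the `i`-th
one, all that precedes is exchanged for an initial segment, which is no longer by
`le_of_reach_vert`. If it uses one behind, `j` is fixed, and the remaining walk has at least `h - j`
edges. -/
theorem exists_detour (i : Fin I.hops) (h : I.replacementLength i ≠ ⊤) :
    ∃ a j d : ℕ, a ≤ i ∧ i < j ∧ j ≤ I.hops ∧ Reach (OffPath I) d (vert I a) (vert I j) ∧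
      ((a + d + (I.hops - j) : ℕ) : ℕ∞) ≤ I.replacementLength i := by
  rw [RPathsInstance.replacementLength, didist_eq_ddist] at h ⊢
  obtain ⟨n, hn, hr⟩ := exists_reach h
  rw [hn]
  have key : ∀ v, Reach (removeEdge I.graph (I.path i.castSucc) (I.path i.succ)).Adj n
      I.source v → (∃ a d : ℕ, a ≤ i ∧ a + d ≤ n ∧ Reach (OffPath I) d (vert I a) v) ∨
      ∃ a j d r : ℕ, a ≤ i ∧ i < j ∧ j ≤ I.hops ∧ Reach (OffPath I) d (vert I a) (vert I j) ∧
        a + d + r ≤ n ∧ Reach I.graph.Adj r (vert I j) v := by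
    clear hn hr
    induction n with
    | zero =>
      rintro v rfl
      exact .inl ⟨0, 0, Nat.zero_le _, le_rfl, vert_zero⟩
    | succ n ih =>
      rintro v' ⟨v, hv, hvv, hne⟩
      rcases ih v hv with ⟨a, d, ha, hd, hr⟩ | ⟨a, j, d, r, h1, h2, h3, h4, h5, h6⟩
      -- Loops carry no link and are excluded from `OffPath`; here they are just skipped.
      · by_cases hloop : v = v'
        · subst hloop
          exact .inl ⟨a, d, ha, by omega, hr⟩
        by_cases hon : I.OnPath v v'
        · obtain ⟨k, hk, rfl, rfl⟩ := onPath_iff.1 hon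
          have hka := le_of_reach_vert (by omega) hk.le (hr.mono fun _ _ => OffPath.adj)
          rcases lt_trichotomy k i with hki | hki | hki
          · exact .inl ⟨k + 1, 0, hki, by omega, rfl⟩
          · exact absurd ⟨by rw [vert_castSucc, hki], by rw [vert_succ, hki]⟩ hne
          · exact .inr ⟨a, k, d, 1, ha, hki, hk.le, hr, by omega, reach_one.2 hvv⟩
        · exact .inl ⟨a, d + 1, ha, by omega, v, hr, hvv, hloop, hon⟩
      · exact .inr ⟨a, j, d, r + 1, h1, h2, h3, h4, by omega, v, h6, hvv⟩
  rcases key _ hr with ⟨a, d, ha, hd, hr⟩ | ⟨a, j, d, r, h1, h2, h3, h4, h5, h6⟩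
  -- No path edge behind the `i`-th was used, so the detour ends at the target.
  · rw [← vert_hops] at hr
    exact ⟨a, I.hops, d, ha, i.2, le_rfl, hr, by norm_cast; omega⟩
  · refine ⟨a, j, d, h1, h2, h3, h4, ?_⟩
    rw [← vert_hops] at h6
    have := le_of_reach_vert h3 le_rfl h6
    norm_cast
    omega

/-! ### The local input -/

theorem onPath_ne {w v : V} (h : I.OnPath w v) : w ≠ v := by
  obtain ⟨k, hk, rfl, rfl⟩ := onPath_iff.1 h
  intro h
  have := vert_injOn hk.le hk h
  omega

theorem mem_image_id {s : Set V} {w : V} : I.network.id w ∈ I.id '' s ↔ w ∈ s :=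
  I.id_injective.mem_set_image

theorem heard_pathIn : Heard I.network (fun v => (I.localInput v).pathInIds) = I.OnPath := by
  funext w v
  simp only [Heard, RPathsInstance.localInput, mem_image_id, eq_iff_iff]
  exact ⟨fun h => h.2, fun h => ⟨⟨onPath_ne h, .inl (adj_of_onPath h)⟩, h⟩⟩

theorem heard_pathOut :
    Heard I.network (fun v => (I.localInput v).pathOutIds) = flip I.OnPath := by
  funext w v
  simp only [Heard, RPathsInstance.localInput, mem_image_id, eq_iff_iff, flip]
  exact ⟨fun h => h.2, fun h => ⟨⟨(onPath_ne h).symm, .inr (adj_of_onPath h)⟩, h⟩⟩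

theorem heard_offIn :
    Heard I.network (fun v => (I.localInput v).inIds \ (I.localInput v).pathInIds)
      = OffPath I := by
  funext w v
  simp only [Heard, RPathsInstance.localInput, Set.mem_sdiff, mem_image_id, eq_iff_iff, OffPath,
    Set.mem_ofPred_eq]
  exact ⟨fun h => ⟨h.2.1, h.1.1, h.2.2⟩, fun h => ⟨⟨h.2.1, .inl h.1⟩, h.1, h.2.2⟩⟩

theorem heard_offOut :
    Heard I.network (fun v => (I.localInput v).outIds \ (I.localInput v).pathOutIds)
      = flip (OffPath I) := by
  funext w v
  simp only [Heard, RPathsInstance.localInput, Set.mem_sdiff, mem_image_id, eq_iff_iff, OffPath,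
    Set.mem_ofPred_eq, flip]
  exact ⟨fun h => ⟨h.2.1, h.1.1.symm, h.2.2⟩, fun h => ⟨⟨h.2.1.symm, .inr h.1⟩, h.1, h.2.2⟩⟩

end Detours

/-! ### Sweeps along the path, sharing among landmarks, and short detours. -/

section ShortDetours

variable {V : Type}

theorem exists_of_iInf_ne_top {ι : Type} {p : ι → Prop} {f : ι → ℕ∞}
    (h : (⨅ i, ⨅ (_ : p i), f i) ≠ ⊤) : ∃ i, p i ∧ (⨅ i, ⨅ (_ : p i), f i) = f i := by
  have hne : Nonempty {i // p i} := by
    by_contra hc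
    rw [not_nonempty_iff, isEmpty_subtype] at hc
    exact h (by simp [hc])
  obtain ⟨⟨i, hi⟩, he⟩ := ENat.exists_eq_iInf (fun i : {i // p i} => f i)
  exact ⟨i, hi, by rw [he, iInf_subtype]⟩

theorem enc_lt {x : ℕ∞} {m M : ℕ} (hx : x ≠ ⊤ → x ≤ m) (hm : m + 1 < M) : enc x < M := by
  by_cases h : x = ⊤
  · rw [h, enc_top]; omega
  · obtain ⟨k, rfl⟩ := ENat.ne_top_iff_exists.1 h
    have : k ≤ m := by exact_mod_cast hx h
    rw [enc_coe]; omega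

/-! ### Sweeping minima along the path -/

/-- The number of smaller keys. -/
noncomputable def slot (keys : Set ℕ) (x : ℕ) : ℕ := (keys ∩ Set.Iio x).ncard

theorem slot_lt_slot {k : Set ℕ} (hk : k.Finite) {x y : ℕ} (hx : x ∈ k) (h : x < y) :
    slot k x < slot k y := by
  refine Set.ncard_lt_ncard ⟨fun a ha => ⟨ha.1, lt_trans ha.2 h⟩, fun hs => ?_⟩
    (hk.inter_of_left _)
  exact lt_irrefl x (hs ⟨hx, h⟩).2

theorem slot_lt {k : Set ℕ} {K : ℕ} (hk : k.encard ≤ K) {x : ℕ} (hx : x ∈ k) : slot k x < K := by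
  have hfin : k.Finite := Set.finite_of_encard_le_coe hk
  have h1 : slot k x < k.ncard := Set.ncard_lt_ncard ⟨Set.inter_subset_left, fun hs =>
    lt_irrefl x (hs hx).2⟩ hfin
  rw [← hfin.cast_ncard_eq] at hk
  exact h1.trans_le (by exact_mod_cast hk)

theorem slot_inj {k : Set ℕ} {K : ℕ} (hk : k.encard ≤ K) {x y : ℕ} (hx : x ∈ k) (hy : y ∈ k)
    (h : (slot k x : ℤ) ≡ slot k y [ZMOD K]) : x = y := by
  have hfin : k.Finite := Set.finite_of_encard_le_coe hk
  have h' := Nat.ModEq.eq_of_lt_of_lt ((Int.natCast_modEq_iff).1 h) (slot_lt hk hx) (slot_lt hk hy)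
  rcases lt_trichotomy x y with h1 | h1 | h1
  · exact absurd h' (slot_lt_slot hfin hx h1).ne
  · exact h1
  · exact absurd h' (slot_lt_slot hfin hy h1).ne'

/-- For each key `x`, compute the minimum of the values `w x` over windows of length at least `z`.
The keys take turns: the vertex is concerned with the keys of slot `e t` modulo `K` in round
`t`. -/
noncomputable def sweep (W z K : ℕ) (Src keys : Set ℕ) (e : ℕ → ℤ) (w : ℕ → ℕ∞) :
    Prog (ℕ → ℕ∞) :=
  (relax (clamp W) Src
    (fun t => ⨅ x, ⨅ (_ : x ∈ keys ∧ (slot keys x : ℤ) ≡ e t [ZMOD K]), w x) (z + K)).bind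
  fun a => .ret fun x => ⨅ t, ⨅ (_ : t ≤ z + K ∧ (slot keys x : ℤ) ≡ e t [ZMOD K]), a t

/-- The condition that `e` is constant along a walk taken at one step per round means that each
moving front is devoted to one residue class, hence to at most one key, as slots are smaller than
`K`. Among the last rounds, from `z` to `z + K`, every class occurs, and by then a front has crossed
the whole window of length `z`. -/
theorem runs_sweep {N : Network V} {W b : ℕ} (hW : W ≤ b) (z K : ℕ) (Src keys : V → Set ℕ)
    (e : V → ℕ → ℤ) (w : V → ℕ → ℕ∞) :
    ∃ a, Runs N b (fun v => sweep W z K (Src v) (keys v) (e v) (w v)) (z + K) a ∧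
      ∀ k : Set ℕ, (∀ v, keys v = k) → k.encard ≤ K →
        (∀ v, ∀ x ∈ k, enc (w v x) < 2 ^ W) →
        (∀ q u v t, 1 ≤ q → q ≤ t → Reach (Heard N Src) q u v → e u (t - q) = e v t) →
        (∀ v r, ∃ t, z ≤ t ∧ t ≤ z + K ∧ r ≡ e v t [ZMOD K]) →
        ∀ v, ∀ x ∈ k,
          (a v x ≠ ⊤ → ∃ q u, 1 ≤ q ∧ Reach (Heard N Src) q u v ∧ a v x = w u x) ∧
          ∀ q u, 1 ≤ q → q ≤ z → Reach (Heard N Src) q u v → a v x ≤ w u x := by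
  obtain ⟨a, ha, hspec⟩ := runs_relax (N := N) (b := b) (cl := clamp W) (T := z + K) (Src := Src)
    (own := fun v t => ⨅ x, ⨅ (_ : x ∈ keys v ∧ (slot (keys v) x : ℤ) ≡ e v t [ZMOD K]), w v x)
    (clamp_zero W)
    (.inl fun m => (clamp_lt W m).trans_le (Nat.pow_le_pow_right (by norm_num) hW))
  refine ⟨_, ha.bind (T' := 0) (.ret _), fun k hk hkK hw he hcov v x hx => ?_⟩
  simp only [hk] at hspec ⊢
  have hm := hspec fun u t => by
    by_cases h : (⨅ x, ⨅ (_ : x ∈ k ∧ (slot k x : ℤ) ≡ e u t [ZMOD K]), w u x) = ⊤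
    · rw [h, enc_top, clamp_zero]
    · obtain ⟨x, ⟨hx, -⟩, h'⟩ := exists_of_iInf_ne_top h
      rw [h', clamp_of_lt (hw u x hx)]
  constructor
  · intro hne
    obtain ⟨t, ⟨ht, hxt⟩, h1⟩ := exists_of_iInf_ne_top hne
    rw [h1] at hne ⊢
    obtain ⟨q, u, hq, hqt, hr, h2⟩ := hm.attained ht hne
    rw [h2] at hne ⊢
    obtain ⟨y, ⟨hy, hyt⟩, h3⟩ := exists_of_iInf_ne_top hne
    rw [he q u v t hq hqt hr] at hyt
    rw [h3, slot_inj hkK hx hy (hxt.trans hyt.symm)]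
    exact ⟨q, u, hq, hr, rfl⟩
  · intro q u hq hqz hr
    obtain ⟨t, ht1, ht2, ht⟩ := hcov v (slot k x)
    refine (iInf₂_le t ⟨ht2, ht⟩).trans ((hm.le hq (hqz.trans ht1) ht2 hr).trans ?_)
    refine iInf₂_le x ⟨hx, ?_⟩
    rwa [he q u v t hq (hqz.trans ht1) hr]

/-! ### Sharing the values of the landmarks -/

/-- Tell all vertices the values `val x` at the landmarks on the path. -/
noncomputable def share (W K d : ℕ) (isL : Prop) (keys : Set ℕ) (pos : ℕ∞) (val : ℕ → ℕ∞) :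
    Prog (ℕ → ℕ → ℕ∞) :=
  (gossip W (d + K * K + 1) {i | isL ∧ ∃ b x δ : ℕ, pos = b ∧ x ∈ keys ∧ val x = δ ∧
    i = Nat.pair b (Nat.pair x δ) + 1}).bind fun S => .ret (itemDist S)

theorem runs_share {N : Network V} {W b : ℕ} (hW : W ≤ b) (K d : ℕ) (L : Set V)
    (keys : V → Set ℕ) (pos : V → ℕ∞) (val : V → ℕ → ℕ∞) :
    ∃ a, Runs N b (fun v => share W K d (v ∈ L) (keys v) (pos v) (val v)) (d + K * K + 1) a ∧
      ∀ k : Set ℕ, (∀ v, keys v = k) → k.encard ≤ K → L.encard ≤ K →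
        (∀ u v, ∃ q ≤ d, Reach N.link.Adj q u v) →
        (∀ v, ∀ x ∈ k, ∀ b δ : ℕ, pos v = b → val v x = δ →
          Nat.pair b (Nat.pair x δ) + 1 < 2 ^ W) →
        ∀ v b x,
          (a v b x ≠ ⊤ → ∃ u ∈ L, pos u = b ∧ x ∈ k ∧ a v b x = val u x) ∧
          (x ∈ k → ∀ u ∈ L, pos u = b → a v b x ≤ val u x) := by
  obtain ⟨S, hS, hspec⟩ := runs_gossip (N := N) (T := d + K * K + 1) hW fun v =>
    {i | v ∈ L ∧ ∃ b x δ : ℕ, pos v = b ∧ x ∈ keys v ∧ val v x = δ ∧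
      i = Nat.pair b (Nat.pair x δ) + 1}
  refine ⟨_, hS.bind (T' := 0) (.ret _), fun k hk hkK hLK hd hsize v b x => ?_⟩
  simp only [hk] at hspec
  have hX : S v = _ := hspec (K * K) d ?_ ?_ hd (Nat.lt_succ_self _) v
  rotate_left
  · rintro v i ⟨-, b, x, δ, hb, hx, hδ, rfl⟩
    exact ⟨Nat.succ_pos _, hsize v x hx b δ hb hδ⟩
  · refine (Set.encard_le_encard (t := (fun p : V × ℕ => Nat.pair (pos p.1).toNat
      (Nat.pair p.2 (val p.1 p.2).toNat) + 1) '' (L ×ˢ k)) ?_).trans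
        ((Set.encard_image_le _ _).trans ?_)
    · refine Set.iUnion_subset fun v => ?_
      rintro i ⟨hv, b, x, δ, hb, hx, hδ, rfl⟩
      exact ⟨(v, x), ⟨hv, hx⟩, by simp [hb, hδ]⟩
    · rw [Set.encard_prod]
      push_cast
      gcongr
  constructor
  · intro hne
    obtain ⟨δ, hδ, he⟩ := exists_of_iInf_ne_top hne
    rw [hX] at hδ
    obtain ⟨-, ⟨u, rfl⟩, hu, b', x', δ', hb, hx, hδ', h⟩ := hδ
    obtain ⟨rfl, h'⟩ := Nat.pair_eq_pair.1 (Nat.succ_injective h)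
    obtain ⟨rfl, rfl⟩ := Nat.pair_eq_pair.1 h'
    exact ⟨u, hu, hb, hx, by rw [hδ']; exact he⟩
  · intro hx u hu hb
    by_cases htop : val u x = ⊤
    · simp [htop]
    obtain ⟨δ, hδ⟩ := ENat.ne_top_iff_exists.1 htop
    rw [← hδ]
    refine iInf₂_le δ ?_
    rw [hX]
    exact Set.mem_iUnion.2 ⟨u, hu, b, x, δ, hb, hx, hδ.symm, rfl⟩

/-! ### Short detours -/

open Classical in
/-- The length of the rest of the path, and `∞` off the path. -/
noncomputable def pathRest (pos hops : ℕ∞) : ℕ∞ := if pos = ⊤ then ⊤ else hops - pos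

/-- The least length of a path that leaves the given path at position `pos` and returns behind its
`i`-th edge, when a detour of length `δ` can return with `f δ` edges left to go. -/
noncomputable def jump (z : ℕ) (pos hops : ℕ∞) (f : ℕ → ℕ∞) (i : ℕ) : ℕ∞ :=
  ⨅ δ : ℕ, ⨅ (_ : 1 ≤ δ ∧ δ ≤ z ∧ f δ + i < hops), pos + δ + f δ

open Classical in
/-- Compute the least length of a replacement path with a detour of length at most `z`. -/
noncomputable def shortDetour (W z : ℕ) (offOut pathIn : Set ℕ) (pos hops : ℕ∞) : Prog ℕ∞ :=
  (relax (clamp W) offOut (fun t => if t = 0 then pathRest pos hops else ⊤) z).bind fun f =>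
    (relax (clamp W) pathIn (fun t => jump z pos hops f (pos.toNat + z - t)) z).bind fun g =>
    .ret (min (jump z pos hops f pos.toNat) (g z))

variable {I : RPathsInstance V}

theorem ddist_source_vert {a : ℕ} (ha : a ≤ I.hops) :
    ddist I.OnPath I.source (vert I a) = a := by
  rw [← vert_zero, ddist_onPath (Nat.zero_le a) ha]
  simp

theorem pathRest_vert {a : ℕ} : pathRest (a : ℕ∞) I.hops = (I.hops - a : ℕ) := by
  simp [pathRest]

theorem pathRest_ne_top {v : V} {h : ℕ∞} (hr : pathRest (ddist I.OnPath I.source v) h ≠ ⊤) :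
    ∃ a ≤ I.hops, v = vert I a := by
  refine ddist_source_ne_top fun htop => hr ?_
  simp [pathRest, htop]

/-- In the first relaxation own values exist only at time `0`, so `f δ` concerns walks with exactly
`δ` edges. The farthest return point for a given `δ` is best for every `i`, being both shortest
overall and most likely to lie behind the edge. In the second relaxation the message at position `p`
and time `t` concerns the edge `p + z - t`, which is invariant when both grow by one; at time `z` it
is the vertex's own edge. Since `i - c < j - c ≤ δ ≤ z`, every relevant `v_c` is in reach. -/
theorem runs_shortDetour {W b : ℕ} (hW : W ≤ b) (z : ℕ) (pos hops : V → ℕ∞) :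
    ∃ a, Runs I.network b (fun v => shortDetour W z
        ((I.localInput v).outIds \ (I.localInput v).pathOutIds) (I.localInput v).pathInIds
        (pos v) (hops v)) (z + z) a ∧
      ((∀ v, pos v = ddist I.OnPath I.source v) → (∀ v, hops v = I.hops) →
        2 * I.hops + z + 1 < 2 ^ W → ∀ i < I.hops,
        (a (vert I i) ≠ ⊤ → ∃ c j δ : ℕ, c ≤ i ∧ i < j ∧ j ≤ I.hops ∧
          Reach (OffPath I) δ (vert I c) (vert I j) ∧
          a (vert I i) = (c + δ + (I.hops - j) : ℕ)) ∧
        ∀ c j δ : ℕ, c ≤ i → i < j → j ≤ I.hops → δ ≤ z →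
          Reach (OffPath I) δ (vert I c) (vert I j) →
          a (vert I i) ≤ (c + δ + (I.hops - j) : ℕ)) := by
  classical
  have hcl : ∀ m, clamp W m < 2 ^ b := fun m =>
    (clamp_lt W m).trans_le (Nat.pow_le_pow_right (by norm_num) hW)
  obtain ⟨f, hf, hfs⟩ := runs_relax (N := I.network) (b := b) (cl := clamp W) (T := z)
    (Src := fun v => (I.localInput v).outIds \ (I.localInput v).pathOutIds)
    (own := fun v t => if t = 0 then pathRest (pos v) (hops v) else ⊤) (clamp_zero W) (.inl hcl)
  obtain ⟨g, hg, hgs⟩ := runs_relax (N := I.network) (b := b) (cl := clamp W) (T := z)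
    (Src := fun v => (I.localInput v).pathInIds)
    (own := fun v t => jump z (pos v) (hops v) (f v) ((pos v).toNat + z - t))
    (clamp_zero W) (.inl hcl)
  refine ⟨_, hf.bind (hg.bind (T' := 0) (.ret _)), fun hpos hhops hsize => ?_⟩
  simp only [hpos, hhops] at hfs hgs ⊢
  rw [heard_offOut] at hfs
  rw [heard_pathIn] at hgs
  have hF := hfs fun u t => clamp_of_lt (by
    refine enc_lt (m := I.hops) (fun hne => ?_) (by omega)
    split_ifs at hne ⊢ with ht
    · obtain ⟨a, ha, rfl⟩ := pathRest_ne_top hne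
      rw [ddist_source_vert ha, pathRest_vert]
      exact_mod_cast Nat.sub_le _ _
    · exact absurd rfl hne)
  have hG := hgs fun u t => clamp_of_lt (by
    refine enc_lt (m := I.hops + z + I.hops) (fun hne => ?_) (by omega)
    obtain ⟨δ, ⟨-, hδ, hlt⟩, he⟩ := exists_of_iInf_ne_top hne
    rw [jump, he]
    rw [jump, he] at hne
    obtain ⟨a, ha, rfl⟩ := ddist_source_ne_top (I := I) (v := u) fun h =>
      hne (by simp [h])
    rw [ddist_source_vert ha]
    push_cast
    gcongr
    exact le_self_add.trans hlt.le)
  have hjump : ∀ c ≤ I.hops, ∀ i < I.hops,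
      (jump z c I.hops (f (vert I c)) i ≠ ⊤ → ∃ j δ : ℕ, i < j ∧ j ≤ I.hops ∧
        Reach (OffPath I) δ (vert I c) (vert I j) ∧
        jump z c I.hops (f (vert I c)) i = (c + δ + (I.hops - j) : ℕ)) ∧
      ∀ j δ : ℕ, i < j → j ≤ I.hops → 1 ≤ δ → δ ≤ z →
        Reach (OffPath I) δ (vert I c) (vert I j) →
        jump z c I.hops (f (vert I c)) i ≤ (c + δ + (I.hops - j) : ℕ) := by
    intro c hc i hi
    constructor
    · intro hne
      obtain ⟨δ, ⟨hδ1, hδ2, hlt⟩, he⟩ := exists_of_iInf_ne_top hne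
      have hfne : f (vert I c) δ ≠ ⊤ := fun h => by simp [h] at hlt
      obtain ⟨q, u, hq1, hq2, hr, h1⟩ := hF.attained hδ2 hfne
      rw [h1] at hfne
      split_ifs at hfne h1 with h0
      · obtain rfl : q = δ := by omega
        obtain ⟨j, hj, rfl⟩ := pathRest_ne_top hfne
        rw [ddist_source_vert hj, pathRest_vert] at h1
        rw [h1] at hlt
        refine ⟨j, q, by norm_cast at hlt; omega, hj, reach_flip.1 hr, ?_⟩
        rw [jump, he, h1]
        push_cast
        rfl
      · exact absurd rfl hfne
    · intro j δ hij hj hδ1 hδ2 hr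
      have h1 := hF.le hδ1 le_rfl hδ2 (reach_flip.2 hr)
      rw [Nat.sub_self, if_pos rfl, ddist_source_vert hj, pathRest_vert] at h1
      have hlt : f (vert I c) δ + i < I.hops := by
        refine (add_le_add_left h1 _).trans_lt ?_
        norm_cast
        omega
      refine (iInf₂_le δ ⟨hδ1, hδ2, hlt⟩).trans ?_
      rw [Nat.cast_add, Nat.cast_add]
      gcongr
  intro i hi
  simp only [ddist_source_vert hi.le, ENat.toNat_natCast]
  constructor
  · intro hne
    rcases min_choice (jump z i I.hops (f (vert I i)) i) (g (vert I i) z) with h | h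
    · rw [h] at hne ⊢
      obtain ⟨j, δ, h1, h2, h3, h4⟩ := (hjump i hi.le i hi).1 hne
      exact ⟨i, j, δ, le_rfl, h1, h2, h3, h4⟩
    · rw [h] at hne ⊢
      obtain ⟨q, u, hq1, hq2, hr, he⟩ := hG.attained le_rfl hne
      obtain ⟨hqi, rfl⟩ := (reach_onPath_to_iff hi.le).1 hr
      rw [he] at hne ⊢
      have hqh : i - q ≤ I.hops := by omega
      simp only [ddist_source_vert hqh, ENat.toNat_natCast] at hne ⊢
      rw [show i - q + z - (z - q) = i by omega] at hne ⊢
      obtain ⟨j, δ, h1, h2, h3, h4⟩ := (hjump (i - q) hqh i hi).1 hne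
      exact ⟨i - q, j, δ, by omega, h1, h2, h3, h4⟩
  · intro c j δ hci hij hj hδ hr
    have hδ1 : 1 ≤ δ := by
      rcases Nat.eq_zero_or_pos δ with rfl | h
      · have := vert_injOn (by omega) hj hr
        omega
      · exact h
    have hjc := le_of_reach_vert (by omega) hj (hr.mono fun _ _ => OffPath.adj)
    have hle := (hjump c (by omega) i hi).2 j δ hij hj hδ1 hδ hr
    rcases hci.eq_or_lt with rfl | hlt
    · exact (min_le_left _ _).trans hle
    · refine (min_le_right _ _).trans (le_trans ?_ hle)
      have := hG.le (q := i - c) (t := z) (u := vert I c) (v := vert I i) (by omega) (by omega)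
        le_rfl ((reach_onPath_to_iff hi.le).2 ⟨by omega, by congr 1; omega⟩)
      have hch : c ≤ I.hops := by omega
      simp only [ddist_source_vert hch, ENat.toNat_natCast] at this
      rwa [show c + z - (z - (i - c)) = i by omega] at this

end ShortDetours

/-! ### Prefix and suffix minima along the whole path. -/

section PathMinima

variable {V : Type}

/-! ### Prefix and suffix minima along the whole path -/

theorem exists_modEq {K : ℕ} (hK : 0 < K) (z : ℕ) (s : ℤ) :
    ∃ t : ℕ, z ≤ t ∧ t ≤ z + K ∧ (t : ℤ) ≡ s [ZMOD K] := by
  have hK' : (0 : ℤ) < K := by exact_mod_cast hK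
  have h1 := Int.emod_nonneg (s - z) hK'.ne'
  have h2 := Int.emod_lt_of_pos (s - z) hK'
  refine ⟨z + ((s - z) % K).toNat, by omega, by omega, ?_⟩
  push_cast
  rw [Int.toNat_of_nonneg h1]
  have := (Int.mod_modEq (s - z) K).add_left z
  rwa [add_sub_cancel] at this

/-- Compute, for each key `x`, the minimum of the values `w x` over the vertices on the path up to
the vertex itself. -/
noncomputable def prefixMin (W z K d : ℕ) (isL : Prop) (keys pathIn : Set ℕ) (pos : ℕ∞)
    (w : ℕ → ℕ∞) : Prog (ℕ → ℕ∞) :=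
  (sweep W (z + 1) K pathIn keys (fun t => (pos.toNat : ℤ) - t) w).bind fun a =>
    (share W K d isL keys pos fun x => min (w x) (a x)).bind fun A =>
    .ret fun x => min (min (w x) (a x)) (⨅ c : ℕ, ⨅ (_ : (c : ℕ∞) ≤ pos), A c x)

/-- Compute, for each key `x`, the minimum of the values `w x` over the vertices on the path behind
the vertex itself. -/
noncomputable def suffixMin (W z K d : ℕ) (isL : Prop) (keys pathOut : Set ℕ) (pos : ℕ∞)
    (w : ℕ → ℕ∞) : Prog (ℕ → ℕ∞) :=
  (sweep W (z + 1) K pathOut keys (fun t => (pos.toNat : ℤ) + t) w).bind fun a =>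
    (share W K d isL keys pos a).bind fun A =>
    .ret fun x => min (a x) (⨅ c : ℕ, ⨅ (_ : pos ≤ c), A c x)

variable {I : RPathsInstance V}

theorem reach_onPath_pos {q : ℕ} (hq : 1 ≤ q) {u v : V} (h : Reach I.OnPath q u v) :
    ∃ a, a + q ≤ I.hops ∧ u = vert I a ∧ v = vert I (a + q) := by
  obtain ⟨q, rfl⟩ := Nat.exists_eq_add_of_le' hq
  obtain ⟨k, hk, -, rfl⟩ := onPath_iff.1 h.choose_spec.2
  have : Reach I.OnPath (q + 1) u (vert I (k + 1)) := h
  obtain ⟨h1, rfl⟩ := (reach_onPath_to_iff (b := k + 1) hk).1 this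
  exact ⟨k + 1 - (q + 1), by omega, rfl, by congr 1; omega⟩

/-- The conditions under which landmarks can be used to compute minima along the path. -/
structure GoodLandmarks (I : RPathsInstance V) (W z K d M : ℕ) (L : Set V) (k : Set ℕ) :
    Prop where
  pos_K : 0 < K
  card_keys : k.encard ≤ K
  card : L.encard ≤ K
  connected : ∀ u v, ∃ q ≤ d, Reach I.network.link.Adj q u v
  hit_path : ∀ u v, ddist I.OnPath u v = z →
    ∃ x ∈ L, ddist I.OnPath u x + ddist I.OnPath x v = z
  key_le : ∀ x ∈ k, x ≤ M
  hops_le : I.hops ≤ M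
  size : ∀ x y δ, x ≤ M → y ≤ M → δ ≤ M → Nat.pair x (Nat.pair y δ) + 1 < 2 ^ W

namespace GoodLandmarks

variable {W z K d M : ℕ} {L : Set V} {k : Set ℕ}

theorem lt (h : GoodLandmarks I W z K d M L k) : M + 1 < 2 ^ W :=
  (Nat.add_le_add_right (Nat.left_le_pair M _) 1).trans_lt
    (h.size M 0 0 le_rfl (Nat.zero_le _) (Nat.zero_le _))

/-- The relation `OnPath` has no walks but segments of the path, so the landmark supplied by
`hit_path` lies on the segment. -/
theorem exists_landmark (h : GoodLandmarks I W z K d M L k) {a : ℕ} (ha : a + z ≤ I.hops) :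
    ∃ b, a ≤ b ∧ b ≤ a + z ∧ vert I b ∈ L := by
  obtain ⟨x, hx, he⟩ := h.hit_path (vert I a) (vert I (a + z)) (by
    rw [ddist_onPath (by omega) ha]; congr 1; omega)
  obtain ⟨m, hm, hr⟩ := exists_reach (H := I.OnPath) (u := vert I a) (v := x)
    (ne_top_of_le_ne_top (ENat.natCast_ne_top z) (le_self_add.trans he.le))
  obtain ⟨h1, rfl⟩ := (reach_onPath_iff (by omega)).1 hr
  refine ⟨a + m, by omega, ?_, hx⟩
  have : (m : ℕ∞) ≤ z := by rw [← hm]; exact le_self_add.trans he.le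
  have : m ≤ z := by exact_mod_cast this
  omega

theorem size_share (h : GoodLandmarks I W z K d M L k) {val : V → ℕ → ℕ∞}
    (hval : ∀ v, ∀ x ∈ k, val v x ≠ ⊤ → val v x ≤ M) (v : V) (x : ℕ) (hx : x ∈ k) (b δ : ℕ)
    (hb : ddist I.OnPath I.source v = b) (hδ : val v x = δ) :
    Nat.pair b (Nat.pair x δ) + 1 < 2 ^ W := by
  obtain ⟨a, ha, rfl⟩ := ddist_source_ne_top (I := I) (v := v) (by simp [hb])
  rw [ddist_source_vert ha] at hb
  have hab : a = b := by exact_mod_cast hb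
  have h1 := hval (vert I a) x hx (by simp [hδ])
  rw [hδ] at h1
  have h2 := h.hops_le
  exact h.size _ _ _ (by omega) (h.key_le x hx) (by exact_mod_cast h1)

end GoodLandmarks

theorem eq_vert_of_ddist {v : V} {b : ℕ} (hb : ddist I.OnPath I.source v = b) :
    b ≤ I.hops ∧ v = vert I b := by
  obtain ⟨a, ha, rfl⟩ := ddist_source_ne_top (I := I) (v := v) (by simp [hb])
  rw [ddist_source_vert ha] at hb
  have : a = b := by exact_mod_cast hb
  subst this
  exact ⟨ha, rfl⟩

/-- A value up to `z + 1` positions back arrives with the sweep. An older one, from `v_c`, is in the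
window of a landmark among `v_c, …, v_(c+z)`, which publishes its minimum together with its
position. Position minus time is constant along a front. -/
theorem runs_prefixMin {W b : ℕ} (hW : W ≤ b) (z K d : ℕ) (L : Set V) (keys : V → Set ℕ)
    (pos : V → ℕ∞) (w : V → ℕ → ℕ∞) :
    ∃ a, Runs I.network b (fun v => prefixMin W z K d (v ∈ L) (keys v)
        (I.localInput v).pathInIds (pos v) (w v)) (z + 1 + K + (d + K * K + 1)) a ∧
      ∀ k M, GoodLandmarks I W z K d M L k → (∀ v, keys v = k) →
        (∀ v, pos v = ddist I.OnPath I.source v) →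
        (∀ v, ∀ x ∈ k, w v x ≠ ⊤ → w v x ≤ M) → ∀ i ≤ I.hops, ∀ x ∈ k,
        (a (vert I i) x ≠ ⊤ → ∃ c ≤ i, a (vert I i) x = w (vert I c) x) ∧
        ∀ c ≤ i, a (vert I i) x ≤ w (vert I c) x := by
  obtain ⟨a, ha, has⟩ := runs_sweep (N := I.network) hW (z + 1) K
    (fun v => (I.localInput v).pathInIds) keys (fun v t => ((pos v).toNat : ℤ) - t) w
  obtain ⟨A, hA, hAs⟩ := runs_share (N := I.network) hW K d L keys pos
    fun v x => min (w v x) (a v x)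
  refine ⟨_, ha.bind (hA.bind (T' := 0) (.ret _)), fun k M hg hk hpos hw i hi x hx => ?_⟩
  simp only [hpos] at has hAs ⊢
  rw [heard_pathIn] at has
  have hsw := has k hk hg.card_keys (fun v x hx => enc_lt (hw v x hx) hg.lt)
    (fun q u v t hq hqt hr => by
      obtain ⟨c, hc, rfl, rfl⟩ := reach_onPath_pos hq hr
      rw [ddist_source_vert hc, ddist_source_vert (by omega)]
      simp only [ENat.toNat_natCast]
      push_cast [Nat.cast_sub hqt]
      ring)
    (fun v r => by
      obtain ⟨t, h1, h2, h3⟩ := exists_modEq hg.pos_K (z + 1)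
        (((ddist I.OnPath I.source v).toNat : ℤ) - r)
      refine ⟨t, h1, h2, ?_⟩
      have := (h3.sub_left ((ddist I.OnPath I.source v).toNat : ℤ)).symm
      rwa [sub_sub_cancel] at this)
  have ha1 : ∀ v, ∀ x ∈ k, min (w v x) (a v x) ≠ ⊤ → ∃ q u, Reach I.OnPath q u v ∧
      min (w v x) (a v x) = w u x := by
    intro v x hx hne
    rcases min_choice (w v x) (a v x) with h | h
    · exact ⟨0, v, rfl, h⟩
    · rw [h] at hne ⊢
      obtain ⟨q, u, -, hr, he⟩ := (hsw v x hx).1 hne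
      exact ⟨q, u, hr, he⟩
  have ha1' : ∀ c ≤ I.hops, ∀ x ∈ k, min (w (vert I c) x) (a (vert I c) x) ≠ ⊤ →
      ∃ e ≤ c, min (w (vert I c) x) (a (vert I c) x) = w (vert I e) x := by
    intro c hc x hx hne
    obtain ⟨q, u, hr, he⟩ := ha1 _ x hx hne
    obtain ⟨-, rfl⟩ := (reach_onPath_to_iff hc).1 hr
    exact ⟨c - q, by omega, he⟩
  have ha2 : ∀ c e, c ≤ e → e ≤ I.hops → e ≤ c + (z + 1) → ∀ x ∈ k,
      min (w (vert I e) x) (a (vert I e) x) ≤ w (vert I c) x := by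
    intro c e hce he hez x hx
    rcases hce.eq_or_lt with rfl | hlt
    · exact min_le_left _ _
    · refine (min_le_right _ _).trans ((hsw _ x hx).2 (e - c) _ (by omega) (by omega) ?_)
      exact (reach_onPath_to_iff he).2 ⟨by omega, by congr 1; omega⟩
  have hAk := hAs k hk hg.card_keys hg.card hg.connected
    (hg.size_share fun v x hx hne => by
      obtain ⟨q, u, -, he⟩ := ha1 v x hx hne
      rw [he] at hne ⊢
      exact hw u x hx hne)
  rw [ddist_source_vert hi]
  constructor
  · intro hne
    rcases min_choice (min (w (vert I i) x) (a (vert I i) x))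
      (⨅ c : ℕ, ⨅ (_ : (c : ℕ∞) ≤ i), A (vert I i) c x) with h | h
    · rw [h] at hne ⊢
      exact ha1' i hi x hx hne
    · rw [h] at hne ⊢
      obtain ⟨c, hc, he⟩ := exists_of_iInf_ne_top hne
      rw [he] at hne ⊢
      obtain ⟨u, -, hu, -, he'⟩ := (hAk (vert I i) c x).1 hne
      rw [he'] at hne ⊢
      obtain ⟨hch, rfl⟩ := eq_vert_of_ddist hu
      have hci : c ≤ i := by exact_mod_cast hc
      obtain ⟨e, he1, he2⟩ := ha1' c hch x hx hne
      exact ⟨e, he1.trans hci, he2⟩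
  · intro c hc
    by_cases hz : i ≤ c + (z + 1)
    · exact (min_le_left _ _).trans (ha2 c i hc hi hz x hx)
    · obtain ⟨e, h1, h2, h3⟩ := hg.exists_landmark (a := c) (by omega)
      refine (min_le_right _ _).trans ((iInf₂_le e (by exact_mod_cast (by omega : e ≤ i))).trans ?_)
      exact ((hAk (vert I i) e x).2 hx _ h3 (ddist_source_vert (by omega))).trans
        (ha2 c e h1 (by omega) (by omega) x hx)

/-- The mirror image, but with strict inequality `i < j`: the relaying landmark must lie strictly
before `v_j`, so it is sought at positions `j - 1 - z` to `j - 1`. This is why windows have length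
`z + 1`. -/
theorem runs_suffixMin {W b : ℕ} (hW : W ≤ b) (z K d : ℕ) (L : Set V) (keys : V → Set ℕ)
    (pos : V → ℕ∞) (w : V → ℕ → ℕ∞) :
    ∃ a, Runs I.network b (fun v => suffixMin W z K d (v ∈ L) (keys v)
        (I.localInput v).pathOutIds (pos v) (w v)) (z + 1 + K + (d + K * K + 1)) a ∧
      ∀ k M, GoodLandmarks I W z K d M L k → (∀ v, keys v = k) →
        (∀ v, pos v = ddist I.OnPath I.source v) →
        (∀ v, ∀ x ∈ k, w v x ≠ ⊤ → w v x ≤ M) → ∀ i ≤ I.hops, ∀ x ∈ k,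
        (a (vert I i) x ≠ ⊤ → ∃ j, i < j ∧ j ≤ I.hops ∧ a (vert I i) x = w (vert I j) x) ∧
        ∀ j, i < j → j ≤ I.hops → a (vert I i) x ≤ w (vert I j) x := by
  obtain ⟨a, ha, has⟩ := runs_sweep (N := I.network) hW (z + 1) K
    (fun v => (I.localInput v).pathOutIds) keys (fun v t => ((pos v).toNat : ℤ) + t) w
  obtain ⟨A, hA, hAs⟩ := runs_share (N := I.network) hW K d L keys pos a
  refine ⟨_, ha.bind (hA.bind (T' := 0) (.ret _)), fun k M hg hk hpos hw i hi x hx => ?_⟩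
  simp only [hpos] at has hAs ⊢
  rw [heard_pathOut] at has
  have hsw := has k hk hg.card_keys (fun v x hx => enc_lt (hw v x hx) hg.lt)
    (fun q u v t hq hqt hr => by
      obtain ⟨c, hc, rfl, rfl⟩ := reach_onPath_pos hq (reach_flip.1 hr)
      rw [ddist_source_vert hc, ddist_source_vert (by omega)]
      simp only [ENat.toNat_natCast]
      push_cast [Nat.cast_sub hqt]
      ring)
    (fun v r => by
      obtain ⟨t, h1, h2, h3⟩ := exists_modEq hg.pos_K (z + 1)
        ((r : ℤ) - ((ddist I.OnPath I.source v).toNat : ℤ))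
      refine ⟨t, h1, h2, ?_⟩
      have := (h3.add_left ((ddist I.OnPath I.source v).toNat : ℤ)).symm
      rwa [add_sub_cancel] at this)
  have ha1 : ∀ c ≤ I.hops, ∀ x ∈ k, a (vert I c) x ≠ ⊤ →
      ∃ j, c < j ∧ j ≤ I.hops ∧ a (vert I c) x = w (vert I j) x := by
    intro c hc x hx hne
    obtain ⟨q, u, hq, hr, he⟩ := (hsw _ x hx).1 hne
    obtain ⟨h1, rfl⟩ := (reach_onPath_iff hc).1 (reach_flip.1 hr)
    exact ⟨c + q, by omega, h1, he⟩
  have ha2 : ∀ e j, e < j → j ≤ I.hops → j ≤ e + (z + 1) → ∀ x ∈ k,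
      a (vert I e) x ≤ w (vert I j) x := by
    intro e j hej hj hez x hx
    refine (hsw _ x hx).2 (j - e) _ (by omega) (by omega) (reach_flip.2 ?_)
    exact (reach_onPath_iff (by omega)).2 ⟨by omega, by congr 1; omega⟩
  have hAk := hAs k hk hg.card_keys hg.card hg.connected
    (hg.size_share fun v x hx hne => by
      obtain ⟨q, u, -, -, he⟩ := (hsw v x hx).1 hne
      rw [he] at hne ⊢
      exact hw u x hx hne)
  rw [ddist_source_vert hi]
  constructor
  · intro hne
    rcases min_choice (a (vert I i) x)
      (⨅ c : ℕ, ⨅ (_ : (i : ℕ∞) ≤ c), A (vert I i) c x) with h | h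
    · rw [h] at hne ⊢
      exact ha1 i hi x hx hne
    · rw [h] at hne ⊢
      obtain ⟨c, hc, he⟩ := exists_of_iInf_ne_top hne
      rw [he] at hne ⊢
      obtain ⟨u, -, hu, -, he'⟩ := (hAk (vert I i) c x).1 hne
      rw [he'] at hne ⊢
      obtain ⟨hch, rfl⟩ := eq_vert_of_ddist hu
      have hic : i ≤ c := by exact_mod_cast hc
      obtain ⟨j, hj1, hj2, hj3⟩ := ha1 c hch x hx hne
      exact ⟨j, by omega, hj2, hj3⟩
  · intro j hij hj
    by_cases hz : j ≤ i + (z + 1)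
    · exact (min_le_left _ _).trans (ha2 i j hij hj hz x hx)
    · obtain ⟨e, h1, h2, h3⟩ := hg.exists_landmark (a := j - 1 - z) (by omega)
      refine (min_le_right _ _).trans ((iInf₂_le e (by exact_mod_cast (by omega : i ≤ e))).trans ?_)
      exact ((hAk (vert I i) e x).2 hx _ h3 (ddist_source_vert (by omega))).trans
        (ha2 e j (by omega) hj (by omega) x hx)

end PathMinima

/-! ### Combining short and long detours. -/

section Solve

variable {V : Type}

/-! ### Replacement paths, given all parameters -/

/-- Compute the length of a shortest replacement path. The landmark with key `0` is the source, and
the landmark with key `1` is the target. -/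
noncomputable def solve (W z K d : ℕ) (x : RPathsInput) (isL : Prop) (key : ℕ) : Prog ℕ∞ :=
  (landmarkDist W z K d x.pathInIds isL key).bind fun p =>
  (landmarkDist W z K d (x.inIds \ x.pathInIds) isL key).bind fun f =>
  (landmarkDist W z K d (x.outIds \ x.pathOutIds) isL key).bind fun t =>
  (shortDetour W z (x.outIds \ x.pathOutIds) x.pathInIds (p.dist 0) (p.between 0 1)).bind fun g =>
  (prefixMin W z K d isL p.keys x.pathInIds (p.dist 0) fun y => p.dist 0 + t.dist y).bind fun A =>
  (suffixMin W z K d isL p.keys x.pathOutIds (p.dist 0)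
    fun y => f.dist y + pathRest (p.dist 0) (p.between 0 1)).bind fun B =>
  .ret (min g (⨅ y, ⨅ (_ : y ∈ p.keys), A y + B y))

variable {I : RPathsInstance V}

/-- The conditions under which `solve` is correct. -/
structure GoodParams [Fintype V] (I : RPathsInstance V) (W z K d M : ℕ) (L : Set V) (key : V → ℕ) :
    Prop where
  pos_K : 0 < K
  card : L.encard ≤ K
  connected : ∀ u v, ∃ q ≤ d, Reach I.network.link.Adj q u v
  hit_path : ∀ u v, ddist I.OnPath u v = z →
    ∃ x ∈ L, ddist I.OnPath u x + ddist I.OnPath x v = z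
  hit_off : ∀ u v, ddist (OffPath I) u v = z →
    ∃ x ∈ L, ddist (OffPath I) u x + ddist (OffPath I) x v = z
  key_injective : Function.Injective key
  key_source : key I.source = 0
  key_target : I.source ≠ I.target → key I.target = 1
  source_mem : I.source ∈ L
  target_mem : I.target ∈ L
  key_le : ∀ v, key v ≤ M
  le_range : z + 1 + K ≤ M
  card_le : 2 * Fintype.card V + z ≤ M
  size : ∀ x y δ, x ≤ M → y ≤ M → δ ≤ M → Nat.pair x (Nat.pair y δ) + 1 < 2 ^ W

theorem hops_lt_card [Fintype V] : I.hops < Fintype.card V := by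
  have h := ddist_onPath (I := I) (Nat.zero_le _) le_rfl
  exact ddist_lt_card h

variable [Fintype V] {W z K d M : ℕ} {L : Set V} {key : V → ℕ}

theorem GoodParams.goodLandmarks (h : GoodParams I W z K d M L key) :
    GoodLandmarks I W z K d M L (key '' L) where
  pos_K := h.pos_K
  card_keys := (Set.encard_image_le _ _).trans h.card
  card := h.card
  connected := h.connected
  hit_path := h.hit_path
  key_le := by rintro _ ⟨x, -, rfl⟩; exact h.key_le x
  hops_le := by have := hops_lt_card (I := I); have := h.card_le; omega
  size := h.size

theorem GoodParams.size_dist (h : GoodParams I W z K d M L key) (u v : V) (δ : ℕ)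
    (hδ : δ ≤ z + 1 + K) : Nat.pair (key u) (Nat.pair (key v) δ) + 1 < 2 ^ W ∧
      Nat.pair δ (key u) + 1 < 2 ^ W := by
  have h1 := hδ.trans h.le_range
  refine ⟨h.size _ _ _ (h.key_le u) (h.key_le v) h1, ?_⟩
  refine lt_of_le_of_lt ?_ (h.size δ (key u) 0 h1 (h.key_le u) (Nat.zero_le _))
  gcongr
  rcases (Nat.left_le_pair (key u) 0).eq_or_lt with h | h
  · rw [← h]
  · exact (Nat.pair_lt_pair_right _ h).le

theorem keyDist_lt_card {H : V → V → Prop} {x : ℕ} {v : V} (hkey : Function.Injective key)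
    (hx : x ∈ key '' L) (hne : keyDist H L key x v ≠ ⊤) :
    keyDist H L key x v ≤ Fintype.card V := by
  obtain ⟨u, hu, rfl⟩ := hx
  rw [keyDist_key hkey hu] at hne ⊢
  obtain ⟨m, hm, -⟩ := exists_reach hne
  rw [hm]
  exact_mod_cast (ddist_lt_card hm).le

/-- No value is too small, since off-path walks from `v_c` to `x` and from `x` to `v_j` join to a
detour. None is too large: replace an optimal detour by a shortest off-path walk with the same ends;
if that still has more than `z` edges, its first `z` edges can be rerouted through a landmark at no
cost. -/
theorem runs_solve {b : ℕ} (hW : W ≤ b) (z K d : ℕ) (L : Set V) (key : V → ℕ) :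
    ∃ a, Runs I.network b (fun v => solve W z K d (I.localInput v) (v ∈ L) (key v))
        (5 * (z + 1 + K + (d + K * K + 1)) + 2 * z) a ∧
      ∀ M, GoodParams I W z K d M L key → ∀ i : Fin I.hops,
        a (vert I i) = I.replacementLength i := by
  obtain ⟨p, hp, hps⟩ := runs_landmarkDist (N := I.network) (z := z) (K := K) (d := d) hW
    (fun v => (I.localInput v).pathInIds) L key
  obtain ⟨f, hf, hfs⟩ := runs_landmarkDist (N := I.network) (z := z) (K := K) (d := d) hW
    (fun v => (I.localInput v).inIds \ (I.localInput v).pathInIds) L key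
  obtain ⟨t, ht, hts⟩ := runs_landmarkDist (N := I.network) (z := z) (K := K) (d := d) hW
    (fun v => (I.localInput v).outIds \ (I.localInput v).pathOutIds) L key
  obtain ⟨g, hg, hgs⟩ := runs_shortDetour (I := I) hW z (fun v => (p v).dist 0)
    fun v => (p v).between 0 1
  obtain ⟨A, hA, hAs⟩ := runs_prefixMin (I := I) hW z K d L (fun v => (p v).keys)
    (fun v => (p v).dist 0) fun v y => (p v).dist 0 + (t v).dist y
  obtain ⟨B, hB, hBs⟩ := runs_suffixMin (I := I) hW z K d L (fun v => (p v).keys)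
    (fun v => (p v).dist 0) fun v y => (f v).dist y + pathRest ((p v).dist 0) ((p v).between 0 1)
  have htime : 5 * (z + 1 + K + (d + K * K + 1)) + 2 * z =
      z + 1 + K + (d + K * K + 1) + (z + 1 + K + (d + K * K + 1) + (z + 1 + K + (d + K * K + 1) +
        (z + z + (z + 1 + K + (d + K * K + 1) + (z + 1 + K + (d + K * K + 1) + 0))))) := by
    ring
  rw [htime]
  refine ⟨_, hp.bind (hf.bind (ht.bind (hg.bind (hA.bind (hB.bind (T' := 0) (.ret _)))))),
    fun M h i => ?_⟩
  have hL := h.goodLandmarks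
  have hhit : ∀ u v, ddist (flip (OffPath I)) u v = z →
      ∃ x ∈ L, ddist (flip (OffPath I)) u x + ddist (flip (OffPath I)) x v = z := by
    intro u v huv
    simp only [ddist_flip] at huv ⊢
    obtain ⟨x, hx, he⟩ := h.hit_off v u huv
    exact ⟨x, hx, by rw [add_comm, he]⟩
  rw [heard_pathIn] at hps
  rw [heard_offIn] at hfs
  rw [heard_offOut] at hts
  replace hps := hps h.key_injective h.card h.hit_path h.connected h.size_dist
  replace hfs := hfs h.key_injective h.card h.hit_off h.connected h.size_dist
  replace hts := hts h.key_injective h.card hhit h.connected h.size_dist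
  have hpos : ∀ v, (p v).dist 0 = ddist I.OnPath I.source v := by
    intro v
    rw [(hps v).1, ← h.key_source]
    exact keyDist_key h.key_injective h.source_mem v
  have hkeys : ∀ v, (p v).keys = key '' L := fun v => (hps v).2.2
  -- The index `i` forces `h > 0`; only then does key `1` denote the target.
  have hne : I.source ≠ I.target := by
    rw [← vert_zero, ← vert_hops]
    intro he
    have := vert_injOn (Nat.zero_le _) le_rfl he
    have := i.2
    omega
  have hhops : ∀ v, (p v).between 0 1 = I.hops := by
    intro v
    rw [← h.key_target hne, (hps v).2.1 0 _ h.target_mem, ← h.key_source,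
      keyDist_key h.key_injective h.source_mem, ← vert_hops, ddist_source_vert le_rfl]
  have hM := h.card_le
  have hposM : ∀ v, ddist I.OnPath I.source v ≠ ⊤ → ddist I.OnPath I.source v ≤ I.hops := by
    intro v hv
    obtain ⟨a, ha, rfl⟩ := ddist_source_ne_top hv
    rw [ddist_source_vert ha]
    exact_mod_cast ha
  have hopsn := hops_lt_card (I := I)
  have hsum : ((Fintype.card V : ℕ) : ℕ∞) + I.hops ≤ M := by
    exact_mod_cast (by omega : Fintype.card V + I.hops ≤ M)
  have hgi := hgs hpos hhops (by have := hL.lt; omega) i i.2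
  have hA' := hAs _ M hL hkeys hpos (by
    intro v y hy hv
    rw [hpos, (hts v).1] at hv ⊢
    obtain ⟨h1, h2⟩ := WithTop.add_ne_top.1 hv
    rw [add_comm]
    exact (add_le_add (keyDist_lt_card h.key_injective hy h2) (hposM v h1)).trans hsum) i i.2.le
  have hB' := hBs _ M hL hkeys hpos (by
    intro v y hy hv
    rw [hpos, (hfs v).1, hhops] at hv ⊢
    obtain ⟨h1, h2⟩ := WithTop.add_ne_top.1 hv
    refine (add_le_add (keyDist_lt_card h.key_injective hy h1) ?_).trans hsum
    obtain ⟨a, ha, rfl⟩ := pathRest_ne_top h2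
    rw [ddist_source_vert ha, pathRest_vert]
    exact_mod_cast Nat.sub_le _ _) i i.2.le
  have hAval : ∀ c ≤ I.hops, ∀ x ∈ L, (p (vert I c)).dist 0 + (t (vert I c)).dist (key x) =
      c + ddist (OffPath I) (vert I c) x := by
    intro c hc x hx
    rw [hpos, ddist_source_vert hc, (hts _).1]
    simp only
    rw [keyDist_key h.key_injective hx, ddist_flip]
  have hBval : ∀ j ≤ I.hops, ∀ x ∈ L, (f (vert I j)).dist (key x) +
      pathRest ((p (vert I j)).dist 0) ((p (vert I j)).between 0 1) =
      ddist (OffPath I) x (vert I j) + (I.hops - j : ℕ) := by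
    intro j hj x hx
    rw [hpos, hhops, ddist_source_vert hj, pathRest_vert, (hfs _).1]
    simp only
    rw [keyDist_key h.key_injective hx]
  apply le_antisymm
  · by_cases htop : I.replacementLength i = ⊤
    · simp [htop]
    obtain ⟨c, j, δ, hci, hij, hj, hr, hle⟩ := exists_detour i htop
    refine le_trans ?_ hle
    by_cases hδz : δ ≤ z
    · exact (min_le_left _ _).trans (hgi.2 c j δ hci hij hj hδz hr)
    obtain ⟨m, hm, hrm⟩ := exists_reach (H := OffPath I) (u := vert I c) (v := vert I j)
      (ne_top_of_le_ne_top (ENat.natCast_ne_top δ) hr.ddist_le)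
    have hmδ : m ≤ δ := by have := hr.ddist_le; rw [hm] at this; exact_mod_cast this
    by_cases hmz : m ≤ z
    · refine (min_le_left _ _).trans ((hgi.2 c j m hci hij hj hmz hrm).trans ?_)
      exact_mod_cast (by omega)
    have hsplit : ∃ w, ddist (OffPath I) (vert I c) w = z ∧
        ddist (OffPath I) w (vert I j) = (m - z : ℕ) := by
      have hmz' : z + (m - z) = m := by omega
      exact exists_ddist_split (by rw [hm, hmz'])
    obtain ⟨w, hw1, hw2⟩ := hsplit
    obtain ⟨x, hx, hxe⟩ := h.hit_off _ _ hw1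
    refine (min_le_right _ _).trans ((iInf₂_le (key x) (hkeys _ ▸ ⟨x, hx, rfl⟩)).trans ?_)
    refine (add_le_add ((hA' _ ⟨x, hx, rfl⟩).2 c hci)
      ((hB' _ ⟨x, hx, rfl⟩).2 j hij hj)).trans ?_
    rw [hAval c (by omega) x hx, hBval j hj x hx]
    calc (c : ℕ∞) + ddist (OffPath I) (vert I c) x +
          (ddist (OffPath I) x (vert I j) + (I.hops - j : ℕ))
        ≤ (c : ℕ∞) + ddist (OffPath I) (vert I c) x +
          (ddist (OffPath I) x w + ddist (OffPath I) w (vert I j) + (I.hops - j : ℕ)) := by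
          gcongr
          exact ddist_triangle _ _ _ _
      _ = c + (ddist (OffPath I) (vert I c) x + ddist (OffPath I) x w) +
          ddist (OffPath I) w (vert I j) + (I.hops - j : ℕ) := by ring
      _ = (c + z + (m - z : ℕ) + (I.hops - j : ℕ) : ℕ) := by rw [hxe, hw2]; push_cast; rfl
      _ ≤ _ := by exact_mod_cast (by omega)
  · refine le_min ?_ (le_iInf₂ fun y hy => ?_)
    · by_cases htop : g (vert I i) = ⊤
      · simp [htop]
      obtain ⟨c, j, δ, hci, hij, hj, hr, he⟩ := hgi.1 htop
      rw [he]
      exact replacementLength_le i hci hij hj hr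
    · rw [hkeys] at hy
      by_cases htop : A (vert I i) y + B (vert I i) y = ⊤
      · simp [htop]
      obtain ⟨h1, h2⟩ := WithTop.add_ne_top.1 htop
      obtain ⟨c, hci, hc⟩ := (hA' y hy).1 h1
      obtain ⟨j, hij, hj, hj'⟩ := (hB' y hy).1 h2
      obtain ⟨x, hx, rfl⟩ := hy
      rw [hc] at h1 ⊢
      rw [hj'] at h2 ⊢
      rw [hAval c (by omega) x hx] at h1 ⊢
      rw [hBval j hj x hx] at h2 ⊢
      obtain ⟨q, hq, hrq⟩ := exists_reach (WithTop.add_ne_top.1 h1).2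
      obtain ⟨r, hr, hrr⟩ := exists_reach (WithTop.add_ne_top.1 h2).1
      rw [hq, hr]
      refine (replacementLength_le i hci hij hj (hrq.trans hrr)).trans (le_of_eq ?_)
      push_cast
      ring

end Solve

/-! ### Parameters, doubling of the guessed depth, and the total cost. -/

section Algorithm

variable {V : Type}

/-! ### The choice of the parameters -/

/-- The cube root, rounded up. -/
noncomputable def cbrt (n : ℕ) : ℕ := ⌈(n : ℝ) ^ (1 / 3 : ℝ)⌉₊

theorem le_cbrt_pow (n : ℕ) : n ≤ cbrt n ^ 3 := by
  have h : (n : ℝ) ^ (1 / 3 : ℝ) ≤ cbrt n := Nat.le_ceil _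
  have h2 := pow_le_pow_left₀ (by positivity) h 3
  rw [← Real.rpow_natCast, ← Real.rpow_mul (by positivity)] at h2
  norm_num at h2
  exact_mod_cast h2

theorem cbrt_pos {n : ℕ} (hn : 1 ≤ n) : 1 ≤ cbrt n := by
  by_contra h
  have := le_cbrt_pow n
  rw [show cbrt n = 0 by omega] at this
  simp at this
  omega

theorem cbrt_le (n : ℕ) : cbrt n ≤ n := by
  rcases Nat.eq_zero_or_pos n with rfl | hn
  · simp [cbrt]
  · refine Nat.ceil_le.2 ?_
    calc (n : ℝ) ^ (1 / 3 : ℝ) ≤ (n : ℝ) ^ (1 : ℝ) :=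
          Real.rpow_le_rpow_of_exponent_le (by exact_mod_cast hn) (by norm_num)
      _ = n := Real.rpow_one _

theorem cbrt_sq_le {n : ℕ} (hn : 1 ≤ n) : ((cbrt n : ℝ)) ^ 2 ≤ 4 * (n : ℝ) ^ (2 / 3 : ℝ) := by
  have h1 : (1 : ℝ) ≤ (n : ℝ) ^ (1 / 3 : ℝ) :=
    Real.one_le_rpow (by exact_mod_cast hn) (by norm_num)
  have h2 : (cbrt n : ℝ) ≤ 2 * (n : ℝ) ^ (1 / 3 : ℝ) := by
    have : (cbrt n : ℝ) < (n : ℝ) ^ (1 / 3 : ℝ) + 1 := Nat.ceil_lt_add_one (by positivity)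
    linarith
  have h3 : ((n : ℝ) ^ (1 / 3 : ℝ)) ^ 2 = (n : ℝ) ^ (2 / 3 : ℝ) := by
    rw [← Real.rpow_natCast, ← Real.rpow_mul (by positivity)]
    norm_num
  calc ((cbrt n : ℝ)) ^ 2 ≤ (2 * (n : ℝ) ^ (1 / 3 : ℝ)) ^ 2 := by gcongr
    _ = _ := by rw [mul_pow, h3]; norm_num

/-- The length up to which detours are searched directly. -/
noncomputable def detourLength (n : ℕ) : ℕ := cbrt n ^ 2

/-- A vertex is sampled as a landmark if so many random bits are all set. -/
noncomputable def sampleBits (c n : ℕ) : ℕ :=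
  Nat.log 2 (detourLength n / ((c + 4) * bitLength n))

/-- With high probability, this bounds the number of sampled landmarks. -/
noncomputable def sampleBound (c n : ℕ) : ℕ :=
  4 * (2 * ((c + 4) * bitLength n) * cbrt n) + (c + 4) * bitLength n

/-- The number of bits of the fields of messages. -/
def fieldBits (κ c n : ℕ) : ℕ := (κ + c + 12) * bitLength n

theorem lt_two_pow_bitLength (n : ℕ) : n < 2 ^ bitLength n :=
  Nat.lt_pow_succ_log_self (by norm_num) n

theorem bitLength_pos (n : ℕ) : 1 ≤ bitLength n := Nat.le_add_left _ _

theorem sampleBits_spec (c n : ℕ) :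
    sampleBits c n = 0 ∨ (c + 4) * bitLength n * 2 ^ sampleBits c n ≤ detourLength n := by
  have hl := bitLength_pos n
  rcases Nat.eq_zero_or_pos (detourLength n / ((c + 4) * bitLength n)) with h | h
  · exact .inl (by simp [sampleBits, h])
  · right
    have := Nat.pow_log_le_self 2 h.ne'
    rw [Nat.le_div_iff_mul_le (by positivity)] at this
    rwa [mul_comm] at this

/-- By the choice of `m = sampleBits c n`, `2 ^ (m + 1) * ((c + 4) * bitLength n)` exceeds `z`,
while `n ≤ cbrt n * z`. So the expected number `n / 2 ^ m` of sampled vertices is at most `2 * (c +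
4) * bitLength n * cbrt n`. -/
theorem le_sampleBound (c n : ℕ) :
    n ≤ 2 * ((c + 4) * bitLength n) * cbrt n * 2 ^ sampleBits c n := by
  have hl := bitLength_pos n
  have h1 : detourLength n < 2 ^ (sampleBits c n + 1) * ((c + 4) * bitLength n) :=
    (Nat.div_lt_iff_lt_mul (by positivity)).1 (Nat.lt_pow_succ_log_self (by norm_num) _)
  calc n ≤ cbrt n * detourLength n := (le_cbrt_pow n).trans (by rw [detourLength]; ring_nf; rfl)
    _ ≤ cbrt n * (2 ^ (sampleBits c n + 1) * ((c + 4) * bitLength n)) := by gcongr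
    _ = _ := by ring

theorem sampleBound_le {c n : ℕ} (hn : 1 ≤ n) :
    sampleBound c n + 2 ≤ 10 * ((c + 4) * bitLength n * cbrt n) := by
  have hl := bitLength_pos n
  have hy := cbrt_pos hn
  have h1 : (c + 4) * bitLength n * 1 ≤ (c + 4) * bitLength n * cbrt n := by gcongr
  have h2 : 4 * 1 ≤ (c + 4) * bitLength n := Nat.mul_le_mul (by omega) hl
  rw [sampleBound]
  linarith

theorem two_pow_add_le {a b e : ℕ} (ha : a < e) (hb : b < e) : 2 ^ a + 2 ^ b ≤ 2 ^ e := by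
  obtain ⟨e, rfl⟩ : ∃ e', e = e' + 1 := ⟨e - 1, by omega⟩
  have h1 : 2 ^ a ≤ 2 ^ e := Nat.pow_le_pow_right (by norm_num) (by omega)
  have h2 : 2 ^ b ≤ 2 ^ e := Nat.pow_le_pow_right (by norm_num) (by omega)
  rw [pow_succ]
  omega

/-- The summands of `κ + c + 12` make room for the identifiers, for the factor `c + 4` in the number
of landmarks, and for the numerical constants. -/
theorem ranges_lt {κ c n : ℕ} (hn : 1 ≤ n) :
    2 ^ (κ * bitLength n) + 2 < 2 ^ fieldBits κ c n ∧
    detourLength n + 1 + (sampleBound c n + 2) < 2 ^ fieldBits κ c n ∧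
    2 * n + detourLength n < 2 ^ fieldBits κ c n := by
  have hl := bitLength_pos n
  have hnl := lt_two_pow_bitLength n
  have hexp : κ * bitLength n + c + 12 + 0 * bitLength n ≤ fieldBits κ c n ∧
      c + 9 + 3 * bitLength n ≤ fieldBits κ c n := by
    simp only [fieldBits]
    constructor <;> nlinarith [Nat.zero_le (κ * bitLength n), Nat.zero_le (c * bitLength n)]
  have hz : detourLength n ≤ 2 ^ (2 * bitLength n) := by
    rw [detourLength, mul_comm, pow_mul]
    exact Nat.pow_le_pow_left ((cbrt_le n).trans hnl.le) 2
  have hK : sampleBound c n + 2 ≤ 2 ^ (c + 8 + 2 * bitLength n) := by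
    refine (sampleBound_le hn).trans ?_
    have h1 : c + 4 < 2 ^ (c + 4) := Nat.lt_two_pow_self
    have h2 : bitLength n < 2 ^ bitLength n := Nat.lt_two_pow_self
    calc 10 * ((c + 4) * bitLength n * cbrt n)
        ≤ 2 ^ 4 * (2 ^ (c + 4) * 2 ^ bitLength n * 2 ^ bitLength n) := by
          gcongr
          · norm_num
          · exact (cbrt_le n).trans hnl.le
      _ = _ := by ring
  refine ⟨?_, ?_, ?_⟩
  · calc 2 ^ (κ * bitLength n) + 2 < 2 ^ (κ * bitLength n) + 2 ^ 2 := by norm_num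
      _ ≤ 2 ^ fieldBits κ c n := two_pow_add_le (by omega) (by omega)
  · have := two_pow_add_le (a := 2 * bitLength n) (b := 1) (e := c + 8 + 2 * bitLength n)
      (by omega) (by omega)
    have := two_pow_add_le (a := c + 8 + 2 * bitLength n) (b := c + 8 + 2 * bitLength n)
      (e := fieldBits κ c n) (by omega) (by omega)
    omega
  · have := two_pow_add_le (a := bitLength n + 1) (b := 2 * bitLength n) (e := fieldBits κ c n)
      (by omega) (by omega)
    rw [pow_succ] at this
    omega

theorem pair_lt_two_pow {x y q : ℕ} (hx : x < 2 ^ q) (hy : y < 2 ^ q) :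
    Nat.pair x y < 2 ^ (2 * q) := by
  refine (Nat.pair_lt_max_add_one_sq x y).trans_le ?_
  rw [mul_comm, pow_mul]
  exact Nat.pow_le_pow_left (by omega) 2

/-- Pairing doubles the larger width, and a triple is paired twice. -/
theorem triple_lt_two_pow {x y δ q : ℕ} (hx : x < 2 ^ q) (hy : y < 2 ^ q) (hδ : δ < 2 ^ q) :
    Nat.pair x (Nat.pair y δ) + 1 < 2 ^ (4 * q + 1) := by
  have h := pair_lt_two_pow (hx.trans_le (Nat.pow_le_pow_right (by norm_num) (by omega)))
    (pair_lt_two_pow hy hδ)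
  rw [pow_succ, show 4 * q = 2 * (2 * q) by ring]
  omega

/-! ### The algorithm -/

open Classical in
/-- The attempt to solve the problem under the assumption that all vertices have distance at most
`2 ^ k` from the source. -/
noncomputable def attempt (κ c : ℕ) (x : LocalView RPathsInput) (ω : ℕ → Bool) (k : ℕ) :
    Prog (Option ℕ∞) :=
  (census x.input.isSource x.ownId x.nbrIds (2 ^ k)).bind fun r =>
    match r with
    | none => .ret none
    | some n =>
      (solve (4 * fieldBits κ c n + 1) (detourLength n) (sampleBound c n + 2) (2 * 2 ^ k) x.input
        (x.input.isSource ∨ x.input.isTarget ∨ ∀ j < sampleBits c n, ω j = true)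
        (if x.input.isSource then 0 else if x.input.isTarget then 1 else x.ownId + 2)).bind
      fun y => .ret (some y)

/-- The landmarks. -/
def landmarks (I : RPathsInstance V) (m : ℕ) (ω : RandomStrings V) : Set V :=
  {v | v = I.source ∨ v = I.target ∨ Lucky m ω v}

open Classical in
/-- The keys of the vertices. -/
noncomputable def vertexKey (I : RPathsInstance V) (v : V) : ℕ :=
  if v = I.source then 0 else if v = I.target then 1 else I.id v + 2

variable {I : RPathsInstance V}

theorem vertexKey_injective : Function.Injective (vertexKey I) := by
  intro u v h
  unfold vertexKey at h
  split_ifs at h with h1 h2 h3 h4 h5 h6 h7 h8 <;> first | omega | (subst_vars; rfl) | skip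
  exact I.id_injective (by omega)

/-- All conditions are deterministic once the sample is not too large and meets, for each of the `2
* n ^ 2` choices of two ends and of on-path or off-path distance, the set of vertices in between
whenever that set has at least `z` elements. -/
theorem coinMeasure_not_goodParams [Fintype V] (c : ℕ) {κ d : ℕ}
    (hid : ∀ v, I.id v < 2 ^ (κ * bitLength (Fintype.card V)))
    (hd : ∀ u v, ∃ q ≤ d, Reach I.network.link.Adj q u v) :
    coinMeasure V {ω | ¬ GoodParams I (4 * fieldBits κ c (Fintype.card V) + 1)
      (detourLength (Fintype.card V)) (sampleBound c (Fintype.card V) + 2) d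
      (2 ^ fieldBits κ c (Fintype.card V) - 1)
      (landmarks I (sampleBits c (Fintype.card V)) ω) (vertexKey I)} ≤
      ((Fintype.card V : ENNReal) ^ c)⁻¹ := by
  classical
  set n := Fintype.card V with hn
  have hn1 : 1 ≤ n := Fintype.card_pos_iff.2 ⟨I.source⟩
  refine le_trans (measure_mono ?_) (coinMeasure_sampling
    (fun i : V × V × Bool => Finset.univ.filter fun x =>
      ddist (if i.2.2 then I.OnPath else OffPath I) i.1 x +
        ddist (if i.2.2 then I.OnPath else OffPath I) x i.2.1 = detourLength n)
    (z := detourLength n) hn.symm ?_ (lt_two_pow_bitLength n) hn1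
    (Nat.one_le_pow _ _ (cbrt_pos hn1)) (sampleBits_spec c n) (le_sampleBound c n))
  · intro ω
    simp only [Set.mem_ofPred_eq]
    refine mt fun ⟨hfew, hhit⟩ => ?_
    obtain ⟨hr1, hr2, hr3⟩ := ranges_lt (κ := κ) (c := c) hn1
    have hhit' : ∀ (b : Bool) u v,
        ddist (if b then I.OnPath else OffPath I) u v = detourLength n →
        ∃ x ∈ landmarks I (sampleBits c n) ω, ddist (if b then I.OnPath else OffPath I) u x +
          ddist (if b then I.OnPath else OffPath I) x v = detourLength n := by
      intro b u v huv
      obtain ⟨S, hS, hSb⟩ := card_between huv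
      obtain ⟨x, hx, hl⟩ := hhit (u, v, b) (by
        refine le_trans (by omega : detourLength n ≤ S.card) (Finset.card_le_card fun w hw => ?_)
        simpa using hSb w hw)
      exact ⟨x, .inr (.inr hl), by simpa using hx⟩
    refine {
      pos_K := by omega
      card := ?_
      connected := hd
      hit_path := by simpa using hhit' true
      hit_off := by simpa using hhit' false
      key_injective := vertexKey_injective
      key_source := by simp [vertexKey]
      key_target := fun h => by simp [vertexKey, h.symm]
      source_mem := .inl rfl
      target_mem := .inr (.inl rfl)
      key_le := fun v => ?_
      le_range := by omega
      card_le := by omega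
      size := fun x y δ hx hy hδ =>
        triple_lt_two_pow (q := fieldBits κ c n) (by omega) (by omega) (by omega) }
    · have hlt : (Finset.univ.filter fun v => Lucky (sampleBits c n) ω v).card
          ≤ sampleBound c n := by
        by_contra! hc
        obtain ⟨S, hS, hcard⟩ := Finset.exists_subset_card_eq hc.le
        exact hfew S hcard fun v hv => (Finset.mem_filter.1 (hS hv)).2
      have hsub : landmarks I (sampleBits c n) ω ⊆
          ((Finset.univ.filter fun v => Lucky (sampleBits c n) ω v) ∪ {I.source, I.target} :
            Finset V) := by
        rintro v (h | h | h) <;> simp [h]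
      refine (Set.encard_le_encard hsub).trans ?_
      rw [Set.encard_coe_eq_coe_finsetCard]
      exact_mod_cast (Finset.card_union_le _ _).trans (add_le_add hlt Finset.card_le_two)
    · have := hid v
      unfold vertexKey
      split_ifs <;> omega
  · simp only [Fintype.card_prod, Fintype.card_bool, ← hn]
    nlinarith

theorem reach_of_walk {G : SimpleGraph V} {u v : V} (p : G.Walk u v) :
    Reach G.Adj p.length u v := by
  induction p with
  | nil => rfl
  | cons h p ih =>
    rw [SimpleGraph.Walk.length_cons, add_comm]
    exact (reach_one.2 h).trans ih

theorem exists_depth [Fintype V] (I : RPathsInstance V) : ∃ dep : V → ℕ,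
    (∀ v, ddist I.network.link.Adj I.source v = dep v) ∧ ∀ v, dep v ≤ I.diam := by
  have h : ∀ v, ddist I.network.link.Adj I.source v ≤ I.diam := by
    intro v
    obtain ⟨p, hp⟩ := I.connected.exists_walk_length_eq_dist I.source v
    refine (reach_of_walk p).ddist_le.trans ?_
    rw [hp]
    have : Nonempty V := ⟨I.source⟩
    exact_mod_cast SimpleGraph.dist_le_diam
      (SimpleGraph.connected_iff_ediam_ne_top.1 I.connected)
  have h' : ∀ v, ∃ m : ℕ, ddist I.network.link.Adj I.source v = m := fun v =>
    ⟨_, (ENat.natCast_toNat (ne_top_of_le_ne_top (ENat.natCast_ne_top _) (h v))).symm⟩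
  choose dep hdep using h'
  exact ⟨dep, hdep, fun v => by exact_mod_cast hdep v ▸ h v⟩

/-- For the least such `k > 0`, the guess `2 ^ (k - 1)` is still below some depth, hence below `D`.
The `+ 1` covers `k = 0`. -/
theorem exists_scale [Fintype V] {dep : V → ℕ} {D : ℕ} (h : ∀ v, dep v ≤ D) :
    ∃ k, (∀ v, dep v ≤ 2 ^ k) ∧ (∀ j < k, ∃ v, 2 ^ j < dep v) ∧ 2 ^ k ≤ 2 * D + 1 := by
  classical
  have hex : ∃ k, ∀ v, dep v ≤ 2 ^ k := ⟨D, fun v => (h v).trans Nat.lt_two_pow_self.le⟩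
  have hmin : ∀ j < Nat.find hex, ∃ v, 2 ^ j < dep v := fun j hj => by
    simpa using Nat.find_min hex hj
  refine ⟨_, Nat.find_spec hex, hmin, ?_⟩
  rcases Nat.eq_zero_or_pos (Nat.find hex) with h0 | h0
  · rw [h0]; omega
  · obtain ⟨v, hv⟩ := hmin (Nat.find hex - 1) (by omega)
    have := h v
    calc 2 ^ Nat.find hex = 2 ^ (Nat.find hex - 1) * 2 := by
          rw [← pow_succ]; congr 1; omega
      _ ≤ _ := by omega

theorem runs_attempt_none [Fintype V] {κ c b k : ℕ} {dep : V → ℕ} (hb : 1 ≤ b)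
    (hdep : ∀ v, ddist I.network.link.Adj I.source v = dep v) (hk : ∃ v, 2 ^ k < dep v)
    (ω : RandomStrings V) :
    Runs I.network b (fun v => attempt κ c (DistAlgorithm.view I.network I.localInput v) (ω v) k)
      (3 * 2 ^ k + 1) fun _ => none := by
  have htime : 3 * 2 ^ k + 1 = 2 ^ k + ((2 * 2 ^ k + 1) + 0) + 0 := by ring
  rw [htime]
  exact (runs_census_none hdep hk hb).bind (T' := 0) (.ret _)

/-- The number of rounds of a successful attempt. -/
noncomputable def attemptTime (c n k : ℕ) : ℕ :=
  2 ^ k + ((2 * 2 ^ k + 1) + (1 + (2 ^ k + (2 ^ k + 0)))) +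
    (5 * (detourLength n + 1 + (sampleBound c n + 2) +
      (2 * 2 ^ k + (sampleBound c n + 2) * (sampleBound c n + 2) + 1)) + 2 * detourLength n + 0)

theorem runs_attempt [Fintype V] {κ c b k : ℕ} {dep : V → ℕ}
    (hdep : ∀ v, ddist I.network.link.Adj I.source v = dep v) (hk : ∀ v, dep v ≤ 2 ^ k)
    (hsize : ∀ u r, r ≤ Fintype.card V → Nat.pair (I.network.id u) r + 1 < 2 ^ b)
    (hb : 4 * fieldBits κ c (Fintype.card V) + 1 ≤ b) (ω : RandomStrings V) :
    ∃ a : V → ℕ∞, Runs I.network b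
      (fun v => attempt κ c (DistAlgorithm.view I.network I.localInput v) (ω v) k)
      (attemptTime c (Fintype.card V) k) (fun v => some (a v)) ∧
      ∀ M, GoodParams I (4 * fieldBits κ c (Fintype.card V) + 1)
        (detourLength (Fintype.card V)) (sampleBound c (Fintype.card V) + 2) (2 * 2 ^ k) M
        (landmarks I (sampleBits c (Fintype.card V)) ω) (vertexKey I) →
        ∀ i : Fin I.hops, a (vert I i) = I.replacementLength i := by
  obtain ⟨a, ha, has⟩ := runs_solve (I := I) hb (detourLength (Fintype.card V))
    (sampleBound c (Fintype.card V) + 2) (2 * 2 ^ k)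
    (landmarks I (sampleBits c (Fintype.card V)) ω) (vertexKey I)
  exact ⟨a, (runs_census hdep hk hsize).bind (ha.bind (T' := 0) (.ret _)), has⟩

/-- The failed guesses form a geometric sum comparable to `2 ^ k`. In the successful one `z` occurs
`7` times, and `K` and `K²` `5` times each, where `K ≤ K²` and `K²` has the factor `100`; hence
`1007`. -/
theorem sum_attempts_le {c n k D : ℕ} (hn : 1 ≤ n) (hk : 2 ^ k ≤ 2 * D + 1) :
    ∑ j ∈ Finset.range k, (3 * 2 ^ j + 1) + attemptTime c n k ≤
      38 * D + 31 + 1007 * ((c + 4) * bitLength n) ^ 2 * cbrt n ^ 2 := by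
  have hsum : ∑ j ∈ Finset.range k, (3 * 2 ^ j + 1) + 3 = 3 * 2 ^ k + k := by
    clear hk
    induction k with
    | zero => rfl
    | succ k ih => rw [Finset.sum_range_succ, pow_succ]; omega
  have hk' : k < 2 ^ k := Nat.lt_two_pow_self
  have hK := sampleBound_le (c := c) hn
  have hK2 : sampleBound c n + 2 ≤ (sampleBound c n + 2) * (sampleBound c n + 2) :=
    Nat.le_mul_of_pos_left _ (by omega)
  have hKK := Nat.mul_le_mul hK hK
  have h1 : 1 ≤ ((c + 4) * bitLength n) ^ 2 :=
    Nat.one_le_pow _ _ (Nat.mul_pos (by omega) (bitLength_pos n))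
  have hz : detourLength n ≤ ((c + 4) * bitLength n) ^ 2 * cbrt n ^ 2 :=
    Nat.le_mul_of_pos_left _ h1
  have heq : 10 * ((c + 4) * bitLength n * cbrt n) * (10 * ((c + 4) * bitLength n * cbrt n)) =
      100 * (((c + 4) * bitLength n) ^ 2 * cbrt n ^ 2) := by ring
  rw [heq] at hKK
  rw [mul_assoc, attemptTime]
  omega

end Algorithm

end Congest

open Congest in
theorem theorem1p1 (κ c : ℕ) :
    ∃ (A : DistAlgorithm RPathsInput ℕ∞) (B C k : ℕ),
      ∀ (V : Type) [Fintype V] (I : RPathsInstance V),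
        (∀ v : V, I.id v < 2 ^ (κ * bitLength (Fintype.card V))) →
        A.MessagesBoundedBy I.network I.localInput (B * bitLength (Fintype.card V)) ∧
        ∃ T : ℕ,
          (T : ℝ) ≤ C * (bitLength (Fintype.card V) : ℝ) ^ k *
            ((Fintype.card V : ℝ) ^ (2 / 3 : ℝ) + I.diam) ∧
          A.HaltsWithin I.network I.localInput T ∧
          coinMeasure V {ω | ¬ I.SolvedBy A T ω} ≤ ((Fintype.card V : ENNReal) ^ c)⁻¹ := by
  -- Five fields contain the `4 * fieldBits + 1` bits of the longest messages. The constant `5000`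
  -- dominates `4 * 1007 + 31`, the `4` coming from `cbrt_sq_le`; the exponent `2` of the logarithm
  -- comes from `K²`.
  refine ⟨compile (attempt κ c), 5 * (κ + c + 12), 5000 * (c + 4) ^ 2, 2, ?_⟩
  intro V _ I hid
  obtain ⟨dep, hdep, hD⟩ := exists_depth I
  obtain ⟨k, hk, hk', hk2⟩ := exists_scale hD
  have hn1 : 1 ≤ Fintype.card V := Fintype.card_pos_iff.2 ⟨I.source⟩
  have hl := bitLength_pos (Fintype.card V)
  have hq : 1 ≤ fieldBits κ c (Fintype.card V) := Nat.mul_pos (by omega) hl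
  have hbq : 5 * (κ + c + 12) * bitLength (Fintype.card V) =
      5 * fieldBits κ c (Fintype.card V) := by rw [fieldBits, mul_assoc]
  rw [hbq]
  obtain ⟨hr1, -, hr3⟩ := ranges_lt (κ := κ) (c := c) hn1
  have hsize : ∀ u r, r ≤ Fintype.card V →
      Nat.pair (I.network.id u) r + 1 < 2 ^ (5 * fieldBits κ c (Fintype.card V)) := by
    intro u r hr
    have hu : I.network.id u < 2 ^ (κ * bitLength (Fintype.card V)) := hid u
    have h1 := pair_lt_two_pow (x := I.network.id u) (y := r)
      (q := fieldBits κ c (Fintype.card V)) (by omega) (by omega)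
    have h2 : 2 ^ (2 * fieldBits κ c (Fintype.card V)) < 2 ^ (5 * fieldBits κ c (Fintype.card V)) :=
      Nat.pow_lt_pow_right (by norm_num) (by omega)
    omega
  choose a ha has using fun ω : RandomStrings V =>
    runs_attempt (κ := κ) (c := c) (b := 5 * fieldBits κ c (Fintype.card V)) hdep hk hsize
      (by omega) ω
  have hpos : 1 ≤ attemptTime c (Fintype.card V) k := by unfold attemptTime; omega
  obtain ⟨hmsg, hout⟩ := compile_spec (N := I.network) (x := I.localInput)
    (b := 5 * fieldBits κ c (Fintype.card V)) (body := attempt κ c) (y := a) (k₀ := k)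
    (T := fun j => if j < k then 3 * 2 ^ j else attemptTime c (Fintype.card V) k - 1)
    (fun ω j hj => by
      simpa only [hj, if_true] using runs_attempt_none (by omega) hdep (hk' j hj) ω)
    (fun ω => by
      simpa only [lt_irrefl, if_false, Nat.sub_add_cancel hpos] using ha ω)
  have hT : ∑ j ∈ Finset.range (k + 1),
      ((if j < k then 3 * 2 ^ j else attemptTime c (Fintype.card V) k - 1) + 1) =
      ∑ j ∈ Finset.range k, (3 * 2 ^ j + 1) + attemptTime c (Fintype.card V) k := by
    rw [Finset.sum_range_succ, if_neg (lt_irrefl k), Nat.sub_add_cancel hpos]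
    congr 1
    exact Finset.sum_congr rfl fun j hj => by rw [if_pos (Finset.mem_range.1 hj)]
  rw [hT] at hout
  refine ⟨hmsg, _, ?_, fun ω v => by rw [hout]; rfl, ?_⟩
  · have hle := sum_attempts_le (c := c) hn1 hk2
    have hle' : ((∑ j ∈ Finset.range k, (3 * 2 ^ j + 1) +
        attemptTime c (Fintype.card V) k : ℕ) : ℝ) ≤ 38 * I.diam + 31 +
        1007 * (((c : ℝ) + 4) * bitLength (Fintype.card V)) ^ 2 * (cbrt (Fintype.card V) : ℝ) ^ 2 := by
      exact_mod_cast hle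
    have hX : (1 : ℝ) ≤ (Fintype.card V : ℝ) ^ (2 / 3 : ℝ) :=
      Real.one_le_rpow (by exact_mod_cast hn1) (by norm_num)
    have hy := cbrt_sq_le hn1
    have hDn : (0 : ℝ) ≤ I.diam := Nat.cast_nonneg _
    have hQ : (1 : ℝ) ≤ (((c : ℝ) + 4) * bitLength (Fintype.card V)) ^ 2 := by
      have h4 : 1 ≤ (c + 4) * bitLength (Fintype.card V) := Nat.mul_pos (by omega) hl
      exact one_le_pow₀ (by exact_mod_cast h4)
    push_cast
    generalize (Fintype.card V : ℝ) ^ (2 / 3 : ℝ) = X at *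
    rw [show 5000 * ((c : ℝ) + 4) ^ 2 * (bitLength (Fintype.card V) : ℝ) ^ 2 =
      5000 * (((c : ℝ) + 4) * bitLength (Fintype.card V)) ^ 2 by ring]
    push_cast at hle'
    generalize (((c : ℝ) + 4) * bitLength (Fintype.card V)) ^ 2 = Q at *
    calc _ ≤ _ := hle'
      _ ≤ 38 * (I.diam : ℝ) + 31 + 1007 * Q * (4 * X) := by gcongr
      _ ≤ _ := by nlinarith [mul_nonneg (sub_nonneg.2 hQ) hDn, mul_nonneg (sub_nonneg.2 hQ)
                    (sub_nonneg.2 hX)]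
  -- Any two vertices are joined through the source by a walk with at most `2 * 2 ^ k` steps, the
  -- diameter bound used in the last phase. A wrong output is possible only if `GoodParams` fails.
  · refine le_trans (measure_mono ?_) (coinMeasure_not_goodParams (κ := κ) (d := 2 * 2 ^ k) c hid ?_)
    · intro ω
      simp only [Set.mem_ofPred_eq]
      refine mt fun h i => ?_
      rw [hout, vert_castSucc, has ω _ h i]
    · intro u v
      have hreach : ∀ w, Reach I.network.link.Adj (dep w) I.source w := fun w =>
        exists_reach_of_eq (hdep w)
      exact ⟨dep u + dep v, by have := hk u; have := hk v; omega,
        (reach_symm (fun _ _ h => h.symm) (hreach u)).trans (hreach v)⟩
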